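/- **Setting.** Let $N\ge 2$ be even, let $\mathcal A$ be the algebra of operators on the Fock space $(\mathbb C^2)^{\otimes N/2}$ of $N/2$ fermionic modes, and let $\gamma_1,\dots,\gamma_N\in\mathcal A$ be the Majorana operators, $c_j^*+c_j$ and $i(c_j^*-c_j)$ for each mode $j$. For $X\subset[N]$ put $\gamma_X=i^{r_X}\prod_{x\in X}\gamma_x$ (increasing order), with $r_X=0$ if $|X|\equiv 0,1 \pmod 4$ and $r_X=1$ otherwise; these are Hermitian. Every $A\in\mathcal A$ has a unique expansion $A=\sum_X a_X\gamma_X$; its degree $\deg A$ is the largest $|X|$ with $a_X\ne0$ (and $0$ for $A=0$). Let $\|A\|_F=\sqrt{\operatorname{tr}(A^*A)}$ with the normalized trace, $\operatorname{tr}(1)=1$. Let $0\le u\le 1$ and let $H=H_0+uV$ be Hermitian, where all strings in the expansion of $H_0$ have length $2$, all strings in the expansion of $V$ have length $4$, and all coefficients of $H_0$ and $V$ have modulus at most $1$. Suppose $H$ is $\Delta$-sparse: each $i\in[N]$ lies in at most $\Delta$ of the sets $X$ for which $\gamma_X$ has nonzero coefficient in $H$. For $t\ge0$ let $A(t)=e^{iHt}Ae^{-iHt}$.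 **Majorana Propagation** with time step $\delta t>0$ and truncation degree $\ell\ge\deg A$: split the terms of $H$ greedily into groups, $H=H^1+\dots+H^G$ with $G\le4\Delta$, such that within each group the strings are pairwise disjoint; let $T_s=\tau^G_s\circ\dots\circ\tau^1_s$ with $\tau^g_s(B)=e^{isH^g}Be^{-isH^g}$, and let $\mathrm{Trunc}_\ell$ discard all strings of length larger than $\ell$. With $K=\lfloor t/\delta t\rfloor$, the output is $$\tilde A=\mathrm{Trunc}_\ell\circ T_{t-K\delta t}\circ(\mathrm{Trunc}_\ell\circ T_{\delta t})^{K}(A).$$ The input consists of the lists of the terms of $H$ and of the Majorana expansion of $A$. The output is a list of monomials representing $\tilde A$. It is computed on such lists of monomials: each monomial is rotated by the terms of each group in turn, and monomials with equal strings are collected. Complexity is the number of elementary operations. An arithmetic operation on exact real or complex numbers (including $\cos$ and $\sin$) counts as one operation, as does an operation on a bit, a machine word or a list cell. Strings are bit vectors of length $N$. **Corollary.** For all $\Delta$ and $d$ in $\mathbb N$ there is a constant $C>0$, depending only on $\Delta$ and $d$, such that for all $t\ge 0$ and $0<\varepsilon<1$ there are parameters $\delta t>0$ and $\ell\in\mathbb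 N$, depending only on $\Delta,d,t,\varepsilon$, with $$d\le\ell\le d+C\log\frac{1+t}{\varepsilon},$$ for which the following holds. For every $N$, $u$ and $H=H_0+uV$ as above and every $A\in\mathcal A$ with $\deg A=d$, if $$16e^2\,\Delta\,(\deg A+2)\,t\le\log(e/u)$$ (no condition on $t$ when $u=0$), then Majorana Propagation with parameters $\delta t,\ell$ computes $\tilde A$, as a Majorana polynomial of degree at most $\ell$, with $$\|A(t)-\tilde A\|_F\le\varepsilon\|A\|_F,$$ in complexity at most $N^{\,C\left(1+\log\frac{1+t}{\varepsilon}\right)}$. -/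

import Mathlib

open scoped Matrix symmDiff

namespace MajoranaPropagation

noncomputable section

/-! ## The Majorana algebra on the fermionic Fock space

With `N = 2 * m` Majorana modes there are `m` fermionic modes. The occupation number basis of the
Fock space is indexed by the set of occupied modes, and an observable is an operator on it. -/

/-- Operators on the Fock space of `m` fermionic modes, in the occupation number basis. -/
abbrev Obs (m : ℕ) := Matrix (Finset (Fin m)) (Finset (Fin m)) ℂ

/-- A subset of the `N = 2 * m` Majorana modes, the label of a Majorana string. -/
abbrev Str (m : ℕ) := Finset (Fin (2 * m))

/-- The creation operator `c_j^*`, where the basis vector of an occupied set `T` is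
`c_{j₁}^* ⋯ c_{jᵣ}^* |vacuum⟩` with `j₁ < ⋯ < jᵣ` the elements of `T`. -/
def creation {m : ℕ} (j : Fin m) : Obs m :=
  fun S T => if j ∉ T ∧ S = insert j T then (-1) ^ (T.filter (fun i => i < j)).card else 0

/-- The annihilation operator `c_j`. -/
def annihilation {m : ℕ} (j : Fin m) : Obs m := (creation j)ᴴ

/-- The Majorana operators (modes are numbered from `0`): `γ_{2j} = c_j^* + c_j` and
`γ_{2j+1} = i (c_j^* - c_j)`. -/
def majorana {m : ℕ} (i : Fin (2 * m)) : Obs m :=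
  let j : Fin m := ⟨i.val / 2, by omega⟩
  if i.val % 2 = 0 then creation j + annihilation j
  else Complex.I • (creation j - annihilation j)

/-- The exponent `r_X` of `i` in a Majorana string of length `k = |X|`. -/
def phaseExp (k : ℕ) : ℕ := if k % 4 = 0 ∨ k % 4 = 1 then 0 else 1

/-- The Hermitian Majorana string `γ_X = i^{r_X} ∏_{x ∈ X} γ_x`, factors in increasing order. -/
def majoranaString {m : ℕ} (X : Str m) : Obs m :=
  Complex.I ^ phaseExp X.card • ((X.sort (· ≤ ·)).map majorana).prod

/-- The normalized trace, `tr 1 = 1`. -/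
def ntr {m : ℕ} (A : Obs m) : ℂ := A.trace / 2 ^ m

/-- The coefficient `a_X` in the unique expansion `A = ∑_X a_X γ_X`. The strings are orthonormal
for the inner product `tr (A^* B)`, so it is `tr (γ_X^* A)`. -/
def coeff {m : ℕ} (A : Obs m) (X : Str m) : ℂ := ntr ((majoranaString X)ᴴ * A)

/-- The degree of an observable, the largest length of a string in its expansion
(`0` for `A = 0`). -/
def deg {m : ℕ} (A : Obs m) : ℕ :=
  ((Finset.univ : Finset (Str m)).filter (fun X => coeff A X ≠ 0)).sup Finset.card

/-- The normalized Frobenius norm `‖A‖_F = √(tr (A^* A))`. -/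
def frobNorm {m : ℕ} (A : Obs m) : ℝ := Real.sqrt (ntr (Aᴴ * A)).re

/-- The Heisenberg evolution `e^{iHt} A e^{-iHt}`. -/
def heisenberg {m : ℕ} (H : Obs m) (t : ℝ) (A : Obs m) : Obs m :=
  NormedSpace.exp ((Complex.I * (t : ℂ)) • H) * A * NormedSpace.exp (-((Complex.I * (t : ℂ)) • H))

/-! ## Hamiltonians -/

/-- An interaction of order `k`: all strings in the expansion have length `k`, and the
coefficients have modulus at most `1`. Quadratic is `k = 2`, quartic is `k = 4`. -/
def IsInteraction {m : ℕ} (k : ℕ) (H : Obs m) : Prop :=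
  ∀ X : Str m, (coeff H X ≠ 0 → X.card = k) ∧ ‖coeff H X‖ ≤ 1

/-- `Δ`-sparse: every Majorana mode occurs in at most `Δ` terms of the Hamiltonian. -/
def IsSparse {m : ℕ} (Δ : ℕ) (H : Obs m) : Prop :=
  ∀ i : Fin (2 * m),
    ((Finset.univ : Finset (Str m)).filter (fun X => i ∈ X ∧ coeff H X ≠ 0)).card ≤ Δ

/-! ## Majorana polynomials as data -/

/-- A Majorana polynomial as a list of monomials `a γ_X`. -/
abbrev Poly (m : ℕ) := List (Str m × ℂ)

/-- The terms `h_X γ_X` of a (Hermitian) Hamiltonian; the coefficients are real. -/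
abbrev Terms (m : ℕ) := List (Str m × ℝ)

/-- The operator that a Majorana polynomial represents. -/
def polyOp {m : ℕ} (P : Poly m) : Obs m := (P.map (fun p => p.2 • majoranaString p.1)).sum

/-- The operator that a list of Hamiltonian terms represents. -/
def termsOp {m : ℕ} (L : Terms m) : Obs m :=
  (L.map (fun p => (p.2 : ℂ) • majoranaString p.1)).sum

/-- `P` lists the Majorana expansion of `A`: the strings with nonzero coefficient, once each. -/
def IsExpansion {m : ℕ} (P : Poly m) (A : Obs m) : Prop :=
  (P.map Prod.fst).Nodup ∧ (∀ p ∈ P, p.2 ≠ 0) ∧ polyOp P = A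

/-- `L` lists the terms of the Hamiltonian `H`, once each. -/
def IsTermList {m : ℕ} (L : Terms m) (H : Obs m) : Prop :=
  (L.map Prod.fst).Nodup ∧ (∀ p ∈ L, p.2 ≠ 0) ∧ termsOp L = H

/-- A decomposition `H = H^1 + ⋯ + H^G` of the terms into groups, in each of which the strings
have pairwise disjoint supports. -/
def IsDecomposition {m : ℕ} (gs : List (Terms m)) (L : Terms m) : Prop :=
  gs.flatten.Perm L ∧ ∀ g ∈ gs, g.Pairwise (fun p q => Disjoint p.1 q.1)

/-! ## The operator that Majorana Propagation outputs -/

/-- One Trotter step `τ^G_s ∘ ⋯ ∘ τ^1_s` for the groups `H^1, …, H^G`. -/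
def trotterOp {m : ℕ} (gs : List (Terms m)) (s : ℝ) (A : Obs m) : Obs m :=
  gs.foldl (fun B g => heisenberg (termsOp g) s B) A

/-- Truncation: discard all strings of length larger than `ℓ`. -/
def truncOp {m : ℕ} (ℓ : ℕ) (A : Obs m) : Obs m :=
  ∑ X ∈ (Finset.univ : Finset (Str m)).filter (fun X => X.card ≤ ℓ), coeff A X • majoranaString X

/-- `⌊t/δt⌋` Trotter steps of size `δt` and one of the remaining size, each followed by a
truncation. -/
def mpOp {m : ℕ} (gs : List (Terms m)) (δt : ℝ) (ℓ : ℕ) (t : ℝ) (A : Obs m) : Obs m :=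
  truncOp ℓ (trotterOp gs (t - (⌊t / δt⌋₊ : ℝ) * δt)
    ((fun B => truncOp ℓ (trotterOp gs δt B))^[⌊t / δt⌋₊] A))

/-! ## The algorithm with its running time

Running time is counted in elementary operations: one exact arithmetic operation on real or complex
numbers (including `cos` and `sin`), one operation on a bit, a machine word or a list cell.
A subset of the `N = 2 * m` modes is stored as a bit vector of length `N`, so that operations
on strings cost `N` or `N ^ 2`. Every recursive call is charged as well. -/

/-- A computation: its result and the number of elementary operations it used. -/
structure Counted (α : Type) where
  val : α
  cost : ℕ

instance : Monad Counted where
  pure a := ⟨a, 0⟩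
  bind x f := ⟨(f x.val).val, x.cost + (f x.val).cost⟩

/-- A loop iteration or a recursive call (including handling the list cell at hand). -/
def tick : Counted Unit := ⟨(), 1⟩

def cadd (x y : ℂ) : Counted ℂ := ⟨x + y, 1⟩
def cmul (x y : ℂ) : Counted ℂ := ⟨x * y, 1⟩
def rsub (x y : ℝ) : Counted ℝ := ⟨x - y, 1⟩
def rmul (x y : ℝ) : Counted ℝ := ⟨x * y, 1⟩
def rcos (x : ℝ) : Counted ℂ := ⟨(Real.cos x : ℂ), 1⟩
def rsin (x : ℝ) : Counted ℂ := ⟨(Real.sin x : ℂ), 1⟩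
def ipow (k : ℕ) : Counted ℂ := ⟨Complex.I ^ k, 1⟩

/-- `⌊x / y⌋`, by repeated subtraction. -/
def floorDiv (x y : ℝ) : Counted ℕ := ⟨⌊x / y⌋₊, 2 * ⌊x / y⌋₊ + 2⟩

/-- Comparison of two numbers. -/
def leNat (a b : ℕ) : Counted Bool := ⟨decide (a ≤ b), 1⟩

def strEq {m : ℕ} (X Y : Str m) : Counted Bool := ⟨decide (X = Y), 2 * m⟩
def strDisjoint {m : ℕ} (X Y : Str m) : Counted Bool := ⟨decide (Disjoint X Y), 2 * m⟩
def strOddOverlap {m : ℕ} (X Y : Str m) : Counted Bool :=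
  ⟨decide ((X ∩ Y).card % 2 = 1), 2 * m⟩
def strCard {m : ℕ} (X : Str m) : Counted ℕ := ⟨X.card, 2 * m⟩
def strSymmDiff {m : ℕ} (X Y : Str m) : Counted (Str m) := ⟨X ∆ Y, 2 * m⟩

/-- The number of pairs `(x, y)` in `X × Y` with `y < x`, by a loop over all pairs. -/
def strInversions {m : ℕ} (X Y : Str m) : Counted ℕ :=
  ⟨((X ×ˢ Y).filter (fun p => p.2 < p.1)).card, (2 * m) ^ 2⟩

/-- The product of two strings, as `γ_X γ_S = w γ_Z` with `Z = X ∆ S` and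
`w = i ^ (r_X + r_S - r_Z) (-1) ^ #{(x, s) ∈ X × S : s < x}`. -/
def strMul {m : ℕ} (X S : Str m) : Counted (Str m × ℂ) := do
  let Z ← strSymmDiff X S
  let inv ← strInversions X S
  let a ← strCard X
  let b ← strCard S
  let c ← strCard Z
  let w ← ipow (phaseExp a + phaseExp b + 3 * phaseExp c + 2 * inv)
  return (Z, w)

/-- Step 1: is `X` disjoint from all strings of the group? -/
def disjointFromAll {m : ℕ} (X : Str m) : Terms m → Counted Bool
  | [] => do
    tick
    return true
  | y :: g => do
    tick
    if ← strDisjoint X y.1 then disjointFromAll X g else return false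

/-- Put a term into the first group whose strings are all disjoint from it, or into a new group. -/
def placeTerm {m : ℕ} (x : Str m × ℝ) : List (Terms m) → Counted (List (Terms m))
  | [] => do
    tick
    return [[x]]
  | g :: gs => do
    tick
    if ← disjointFromAll x.1 g then return (x :: g) :: gs
    else
      let gs' ← placeTerm x gs
      return g :: gs'

/-- The greedy decomposition of the Hamiltonian terms into groups of disjoint strings. -/
def greedyGroups {m : ℕ} : Terms m → Counted (List (Terms m))
  | [] => do
    tick
    return []
  | x :: L => do
    tick
    let gs ← greedyGroups L
    placeTerm x gs

/-- The rotation of one monomial, `e^{i s h γ_X} (a γ_S) e^{-i s h γ_X}`, for `|X|` even: it is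
`a γ_S` if `|X ∩ S|` is even, and `a cos(2sh) γ_S + a i sin(2sh) γ_X γ_S` otherwise. -/
def rotateMono {m : ℕ} (s : ℝ) (x : Str m × ℝ) (q : Str m × ℂ) : Counted (Poly m) := do
  if ← strOddOverlap x.1 q.1 then
    let sh ← rmul s x.2
    let θ ← rmul 2 sh
    let c ← rcos θ
    let ca ← cmul c q.2
    let sn ← rsin θ
    let sa ← cmul sn q.2
    let isa ← cmul Complex.I sa
    let zw ← strMul x.1 q.1
    let b ← cmul isa zw.2
    return [(q.1, ca), (zw.1, b)]
  else return [q]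

/-- The rotation by one Hamiltonian term of every monomial in a list. -/
def rotateList {m : ℕ} (s : ℝ) (x : Str m × ℝ) : Poly m → Counted (Poly m)
  | [] => do
    tick
    return []
  | q :: P => do
    tick
    let r ← rotateMono s x q
    let R ← rotateList s x P
    return r ++ R

/-- The successive rotations of a list of monomials by all the terms of one group. -/
def rotateGroup {m : ℕ} (s : ℝ) : Terms m → Poly m → Counted (Poly m)
  | [], P => do
    tick
    return P
  | x :: g, P => do
    tick
    let R ← rotateList s x P
    rotateGroup s g R

/-- Add a monomial to a polynomial, collecting it with a monomial of the same string. -/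
def addMono {m : ℕ} (q : Str m × ℂ) : Poly m → Counted (Poly m)
  | [] => do
    tick
    return [q]
  | p :: P => do
    tick
    if ← strEq q.1 p.1 then
      let c ← cadd q.2 p.2
      return (p.1, c) :: P
    else
      let R ← addMono q P
      return p :: R

/-- Add a list of monomials to a polynomial. -/
def addPoly {m : ℕ} : Poly m → Poly m → Counted (Poly m)
  | [], R => do
    tick
    return R
  | q :: P, R => do
    tick
    let R' ← addMono q R
    addPoly P R'

/-- The evolution `τ^g_s` of a polynomial under one group. -/
def evolveGroup {m : ℕ} (s : ℝ) (g : Terms m) : Poly m → Counted (Poly m)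
  | [] => do
    tick
    return []
  | q :: P => do
    tick
    let R ← evolveGroup s g P
    let L ← rotateGroup s g [q]
    addPoly L R

/-- One Trotter step of a polynomial. -/
def trotterStep {m : ℕ} (s : ℝ) : List (Terms m) → Poly m → Counted (Poly m)
  | [], P => do
    tick
    return P
  | g :: gs, P => do
    tick
    let R ← evolveGroup s g P
    trotterStep s gs R

/-- Degree truncation of a polynomial. -/
def truncPoly {m : ℕ} (ℓ : ℕ) : Poly m → Counted (Poly m)
  | [] => do
    tick
    return []
  | q :: P => do
    tick
    let R ← truncPoly ℓ P
    let k ← strCard q.1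
    if ← leNat k ℓ then return q :: R else return R

/-- `K` Trotter steps of size `s`, each followed by a truncation. -/
def propagate {m : ℕ} (gs : List (Terms m)) (s : ℝ) (ℓ : ℕ) : ℕ → Poly m → Counted (Poly m)
  | 0, P => do
    tick
    return P
  | K + 1, P => do
    tick
    let Q ← trotterStep s gs P
    let R ← truncPoly ℓ Q
    propagate gs s ℓ K R

/-- The Majorana Propagation algorithm with time step `δt` and truncation degree `ℓ`, for the
Hamiltonian with terms `L`, the observable with expansion `P`, and the time horizon `t`. -/
def majoranaPropagation {m : ℕ} (L : Terms m) (P : Poly m) (δt : ℝ) (ℓ : ℕ) (t : ℝ) :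
    Counted (Poly m) := do
  let gs ← greedyGroups L
  let K ← floorDiv t δt
  let Q ← propagate gs δt ℓ K P
  let r ← rmul (K : ℝ) δt
  let s ← rsub t r
  let Q' ← trotterStep s gs Q
  truncPoly ℓ Q'

end

end MajoranaPropagation

open MajoranaPropagation

/-!
Majorana strings are orthonormal for the normalized trace, so every observable is a coefficient
vector on subsets of the modes whose Euclidean norm is the Frobenius norm
(`sum_coeff_smul`, `frobNorm_sq`), and the evolution under one string `X` of even length rotates
the pairs of coefficients at `S` and `X ∆ S` with odd `|X ∩ S|` (`coeff_heisenberg`). The error of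
Majorana Propagation is the sum over the steps of a Trotter error and a truncation error, because
the exact evolution is an isometry.

*Trotter error.* The commutator with a `Δ`-sparse Hamiltonian is, on observables of degree at most
`k`, a matrix with at most `Δ (k + 2)` nonzero entries in each row and column, so it has norm
`O(Δ k)`, whatever the number of modes (`frobNorm_adOp_le`). As only commutators with the input of
a step enter the second order Taylor bounds, and the input has degree at most `ℓ`, a step of length
`s` has an error `O(s² ℓ²)` with a constant depending on `Δ`
(`frobNorm_heisenberg_sub_trotterOp_le`).

*Truncation error.* Give the string `S` the weight `exp (∑ i ∈ S, μ i)`, at first with `μ i = 1`.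
Quadratic terms mix strings of equal weight and preserve the weighted norm. A quartic term rotates
by an angle `O(u s)` and changes the weight by a factor of at most `e²`, so it does not increase the
weighted norm if `μ` is lowered on its support by a suitable `O(u s)`
(`weightSq_heisenberg_quartic`). The terms of a group are disjoint, so each group lowers `μ` only
once at each mode. Over the whole evolution the loss is `O(Δ u t)`, and as
`u * log (e / u) ≤ 1` the assumption on `t` keeps it at most `1 / 4` (`weight_loss_le`). Hence
truncation at degree `ℓ` costs at most `exp (d - 3 (ℓ + 1) / 4) ‖A‖` in each step
(`frobNorm_sub_truncOp_le`), and `ℓ - d` of order `log ((1 + t) / ε)` suffices. When this logarithm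
is so small that `ℓ` has to be `d`, the time is short and the accuracy low, and a single step of
length `t` is good enough (`parameters_small`).

*Running time.* A group splits a monomial `S` into at most `2 ^ |S|` monomials, of length at most
`3 |S|`, so within one Trotter step all lengths stay below `3 ^ (4 Δ) ℓ`. Equal strings are
collected, hence the lists have length `N ^ O(ℓ)`, and the cost is a polynomial in the lengths
times the number of steps (`majoranaPropagation_cost_le_pow`).
-/

namespace MajoranaPropagation

variable {m : ℕ}

/-! ### The Clifford relations -/

/-- The sign of the fermionic mode `j` acting on the basis vector of the occupied set `T`. -/
def jwSign (j : Fin m) (T : Finset (Fin m)) : ℂ := (-1) ^ (T.filter (fun i => i < j)).card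

/-- The fermionic mode to which a Majorana operator belongs. -/
def site (i : Fin (2 * m)) : Fin m := ⟨i.val / 2, by omega⟩

/-- The only nonzero entry of a Majorana operator in the column of the occupied set `T`; it stands
in the row `T ∆ {site i}`. -/
def majoranaEntry (i : Fin (2 * m)) (T : Finset (Fin m)) : ℂ :=
  (if i.val % 2 = 0 then 1 else if site i ∈ T then -Complex.I else Complex.I) * jwSign (site i) T

lemma neg_one_pow_card_symmDiff_singleton (T : Finset (Fin m)) (k : Fin m) :
    (-1 : ℂ) ^ (T ∆ {k}).card = -(-1) ^ T.card := by
  by_cases hk : k ∈ T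
  · have h1 : T ∆ {k} = T.erase k := by
      ext x; simp only [Finset.mem_symmDiff, Finset.mem_singleton, Finset.mem_erase]
      grind
    have h2 := Finset.card_erase_add_one hk
    rw [h1, ← h2, pow_succ]; ring
  · have h1 : T ∆ {k} = insert k T := by
      ext x; simp only [Finset.mem_symmDiff, Finset.mem_singleton, Finset.mem_insert]
      grind
    rw [h1, Finset.card_insert_of_notMem hk, pow_succ]; ring

lemma jwSign_symmDiff (j k : Fin m) (T : Finset (Fin m)) :
    jwSign j (T ∆ {k}) = if k < j then -jwSign j T else jwSign j T := by
  unfold jwSign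
  split_ifs with h
  · rw [← neg_one_pow_card_symmDiff_singleton _ k]
    congr 2
    ext x; simp only [Finset.mem_filter, Finset.mem_symmDiff, Finset.mem_singleton]
    grind
  · congr 2
    ext x; simp only [Finset.mem_filter, Finset.mem_symmDiff, Finset.mem_singleton]
    grind

lemma jwSign_mul_self (j : Fin m) (T : Finset (Fin m)) : jwSign j T * jwSign j T = 1 := by
  rw [jwSign, ← pow_add, ← two_mul, pow_mul]; simp

lemma creation_apply (j : Fin m) (S T : Finset (Fin m)) :
    creation j S T = if S = T ∆ {j} ∧ j ∉ T then jwSign j T else 0 := by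
  unfold creation jwSign
  have : (j ∉ T ∧ S = insert j T) ↔ (S = T ∆ {j} ∧ j ∉ T) := by
    constructor
    · rintro ⟨h, rfl⟩
      refine ⟨?_, h⟩
      ext x; simp only [Finset.mem_symmDiff, Finset.mem_singleton, Finset.mem_insert]; grind
    · rintro ⟨rfl, h⟩
      refine ⟨h, ?_⟩
      ext x; simp only [Finset.mem_symmDiff, Finset.mem_singleton, Finset.mem_insert]; grind
  simp only [this]

lemma annihilation_apply (j : Fin m) (S T : Finset (Fin m)) :
    annihilation j S T = if S = T ∆ {j} ∧ j ∈ T then jwSign j T else 0 := by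
  rw [annihilation, Matrix.conjTranspose_apply, creation_apply]
  have : (T = S ∆ {j} ∧ j ∉ S) ↔ (S = T ∆ {j} ∧ j ∈ T) := by
    constructor
    · rintro ⟨rfl, h⟩
      refine ⟨by simp, by simp [Finset.mem_symmDiff, h]⟩
    · rintro ⟨rfl, h⟩
      refine ⟨by simp, by simp [Finset.mem_symmDiff, h]⟩
  simp only [this]
  split_ifs with h
  · have h2 := jwSign_symmDiff j j T
    rw [if_neg (lt_irrefl j), ← h.1] at h2
    rw [← h2]; simp [jwSign]
  · simp

lemma majorana_apply (i : Fin (2 * m)) (S T : Finset (Fin m)) :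
    majorana i S T = if S = T ∆ {site i} then majoranaEntry i T else 0 := by
  unfold majorana majoranaEntry
  change (if i.val % 2 = 0 then creation (site i) + annihilation (site i)
    else Complex.I • (creation (site i) - annihilation (site i))) S T = _
  by_cases h0 : i.val % 2 = 0 <;> by_cases h1 : S = T ∆ {site i} <;> by_cases h2 : site i ∈ T <;>
    simp [h0, creation_apply, annihilation_apply, h1, h2]

lemma majorana_mul_apply (i k : Fin (2 * m)) (S T : Finset (Fin m)) :
    (majorana i * majorana k) S T = if S = T ∆ {site k} ∆ {site i} then
      majoranaEntry i (T ∆ {site k}) * majoranaEntry k T else 0 := by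
  rw [Matrix.mul_apply, Finset.sum_eq_single (T ∆ {site k})]
  · simp only [majorana_apply]; simp
  · intro U _ hU
    rw [majorana_apply k, if_neg hU, mul_zero]
  · simp

lemma majorana_mul_self (i : Fin (2 * m)) : majorana i * majorana i = 1 := by
  ext S T
  rw [majorana_mul_apply, Matrix.one_apply]
  have h1 : T ∆ {site i} ∆ {site i} = T := by simp
  rw [h1]
  congr 1
  have h2 := jwSign_mul_self (site i) T
  unfold majoranaEntry
  rw [jwSign_symmDiff, if_neg (lt_irrefl _)]
  by_cases h0 : i.val % 2 = 0 <;> by_cases h3 : site i ∈ T <;>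
    simp [h0, h3, Finset.mem_symmDiff, h2, mul_mul_mul_comm]

lemma majorana_anticomm {i k : Fin (2 * m)} (hik : i ≠ k) :
    majorana i * majorana k = -(majorana k * majorana i) := by
  ext S T
  rw [Matrix.neg_apply, majorana_mul_apply, majorana_mul_apply, symmDiff_right_comm]
  split_ifs with h
  · unfold majoranaEntry
    rw [jwSign_symmDiff, jwSign_symmDiff]
    have hne : ¬ (site i = site k ∧ i.val % 2 = k.val % 2) := by
      rintro ⟨h1, h2⟩
      apply hik
      have := congrArg Fin.val h1
      simp only [site] at this
      apply Fin.ext; omega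
    rcases lt_trichotomy (site i) (site k) with h1 | h1 | h1
    · have h2 := h1.ne
      simp only [Finset.mem_symmDiff, Finset.mem_singleton, h1, h2, h2.symm, h1.not_gt, if_true,
        if_false, or_false, not_false_eq_true, and_true, false_and]
      ring
    · rw [h1]
      have h3 : i.val % 2 ≠ k.val % 2 := fun h => hne ⟨h1, h⟩
      by_cases h4 : site k ∈ T <;> by_cases h0 : i.val % 2 = 0 <;> by_cases h5 : k.val % 2 = 0 <;>
        simp [h4, h0, h5, Finset.mem_symmDiff] <;> first | omega | ring
    · have h2 := h1.ne
      simp only [Finset.mem_symmDiff, Finset.mem_singleton, h1, h2, h2.symm, h1.not_gt, if_true,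
        if_false, or_false, not_false_eq_true, and_true, false_and]
      ring
  · simp

lemma majorana_conjTranspose (i : Fin (2 * m)) : (majorana i)ᴴ = majorana i := by
  unfold majorana annihilation
  split_ifs
  · simp [add_comm]
  · simp only [Matrix.conjTranspose_smul, Matrix.conjTranspose_sub,
      Matrix.conjTranspose_conjTranspose]
    simp only [Complex.star_def, Complex.conj_I, neg_smul, ← smul_neg, neg_sub]

/-! ### Products of Majorana strings -/

/-- The ordered product `∏_{x ∈ X} γ_x`, without the phase. -/
def orderedProd (X : Str m) : Obs m := ((X.sort (· ≤ ·)).map majorana).prod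

lemma orderedProd_insert {a : Fin (2 * m)} {X : Str m} (h : ∀ x ∈ X, a < x) :
    orderedProd (insert a X) = majorana a * orderedProd X := by
  unfold orderedProd
  rw [Finset.sort_insert]
  · simp
  · exact fun b hb => (h b hb).le
  · exact fun ha => lt_irrefl _ (h a ha)

/-- Sorting `γ_i` into the ordered product moves it past the smaller factors. -/
lemma majorana_mul_orderedProd (i : Fin (2 * m)) (S : Str m) :
    majorana i * orderedProd S
      = (-1 : ℂ) ^ (S.filter (fun s => s < i)).card • orderedProd (S ∆ {i}) := by
  induction S using Finset.induction_on_min with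
  | empty =>
    have : ((∅ : Str m) ∆ {i}) = insert i ∅ := by simp
    rw [this, orderedProd_insert (by simp)]
    simp
  | insert a X hX ih =>
    have haX : a ∉ X := fun h => lt_irrefl _ (hX a h)
    rcases lt_trichotomy i a with h | h | h
    · have h1 : (insert a X).filter (fun s => s < i) = ∅ := by
        ext x; simp only [Finset.mem_filter, Finset.mem_insert]; grind
      have h2 : (insert a X) ∆ {i} = insert i (insert a X) := by
        ext x; simp only [Finset.mem_symmDiff, Finset.mem_insert, Finset.mem_singleton]; grind
      rw [h1, h2, orderedProd_insert (a := i)]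
      · simp
      · intro x hx; simp only [Finset.mem_insert] at hx; grind
    · subst h
      have h1 : (insert i X).filter (fun s => s < i) = ∅ := by
        ext x; simp only [Finset.mem_filter, Finset.mem_insert]; grind
      have h2 : (insert i X) ∆ {i} = X := by
        ext x; simp only [Finset.mem_symmDiff, Finset.mem_insert, Finset.mem_singleton]; grind
      rw [h1, h2, orderedProd_insert hX, ← mul_assoc, majorana_mul_self]
      simp
    · have h1 : (insert a X).filter (fun s => s < i) = insert a (X.filter (fun s => s < i)) := by
        ext x; simp only [Finset.mem_filter, Finset.mem_insert]; grind
      have h2 : (insert a X) ∆ {i} = insert a (X ∆ {i}) := by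
        ext x; simp only [Finset.mem_symmDiff, Finset.mem_insert, Finset.mem_singleton]; grind
      have h3 : ∀ x ∈ X ∆ {i}, a < x := by
        intro x hx; simp only [Finset.mem_symmDiff, Finset.mem_singleton] at hx; grind
      rw [h1, h2, orderedProd_insert hX, ← mul_assoc, majorana_anticomm h.ne', neg_mul, mul_assoc,
        ih, orderedProd_insert h3, Finset.card_insert_of_notMem (by simp [haX]), pow_succ]
      simp

/-- The number of pairs `(x, s) ∈ X × S` with `s < x`. -/
def inversions (X S : Str m) : ℕ := ((X ×ˢ S).filter (fun p => p.2 < p.1)).card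

lemma inversions_eq_sum (X S : Str m) :
    inversions X S = ∑ x ∈ X, (S.filter (fun s => s < x)).card := by
  unfold inversions
  rw [Finset.card_filter, Finset.sum_product]
  exact Finset.sum_congr rfl (fun x _ => (Finset.card_filter _ _).symm)

lemma inversions_add_inversions (X S : Str m) :
    inversions X S + inversions S X + (X ∩ S).card = X.card * S.card := by
  have h2 : inversions S X = ((X ×ˢ S).filter (fun p => p.1 < p.2)).card := by
    unfold inversions
    rw [Finset.card_filter, Finset.card_filter, Finset.sum_product, Finset.sum_product_right]
  have h3 : (X ∩ S).card = ((X ×ˢ S).filter (fun p => p.1 = p.2)).card := by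
    rw [Finset.card_filter, Finset.sum_product]
    simp only [Finset.sum_ite_eq]
    rw [← Finset.sum_filter, Finset.sum_const, smul_eq_mul, mul_one]
    congr 1
  rw [h2, h3, inversions, ← Finset.card_product, Finset.card_filter, Finset.card_filter,
    Finset.card_filter, ← Finset.sum_add_distrib, ← Finset.sum_add_distrib, Finset.card_eq_sum_ones]
  apply Finset.sum_congr rfl
  rintro ⟨a, b⟩ _
  rcases lt_trichotomy a b with h | h | h
  · simp [h, h.not_gt, h.ne]
  · simp [h]
  · simp [h, h.not_gt, h.ne']

lemma orderedProd_mul (X S : Str m) :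
    orderedProd X * orderedProd S = (-1 : ℂ) ^ inversions X S • orderedProd (X ∆ S) := by
  induction X using Finset.induction_on_min with
  | empty => simp [inversions, orderedProd, symmDiff]
  | insert a X hX ih =>
    have haX : a ∉ X := fun h => lt_irrefl _ (hX a h)
    have h1 : (X ∆ S).filter (fun s => s < a) = S.filter (fun s => s < a) := by
      ext x; simp only [Finset.mem_filter, Finset.mem_symmDiff]; grind
    have h2 : X ∆ S ∆ {a} = insert a X ∆ S := by
      ext x; simp only [Finset.mem_symmDiff, Finset.mem_insert, Finset.mem_singleton]; grind
    rw [orderedProd_insert hX, mul_assoc, ih, mul_smul_comm, majorana_mul_orderedProd, h1, h2,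
      smul_smul, ← pow_add, inversions_eq_sum (insert a X), Finset.sum_insert haX,
      ← inversions_eq_sum, add_comm]

lemma majoranaString_eq (X : Str m) :
    majoranaString X = Complex.I ^ phaseExp X.card • orderedProd X := rfl

/-- The scalar `w` in `γ_X γ_S = w γ_{X ∆ S}`. -/
def mulPhase (X S : Str m) : ℂ :=
  Complex.I ^ (phaseExp X.card + phaseExp S.card + 3 * phaseExp (X ∆ S).card + 2 * inversions X S)

lemma majoranaString_mul (X S : Str m) :
    majoranaString X * majoranaString S = mulPhase X S • majoranaString (X ∆ S) := by
  rw [majoranaString_eq, majoranaString_eq, majoranaString_eq, smul_mul_smul_comm, orderedProd_mul,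
    smul_smul, smul_smul, mulPhase]
  congr 1
  generalize phaseExp (X ∆ S).card = c
  have h4 : Complex.I ^ (3 * c) * Complex.I ^ c = 1 := by
    rw [← pow_add, show 3 * c + c = 4 * c by ring, pow_mul, Complex.I_pow_four, one_pow]
  have h2 : Complex.I ^ (2 * inversions X S) = (-1) ^ inversions X S := by
    rw [pow_mul, Complex.I_sq]
  rw [pow_add, pow_add, pow_add, h2]
  linear_combination (-(Complex.I ^ phaseExp X.card * Complex.I ^ phaseExp S.card *
    (-1) ^ inversions X S)) * h4

lemma norm_mulPhase (X S : Str m) : ‖mulPhase X S‖ = 1 := by simp [mulPhase]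

lemma majoranaString_empty : majoranaString (∅ : Str m) = 1 := by
  simp [majoranaString, phaseExp]

lemma majoranaString_mul_self (X : Str m) : majoranaString X * majoranaString X = 1 := by
  rw [majoranaString_mul, symmDiff_self, Finset.bot_eq_empty, majoranaString_empty]
  suffices h : mulPhase X X = 1 by rw [h, one_smul]
  have h1 := inversions_add_inversions X X
  rw [Finset.inter_self] at h1
  unfold mulPhase
  rw [symmDiff_self, Finset.bot_eq_empty, Finset.card_empty]
  have h2 : (phaseExp X.card + phaseExp X.card + 3 * phaseExp 0 + 2 * inversions X X) % 4 = 0 := by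
    generalize X.card = k at *
    generalize inversions X X = n at *
    have h3 : 2 * n + k = k * k := by omega
    have h4 : k % 4 = 0 ∨ k % 4 = 1 ∨ k % 4 = 2 ∨ k % 4 = 3 := by omega
    obtain ⟨q, r, hq, hr⟩ : ∃ q r, k = 4 * q + r ∧ r = k % 4 := ⟨k / 4, k % 4, by omega, rfl⟩
    have h5 : k * k = 4 * (4 * q * q + 2 * q * r) + r * r := by rw [hq]; ring
    generalize k * k = kk at *
    generalize (4 * q * q + 2 * q * r) = z at *
    unfold phaseExp
    rcases h4 with h | h | h | h <;> rw [h] at hr <;> subst hr <;> simp [h] <;> omega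
  rw [← Nat.div_add_mod (phaseExp X.card + phaseExp X.card + 3 * phaseExp 0 + 2 * inversions X X) 4,
    h2, add_zero, pow_mul, Complex.I_pow_four, one_pow]

lemma orderedProd_conjTranspose_mul (X : Str m) : (orderedProd X)ᴴ * orderedProd X = 1 := by
  induction X using Finset.induction_on_min with
  | empty => simp [orderedProd]
  | insert a X hX ih =>
    rw [orderedProd_insert hX, Matrix.conjTranspose_mul, majorana_conjTranspose, mul_assoc,
      ← mul_assoc (majorana a), majorana_mul_self, one_mul, ih]

lemma majoranaString_conjTranspose (X : Str m) : (majoranaString X)ᴴ = majoranaString X := by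
  have h1 : (majoranaString X)ᴴ * majoranaString X = 1 := by
    rw [majoranaString_eq, Matrix.conjTranspose_smul, smul_mul_smul_comm,
      orderedProd_conjTranspose_mul, star_pow, ← mul_pow]
    simp
  calc (majoranaString X)ᴴ = (majoranaString X)ᴴ * (majoranaString X * majoranaString X) := by
        rw [majoranaString_mul_self, mul_one]
    _ = majoranaString X := by rw [← mul_assoc, h1, one_mul]

/-- Two strings commute up to a sign. -/
lemma majoranaString_mul_comm_sign (X S : Str m) :
    majoranaString X * majoranaString S
      = (-1 : ℂ) ^ (X.card * S.card + (X ∩ S).card) • (majoranaString S * majoranaString X) := by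
  have h := inversions_add_inversions X S
  rw [majoranaString_mul, majoranaString_mul, smul_smul, symmDiff_comm S X]
  congr 1
  have h1 : X.card * S.card + (X ∩ S).card + inversions S X
      = inversions X S + 2 * (inversions S X + (X ∩ S).card) := by omega
  have h2 : ((-1 : ℂ) ^ (X.card * S.card + (X ∩ S).card)) * (-1) ^ inversions S X
      = (-1) ^ inversions X S := by
    rw [← pow_add, h1, pow_add, pow_mul]; simp
  unfold mulPhase
  rw [symmDiff_comm S X, pow_add, pow_add _ _ (2 * _), pow_mul _ 2, pow_mul _ 2, Complex.I_sq,
    ← h2]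
  ring

lemma majoranaString_comm_of_even {X S : Str m} (hX : Even X.card) (h : Even (X ∩ S).card) :
    majoranaString X * majoranaString S = majoranaString S * majoranaString X := by
  rw [majoranaString_mul_comm_sign X S, ((hX.mul_right _).add h).neg_one_pow, one_smul]

lemma majoranaString_anticomm_of_odd {X S : Str m} (hX : Even X.card) (h : Odd (X ∩ S).card) :
    majoranaString X * majoranaString S = -(majoranaString S * majoranaString X) := by
  rw [majoranaString_mul_comm_sign X S, ((hX.mul_right _).add_odd h).neg_one_pow, neg_one_smul]

/-! ### Orthonormality and completeness -/

lemma ntr_add (A B : Obs m) : ntr (A + B) = ntr A + ntr B := by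
  simp [ntr, Matrix.trace_add, add_div]

lemma ntr_smul (c : ℂ) (A : Obs m) : ntr (c • A) = c * ntr A := by
  simp [ntr, Matrix.trace_smul, mul_div_assoc]

lemma ntr_neg (A : Obs m) : ntr (-A) = -ntr A := by
  simp [ntr, Matrix.trace_neg, neg_div]

lemma ntr_mul_comm (A B : Obs m) : ntr (A * B) = ntr (B * A) := by
  rw [ntr, Matrix.trace_mul_comm, ntr]

lemma ntr_one : ntr (1 : Obs m) = 1 := by
  simp [ntr, Matrix.trace_one]

lemma ntr_majoranaString {X : Str m} (hX : X.Nonempty) : ntr (majoranaString X) = 0 := by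
  -- a Majorana operator that anticommutes with the string makes the trace vanish
  obtain ⟨i, hi⟩ : ∃ i : Fin (2 * m), Odd (({i} : Str m).card * X.card + ({i} ∩ X).card) := by
    rcases Nat.even_or_odd X.card with h | h
    · obtain ⟨i, hi⟩ := hX
      refine ⟨i, ?_⟩
      have : ({i} : Str m) ∩ X = {i} := by simp [hi]
      rw [this]
      simpa using h.add_one
    · have hne : X ≠ Finset.univ := by
        rintro rfl
        rw [Finset.card_univ, Fintype.card_fin] at h
        exact (Nat.not_odd_iff_even.2 (even_two_mul m)) h
      obtain ⟨i, hi⟩ : ∃ i, i ∉ X := by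
        by_contra hcon; push Not at hcon; exact hne (Finset.eq_univ_iff_forall.2 hcon)
      refine ⟨i, ?_⟩
      have : ({i} : Str m) ∩ X = ∅ := by simp [hi]
      rw [this]
      simpa using h
  have h1 := majoranaString_mul_comm_sign {i} X
  rw [hi.neg_one_pow, neg_one_smul] at h1
  have h2 : ntr (majoranaString X)
      = ntr (majoranaString {i} * (majoranaString {i} * majoranaString X)) := by
    rw [← mul_assoc, majoranaString_mul_self, one_mul]
  have h3 : ntr (majoranaString {i} * (majoranaString {i} * majoranaString X))
      = -ntr (majoranaString X) := by
    rw [h1, mul_neg, ntr_neg, ntr_mul_comm, mul_assoc, majoranaString_mul_self, mul_one]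
  rw [h3] at h2
  linear_combination h2 / 2

lemma ntr_majoranaString_mul (X S : Str m) :
    ntr (majoranaString X * majoranaString S) = if X = S then 1 else 0 := by
  split_ifs with h
  · rw [h, majoranaString_mul_self, ntr_one]
  · rw [majoranaString_mul, ntr_smul, ntr_majoranaString, mul_zero]
    rw [Finset.nonempty_iff_ne_empty, ← Finset.bot_eq_empty, Ne, symmDiff_eq_bot]
    exact h

lemma coeff_eq (A : Obs m) (X : Str m) : coeff A X = ntr (majoranaString X * A) := by
  rw [coeff, majoranaString_conjTranspose]

lemma coeff_add (A B : Obs m) (X : Str m) : coeff (A + B) X = coeff A X + coeff B X := by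
  rw [coeff, mul_add, ntr_add]; rfl

lemma coeff_smul (c : ℂ) (A : Obs m) (X : Str m) : coeff (c • A) X = c * coeff A X := by
  rw [coeff, mul_smul_comm, ntr_smul]; rfl

lemma coeff_majoranaString (S X : Str m) :
    coeff (majoranaString S) X = if X = S then 1 else 0 := by
  rw [coeff_eq, ntr_majoranaString_mul]

/-- The coefficient of `γ_X` as a linear functional of the observable. -/
noncomputable def coeffLinear (X : Str m) : Obs m →ₗ[ℂ] ℂ where
  toFun A := coeff A X
  map_add' A B := coeff_add A B X
  map_smul' c A := coeff_smul c A X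

lemma coeff_zero (X : Str m) : coeff (0 : Obs m) X = 0 := (coeffLinear X).map_zero

lemma coeff_sub (A B : Obs m) (X : Str m) : coeff (A - B) X = coeff A X - coeff B X :=
  (coeffLinear X).map_sub A B

lemma coeff_sum {ι : Type*} (s : Finset ι) (f : ι → Obs m) (X : Str m) :
    coeff (∑ i ∈ s, f i) X = ∑ i ∈ s, coeff (f i) X := map_sum (coeffLinear X) f s

lemma linearIndependent_majoranaString :
    LinearIndependent ℂ (majoranaString : Str m → Obs m) := by
  rw [Fintype.linearIndependent_iff]
  intro g hg X
  have h := congrArg (fun A => coeff A X) hg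
  simpa [coeff_sum, coeff_smul, coeff_majoranaString, coeff_zero] using h

/-- The expansion of an observable in Majorana strings. The strings are linearly independent, and
there are `2 ^ (2 * m)` of them, the dimension of the algebra. -/
lemma sum_coeff_smul (A : Obs m) : ∑ X : Str m, coeff A X • majoranaString X = A := by
  have hcard : Fintype.card (Str m) = Module.finrank ℂ (Obs m) := by
    rw [Module.finrank_matrix]
    simp [← pow_add, two_mul]
  have hspan := linearIndependent_majoranaString.span_eq_top_of_card_eq_finrank' (K := ℂ) hcard
  have hA : A ∈ Submodule.span ℂ (Set.range (majoranaString : Str m → Obs m)) := by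
    rw [hspan]; trivial
  obtain ⟨c, hc⟩ := (Submodule.mem_span_range_iff_exists_fun ℂ).1 hA
  have hcc : ∀ X, coeff A X = c X := by
    intro X
    rw [← hc]
    simp [coeff_sum, coeff_smul, coeff_majoranaString]
  simp only [hcc]
  exact hc

lemma coeff_ext {A B : Obs m} (h : ∀ X, coeff A X = coeff B X) : A = B := by
  rw [← sum_coeff_smul A, ← sum_coeff_smul B]; simp only [h]

lemma coeff_sum_smul (c : Str m → ℂ) (X : Str m) :
    coeff (∑ S, c S • majoranaString S) X = c X := by
  simp [coeff_sum, coeff_smul, coeff_majoranaString]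

/-- Parseval's identity for the orthonormal basis of Majorana strings. -/
lemma frobNorm_sq (A : Obs m) : frobNorm A ^ 2 = ∑ X : Str m, ‖coeff A X‖ ^ 2 := by
  have h1 : ntr (Aᴴ * A) = ∑ X : Str m, (‖coeff A X‖ ^ 2 : ℝ) := by
    conv_lhs => rw [← sum_coeff_smul A]
    rw [Matrix.conjTranspose_sum, Finset.sum_mul]
    have h2 : ∀ X : Str m, ntr ((coeff A X • majoranaString X)ᴴ *
        ∑ S : Str m, coeff A S • majoranaString S) = (‖coeff A X‖ ^ 2 : ℝ) := by
      intro X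
      rw [sum_coeff_smul, Matrix.conjTranspose_smul, majoranaString_conjTranspose, smul_mul_assoc,
        ntr_smul, ← coeff_eq]
      have := Complex.conj_mul' (coeff A X)
      simpa using this
    have h3 : ∀ (s : Finset (Str m)) (f : Str m → Obs m),
        ntr (∑ i ∈ s, f i) = ∑ i ∈ s, ntr (f i) := by
      intro s f
      simp [ntr, Matrix.trace_sum, Finset.sum_div]
    rw [h3]
    push_cast
    exact Finset.sum_congr rfl (fun X _ => by rw [h2]; push_cast; rfl)
  rw [frobNorm, Real.sq_sqrt]
  · rw [h1]; norm_cast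
  · rw [h1, Complex.ofReal_re]; positivity

lemma frobNorm_nonneg (A : Obs m) : 0 ≤ frobNorm A := Real.sqrt_nonneg _

/-! ### The Frobenius norm -/

section FrobeniusNorm

attribute [local instance] Matrix.frobeniusNormedAddCommGroup Matrix.frobeniusNormedSpace
  Matrix.frobeniusNormedRing Matrix.frobeniusNormedAlgebra

lemma frobNorm_eq_norm (A : Obs m) : frobNorm A = ‖A‖ / Real.sqrt (2 ^ m) := by
  have h1 : (ntr (Aᴴ * A)).re = (∑ i, ∑ j, ‖A i j‖ ^ 2) / 2 ^ m := by
    have h2 : ntr (Aᴴ * A) = (((∑ i, ∑ j, ‖A i j‖ ^ 2) / 2 ^ m : ℝ) : ℂ) := by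
      rw [ntr, Matrix.trace]
      simp only [Matrix.diag_apply, Matrix.mul_apply, Matrix.conjTranspose_apply]
      rw [Finset.sum_comm]
      push_cast
      congr 1
      refine Finset.sum_congr rfl fun i _ => Finset.sum_congr rfl fun j _ => ?_
      exact Complex.conj_mul' (A i j)
    rw [h2, Complex.ofReal_re]
  rw [frobNorm, h1, Real.sqrt_div (by positivity), Matrix.frobenius_norm_def, Real.sqrt_eq_rpow]
  simp

lemma frobNorm_add_le (A B : Obs m) : frobNorm (A + B) ≤ frobNorm A + frobNorm B := by
  simp only [frobNorm_eq_norm, ← add_div]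
  exact div_le_div_of_nonneg_right (norm_add_le A B) (Real.sqrt_nonneg _)

lemma frobNorm_smul (c : ℂ) (A : Obs m) : frobNorm (c • A) = ‖c‖ * frobNorm A := by
  simp only [frobNorm_eq_norm, norm_smul, mul_div_assoc]

lemma frobNorm_neg (A : Obs m) : frobNorm (-A) = frobNorm A := by
  simp only [frobNorm_eq_norm, norm_neg]

lemma frobNorm_zero : frobNorm (0 : Obs m) = 0 := by simp [frobNorm_eq_norm]

lemma frobNorm_sub_le (A B : Obs m) : frobNorm (A - B) ≤ frobNorm A + frobNorm B := by
  rw [sub_eq_add_neg, ← frobNorm_neg B]; exact frobNorm_add_le _ _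

/-- The mean value inequality in the normalized Frobenius norm. -/
lemma frobNorm_sub_le_of_deriv {f f' : ℝ → Obs m} {s c : ℝ} (hs : 0 ≤ s)
    (hf : ∀ r, HasDerivAt f (f' r) r) (hc : ∀ r ∈ Set.Ico 0 s, frobNorm (f' r) ≤ c) :
    frobNorm (f s - f 0) ≤ s * c := by
  have h0 : (0 : ℝ) < Real.sqrt (2 ^ m) := Real.sqrt_pos.2 (by positivity)
  have h := norm_image_sub_le_of_norm_deriv_le_segment' (f := f) (f' := f') (a := 0) (b := s)
    (C := c * Real.sqrt (2 ^ m)) (fun r _ => (hf r).hasDerivWithinAt) (fun r hr => by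
      have := hc r hr
      rwa [frobNorm_eq_norm, div_le_iff₀ h0] at this) s ⟨hs, le_rfl⟩
  rw [frobNorm_eq_norm, div_le_iff₀ h0]
  calc _ ≤ _ := h
    _ = _ := by ring

/-! ### The Heisenberg evolution -/

lemma hasDerivAt_exp_I_smul (H : Obs m) (s : ℝ) :
    HasDerivAt (fun r : ℝ => NormedSpace.exp ((Complex.I * (r : ℂ)) • H))
      (NormedSpace.exp ((Complex.I * (s : ℂ)) • H) * (Complex.I • H)) s := by
  have h := hasDerivAt_exp_smul_const (𝕂 := ℝ) (Complex.I • H) s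
  have h1 : ∀ r : ℝ, r • (Complex.I • H) = (Complex.I * (r : ℂ)) • H := by
    intro r
    rw [← smul_assoc, Complex.real_smul, mul_comm]
  simp only [h1] at h
  exact h

lemma exp_I_smul_neg (H : Obs m) (s : ℝ) :
    NormedSpace.exp (-((Complex.I * (s : ℂ)) • H))
      = NormedSpace.exp ((Complex.I * ((-s : ℝ) : ℂ)) • H) := by
  congr 1
  rw [← neg_smul]; push_cast; ring_nf

lemma heisenberg_eq (H : Obs m) (s : ℝ) (B : Obs m) :
    heisenberg H s B = NormedSpace.exp ((Complex.I * (s : ℂ)) • H) * B *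
      NormedSpace.exp ((Complex.I * ((-s : ℝ) : ℂ)) • H) := by
  rw [heisenberg, exp_I_smul_neg]

lemma exp_I_smul_mul_neg (H : Obs m) (s : ℝ) :
    NormedSpace.exp ((Complex.I * (s : ℂ)) • H) *
      NormedSpace.exp ((Complex.I * ((-s : ℝ) : ℂ)) • H) = 1 := by
  rw [← exp_I_smul_neg, ← Matrix.exp_add_of_commute]
  · simp
  · exact (Commute.refl _).neg_right

lemma commute_exp_I_smul (H : Obs m) (s : ℝ) :
    NormedSpace.exp ((Complex.I * (s : ℂ)) • H) * H
      = H * NormedSpace.exp ((Complex.I * (s : ℂ)) • H) := by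
  have : Commute ((Complex.I * (s : ℂ)) • H) H := (Commute.refl H).smul_left _
  exact this.exp_left.eq

/-- The generator `B ↦ i [H, B]` of the Heisenberg evolution. -/
def adOp (H B : Obs m) : Obs m := Complex.I • (H * B - B * H)

lemma adOp_add_left (H K B : Obs m) : adOp (H + K) B = adOp H B + adOp K B := by
  simp only [adOp, ← smul_add]; congr 1; noncomm_ring

lemma adOp_zero_left (B : Obs m) : adOp 0 B = 0 := by simp [adOp]

lemma heisenberg_zero_time (H B : Obs m) : heisenberg H 0 B = B := by simp [heisenberg]

lemma heisenberg_add (H : Obs m) (s : ℝ) (A B : Obs m) :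
    heisenberg H s (A + B) = heisenberg H s A + heisenberg H s B := by
  simp [heisenberg, mul_add, add_mul]

lemma heisenberg_sub (H : Obs m) (s : ℝ) (A B : Obs m) :
    heisenberg H s (A - B) = heisenberg H s A - heisenberg H s B := by
  simp [heisenberg, mul_sub, sub_mul]

lemma heisenberg_smul (H : Obs m) (s : ℝ) (c : ℂ) (A : Obs m) :
    heisenberg H s (c • A) = c • heisenberg H s A := by
  simp [heisenberg]

lemma heisenberg_zero (H : Obs m) (s : ℝ) : heisenberg H s 0 = 0 := by simp [heisenberg]

lemma heisenberg_hamiltonian_zero (s : ℝ) (B : Obs m) : heisenberg 0 s B = B := by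
  simp [heisenberg]

lemma heisenberg_add_time (H : Obs m) (s r : ℝ) (B : Obs m) :
    heisenberg H (s + r) B = heisenberg H s (heisenberg H r B) := by
  have h : ∀ a b : ℝ, NormedSpace.exp ((Complex.I * ((a + b : ℝ) : ℂ)) • H) =
      NormedSpace.exp ((Complex.I * (a : ℂ)) • H) *
        NormedSpace.exp ((Complex.I * (b : ℂ)) • H) := by
    intro a b
    rw [← Matrix.exp_add_of_commute]
    · push_cast; rw [mul_add, add_smul]
    · exact ((Commute.refl H).smul_left _).smul_right _
  rw [heisenberg_eq, heisenberg_eq, heisenberg_eq, h, neg_add_rev, h]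
  simp only [mul_assoc]

lemma heisenberg_add_of_commute {H K : Obs m} (h : Commute H K) (s : ℝ) (B : Obs m) :
    heisenberg (H + K) s B = heisenberg K s (heisenberg H s B) := by
  have h2 : ∀ a : ℝ, NormedSpace.exp ((Complex.I * (a : ℂ)) • (H + K)) =
      NormedSpace.exp ((Complex.I * (a : ℂ)) • H) *
        NormedSpace.exp ((Complex.I * (a : ℂ)) • K) := by
    intro a
    rw [← Matrix.exp_add_of_commute, smul_add]
    exact (h.smul_left _).smul_right _
  have h3 : ∀ a : ℝ, NormedSpace.exp ((Complex.I * (a : ℂ)) • (H + K)) =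
      NormedSpace.exp ((Complex.I * (a : ℂ)) • K) *
        NormedSpace.exp ((Complex.I * (a : ℂ)) • H) := by
    intro a
    rw [← Matrix.exp_add_of_commute, add_comm H K, smul_add]
    exact (h.symm.smul_left _).smul_right _
  rw [heisenberg_eq, heisenberg_eq, heisenberg_eq, h2 (-s), h3 s]
  simp only [mul_assoc]

lemma hasDerivAt_heisenberg (H B : Obs m) (s : ℝ) :
    HasDerivAt (fun r : ℝ => heisenberg H r B) (heisenberg H s (adOp H B)) s := by
  have h1 := hasDerivAt_exp_I_smul H s
  have h2 := (hasDerivAt_exp_I_smul H (-s)).scomp s (hasDerivAt_neg s)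
  have h3 := (h1.mul_const B).mul h2
  have h4 : (fun r : ℝ => heisenberg H r B)
      = (fun r : ℝ => NormedSpace.exp ((Complex.I * (r : ℂ)) • H) * B) *
        ((fun r : ℝ => NormedSpace.exp ((Complex.I * (r : ℂ)) • H)) ∘ Neg.neg) := by
    funext r
    simp only [Pi.mul_apply, Function.comp, heisenberg_eq]
  rw [h4]
  refine h3.congr_deriv ?_
  rw [heisenberg_eq, adOp]
  simp only [Function.comp, neg_smul, one_smul]
  have h5 := commute_exp_I_smul H (-s)
  rw [mul_smul_comm, mul_smul_comm, h5]
  simp only [mul_smul_comm, smul_mul_assoc, mul_neg, mul_sub, sub_mul, smul_sub, mul_assoc]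
  rw [sub_eq_add_neg]

/-- The evolution is adjoint to the backward evolution for the trace. -/
lemma ntr_mul_heisenberg (H : Obs m) (s : ℝ) (S B : Obs m) :
    ntr (S * heisenberg H s B) = ntr (heisenberg H (-s) S * B) := by
  rw [heisenberg_eq, heisenberg_eq, neg_neg, ← mul_assoc, ← mul_assoc, ntr_mul_comm]
  simp only [mul_assoc]

lemma frobNorm_heisenberg {H : Obs m} (hH : H.IsHermitian) (s : ℝ) (B : Obs m) :
    frobNorm (heisenberg H s B) = frobNorm B := by
  have h1 : ∀ r : ℝ, (NormedSpace.exp ((Complex.I * (r : ℂ)) • H))ᴴ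
      = NormedSpace.exp ((Complex.I * ((-r : ℝ) : ℂ)) • H) := by
    intro r
    rw [← Matrix.exp_conjTranspose, Matrix.conjTranspose_smul, hH.eq]
    congr 2
    simp
  have h2 : (heisenberg H s B)ᴴ = heisenberg H s Bᴴ := by
    rw [heisenberg_eq, heisenberg_eq, Matrix.conjTranspose_mul, Matrix.conjTranspose_mul, h1, h1,
      neg_neg, mul_assoc]
  have h3 : ntr ((heisenberg H s B)ᴴ * heisenberg H s B) = ntr (Bᴴ * B) := by
    rw [h2, ntr_mul_heisenberg, ← heisenberg_add_time, neg_add_cancel, heisenberg_zero_time]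
  rw [frobNorm, h3, frobNorm]

/-- First order Taylor bound for the Heisenberg evolution. -/
lemma frobNorm_heisenberg_sub_le {H : Obs m} (hH : H.IsHermitian) {s : ℝ} (hs : 0 ≤ s)
    (B : Obs m) : frobNorm (heisenberg H s B - B) ≤ s * frobNorm (adOp H B) := by
  have h := frobNorm_sub_le_of_deriv (f := fun r => heisenberg H r B) hs
    (fun r => hasDerivAt_heisenberg H B r) (c := frobNorm (adOp H B))
    (fun r _ => (frobNorm_heisenberg hH r _).le)
  simpa only [heisenberg_zero_time] using h

/-- Second order Taylor bound for the Heisenberg evolution. -/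
lemma frobNorm_heisenberg_sub_sub_le {H : Obs m} (hH : H.IsHermitian) {s : ℝ} (hs : 0 ≤ s)
    (B : Obs m) :
    frobNorm (heisenberg H s B - B - (s : ℂ) • adOp H B)
      ≤ s ^ 2 * frobNorm (adOp H (adOp H B)) := by
  have hd : ∀ r : ℝ, HasDerivAt (fun r : ℝ => heisenberg H r B - (r : ℂ) • adOp H B)
      (heisenberg H r (adOp H B) - adOp H B) r := by
    intro r
    have h1 : HasDerivAt (fun r : ℝ => (r : ℂ) • adOp H B) ((1 : ℂ) • adOp H B) r :=
      Complex.ofRealCLM.hasDerivAt.smul_const (adOp H B)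
    rw [one_smul] at h1
    exact (hasDerivAt_heisenberg H B r).sub h1
  have h := frobNorm_sub_le_of_deriv hs hd (c := s * frobNorm (adOp H (adOp H B)))
    (fun r hr => (frobNorm_heisenberg_sub_le hH hr.1 _).trans
      (mul_le_mul_of_nonneg_right hr.2.le (frobNorm_nonneg _)))
  have h2 : heisenberg H s B - B - (s : ℂ) • adOp H B
      = heisenberg H s B - (s : ℂ) • adOp H B
        - (heisenberg H 0 B - ((0 : ℝ) : ℂ) • adOp H B) := by
    rw [heisenberg_zero_time]; simp; abel
  rw [h2]
  calc _ ≤ _ := h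
    _ = _ := by ring

/-! ### Rotation by one Majorana string -/

lemma exp_I_smul_majoranaString (X : Str m) (θ : ℝ) :
    NormedSpace.exp ((Complex.I * (θ : ℂ)) • majoranaString X)
      = (Real.cos θ : ℂ) • (1 : Obs m) + (Complex.I * (Real.sin θ : ℂ)) • majoranaString X := by
  -- both sides solve the same linear differential equation
  let f : ℝ → Obs m := fun r => NormedSpace.exp ((Complex.I * (r : ℂ)) • majoranaString X) *
    ((Real.cos r : ℂ) • (1 : Obs m) - (Complex.I * (Real.sin r : ℂ)) • majoranaString X)
  have hf : ∀ r, HasDerivAt f 0 r := by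
    intro r
    have h1 := hasDerivAt_exp_I_smul (majoranaString X) r
    have h2 : HasDerivAt (fun r : ℝ => (Real.cos r : ℂ) • (1 : Obs m))
        (((-Real.sin r : ℝ) : ℂ) • (1 : Obs m)) r :=
      (Real.hasDerivAt_cos r).ofReal_comp.smul_const _
    have h3 : HasDerivAt (fun r : ℝ => (Complex.I * (Real.sin r : ℂ)) • majoranaString X)
        ((Complex.I * (Real.cos r : ℂ)) • majoranaString X) r :=
      ((Real.hasDerivAt_sin r).ofReal_comp.const_mul Complex.I).smul_const _
    refine (h1.mul (h2.sub h3)).congr_deriv ?_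
    rw [mul_assoc, ← mul_add, Pi.sub_apply]
    have h4 := majoranaString_mul_self X
    rw [show (Complex.I • majoranaString X * ((Real.cos r : ℂ) • (1 : Obs m) -
      (Complex.I * (Real.sin r : ℂ)) • majoranaString X) + (((-Real.sin r : ℝ) : ℂ) • (1 : Obs m) -
      (Complex.I * (Real.cos r : ℂ)) • majoranaString X)) = 0 from ?_, mul_zero]
    rw [mul_sub, smul_mul_smul_comm, smul_mul_smul_comm, h4, mul_one, ← mul_assoc, Complex.I_mul_I]
    push_cast
    rw [neg_one_mul, neg_smul]
    abel
  have hconst := is_const_of_deriv_eq_zero (fun r => (hf r).differentiableAt)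
    (fun r => (hf r).deriv) (-θ) 0
  have h0 : f 0 = 1 := by simp [f]
  rw [h0] at hconst
  have h5 := congrArg
    (fun A => NormedSpace.exp ((Complex.I * (θ : ℂ)) • majoranaString X) * A) hconst
  simp only [f, ← mul_assoc, exp_I_smul_mul_neg, mul_one, one_mul] at h5
  rw [← h5]
  simp [Real.cos_neg, Real.sin_neg]

end FrobeniusNorm

lemma heisenberg_majoranaString_of_even {X S : Str m} (hX : Even X.card) (h : Even (X ∩ S).card)
    (a : ℂ) (s : ℝ) :
    heisenberg (a • majoranaString X) s (majoranaString S) = majoranaString S := by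
  have h1 : Commute (majoranaString X) (majoranaString S) := majoranaString_comm_of_even hX h
  have h2 : Commute (NormedSpace.exp ((Complex.I * (s : ℂ)) • a • majoranaString X))
      (majoranaString S) := ((h1.smul_left a).smul_left _).exp_left
  rw [heisenberg_eq, h2.eq, mul_assoc, exp_I_smul_mul_neg, mul_one]

lemma heisenberg_majoranaString_of_odd {X S : Str m} (hX : Even X.card) (h : Odd (X ∩ S).card)
    (a s : ℝ) : heisenberg ((a : ℂ) • majoranaString X) s (majoranaString S)
      = (Real.cos (2 * (s * a)) : ℂ) • majoranaString S
        + (Complex.I * (Real.sin (2 * (s * a)) : ℂ)) • (majoranaString X * majoranaString S) := by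
  have h1 : ∀ r : ℝ, (Complex.I * (r : ℂ)) • (a : ℂ) • majoranaString X
      = (Complex.I * ((r * a : ℝ) : ℂ)) • majoranaString X := by
    intro r; rw [smul_smul]; push_cast; ring_nf
  have h2 := majoranaString_anticomm_of_odd hX h
  rw [heisenberg_eq, h1, h1, neg_mul, exp_I_smul_majoranaString, exp_I_smul_majoranaString]
  generalize s * a = θ
  have h3 : majoranaString S * ((Real.cos (-θ) : ℂ) • (1 : Obs m) +
      (Complex.I * (Real.sin (-θ) : ℂ)) • majoranaString X) = ((Real.cos θ : ℂ) • (1 : Obs m) +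
      (Complex.I * (Real.sin θ : ℂ)) • majoranaString X) * majoranaString S := by
    rw [mul_add, add_mul, mul_smul_comm, mul_smul_comm, smul_mul_assoc, smul_mul_assoc, h2]
    simp [Real.cos_neg, Real.sin_neg]
  rw [mul_assoc, h3, ← mul_assoc, ← smul_mul_assoc, Real.cos_two_mul', Real.sin_two_mul]
  have h4 := majoranaString_mul_self X
  have h5 : Complex.I * (Real.sin θ : ℂ) * (Complex.I * (Real.sin θ : ℂ))
      = -(Real.sin θ : ℂ) ^ 2 := by
    linear_combination (Real.sin θ : ℂ) ^ 2 * Complex.I_mul_I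
  have h6 : ((Real.cos θ : ℂ) • (1 : Obs m) + (Complex.I * (Real.sin θ : ℂ)) • majoranaString X) *
      ((Real.cos θ : ℂ) • (1 : Obs m) + (Complex.I * (Real.sin θ : ℂ)) • majoranaString X)
      = ((Real.cos θ ^ 2 - Real.sin θ ^ 2 : ℝ) : ℂ) • (1 : Obs m)
        + (Complex.I * ((2 * Real.sin θ * Real.cos θ : ℝ) : ℂ)) • majoranaString X := by
    simp only [mul_add, add_mul, smul_mul_smul_comm, mul_one, one_mul, h4, h5]
    push_cast
    module
  rw [h6, add_mul, smul_mul_assoc, one_mul]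

/-- The coefficients of an observable rotated by one string of even length. -/
lemma coeff_heisenberg {X : Str m} (hX : Even X.card) (a s : ℝ) (B : Obs m) (S : Str m) :
    coeff (heisenberg ((a : ℂ) • majoranaString X) s B) S
      = if Odd (X ∩ S).card then
          (Real.cos (2 * (s * a)) : ℂ) * coeff B S
            - Complex.I * (Real.sin (2 * (s * a)) : ℂ) * mulPhase X S * coeff B (X ∆ S)
        else coeff B S := by
  rw [coeff_eq, ntr_mul_heisenberg]
  split_ifs with h
  · rw [heisenberg_majoranaString_of_odd hX h, add_mul, ntr_add, smul_mul_assoc, smul_mul_assoc,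
      ntr_smul, ntr_smul, ← coeff_eq, majoranaString_mul, smul_mul_assoc, ntr_smul, ← coeff_eq,
      neg_mul, mul_neg, Real.cos_neg, Real.sin_neg]
    push_cast
    ring
  · rw [heisenberg_majoranaString_of_even hX (Nat.not_odd_iff_even.1 h), ← coeff_eq]

/-! ### Degrees and commutators with sparse Hamiltonians -/

/-- All strings in the expansion of `B` have length at most `k`. -/
def DegLE (k : ℕ) (B : Obs m) : Prop := ∀ X : Str m, coeff B X ≠ 0 → X.card ≤ k

lemma degLE_deg (A : Obs m) : DegLE (deg A) A := fun X hX =>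
  Finset.le_sup (f := Finset.card) (Finset.mem_filter.2 ⟨Finset.mem_univ X, hX⟩)

lemma DegLE.deg_le {k : ℕ} {B : Obs m} (h : DegLE k B) : deg B ≤ k :=
  Finset.sup_le fun X hX => h X (Finset.mem_filter.1 hX).2

lemma DegLE.mono {k l : ℕ} {B : Obs m} (h : DegLE k B) (hkl : k ≤ l) : DegLE l B :=
  fun X hX => (h X hX).trans hkl

lemma card_symmDiff_add (X Z : Str m) :
    (X ∆ Z).card + 2 * (X ∩ Z).card = X.card + Z.card := by
  have h1 : (X ∆ Z).card = (X \ Z).card + (Z \ X).card := by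
    rw [symmDiff_def, Finset.sup_eq_union, Finset.card_union_of_disjoint disjoint_sdiff_sdiff]
  have h2 := Finset.card_sdiff_add_card_inter X Z
  have h3 := Finset.card_sdiff_add_card_inter Z X
  rw [Finset.inter_comm Z X] at h3
  omega

lemma card_inter_symmDiff (X Z : Str m) : (X ∩ (X ∆ Z)).card + (X ∩ Z).card = X.card := by
  have h1 : X ∩ (X ∆ Z) = X \ Z := by
    ext x; simp only [Finset.mem_inter, Finset.mem_symmDiff, Finset.mem_sdiff]; tauto
  rw [h1, Finset.card_sdiff_add_card_inter]

lemma odd_card_inter_symmDiff {X : Str m} (hX : Even X.card) (Z : Str m) :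
    Odd (X ∩ (X ∆ Z)).card ↔ Odd (X ∩ Z).card := by
  have h := card_inter_symmDiff X Z
  rw [← h] at hX
  exact Nat.even_add'.1 hX

lemma card_symmDiff_le_add_two {X Z : Str m} (h4 : X.card ≤ 4) (h : Odd (X ∩ Z).card) :
    (X ∆ Z).card ≤ Z.card + 2 := by
  have h1 := card_symmDiff_add X Z
  have h2 := h.pos
  omega

/-- The terms of a list have strings of even length at most `4` and coefficients of modulus at most
`1`, and every mode occurs in at most `Δ` of them. -/
def SparseTerms (Δ : ℕ) (L : Terms m) : Prop :=
  (∀ p ∈ L, Even p.1.card ∧ p.1.card ≤ 4 ∧ |p.2| ≤ 1) ∧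
    ∀ i, L.countP (fun p => decide (i ∈ p.1)) ≤ Δ

lemma SparseTerms.sublist {Δ : ℕ} {L L' : Terms m} (h : SparseTerms Δ L) (hs : L'.Sublist L) :
    SparseTerms Δ L' :=
  ⟨fun p hp => h.1 p (hs.subset hp), fun i => hs.countP_le.trans (h.2 i)⟩

lemma SparseTerms.perm {Δ : ℕ} {L L' : Terms m} (h : SparseTerms Δ L) (hs : L'.Perm L) :
    SparseTerms Δ L' :=
  ⟨fun p hp => h.1 p (hs.subset hp), fun i => (hs.countP_eq _).le.trans (h.2 i)⟩

lemma countP_le_sum {q : Str m × ℝ → Prop} [DecidablePred q] {S : Str m} (L : Terms m)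
    (h : ∀ p, q p → ¬Disjoint S p.1) :
    L.countP (fun p => decide (q p)) ≤ ∑ i ∈ S, L.countP (fun p => decide (i ∈ p.1)) := by
  induction L with
  | nil => simp
  | cons p L ih =>
    simp only [List.countP_cons, Finset.sum_add_distrib]
    refine add_le_add ih ?_
    split_ifs with ho
    · obtain ⟨i, hi, hip⟩ := Finset.not_disjoint_iff.1 (h p (by simpa using ho))
      calc 1 = if decide (i ∈ p.1) = true then 1 else 0 := by simp [hip]
        _ ≤ _ := Finset.single_le_sum
          (f := fun i => if decide (i ∈ p.1) = true then 1 else 0) (by simp) hi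
    · exact Nat.zero_le _

lemma not_disjoint_of_odd {X S : Str m} (h : Odd (X ∩ S).card) : ¬Disjoint S X := by
  rw [disjoint_comm, Finset.disjoint_iff_inter_eq_empty]
  intro h0
  rw [h0] at h
  simp at h

lemma countP_odd_le {Δ : ℕ} {L : Terms m} (h : SparseTerms Δ L) (S : Str m) :
    L.countP (fun p => decide (Odd (p.1 ∩ S).card)) ≤ Δ * S.card := by
  calc _ ≤ _ := countP_le_sum L (S := S) fun p hp => not_disjoint_of_odd hp
    _ ≤ ∑ i ∈ S, Δ := Finset.sum_le_sum fun i _ => h.2 i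
    _ = Δ * S.card := by rw [Finset.sum_const, smul_eq_mul, mul_comm]

lemma termsOp_cons (x : Str m × ℝ) (L : Terms m) :
    termsOp (x :: L) = (x.2 : ℂ) • majoranaString x.1 + termsOp L := by simp [termsOp]

lemma termsOp_append (L L' : Terms m) : termsOp (L ++ L') = termsOp L + termsOp L' := by
  simp [termsOp]

lemma termsOp_nil : termsOp ([] : Terms m) = 0 := by simp [termsOp]

lemma termsOp_isHermitian (L : Terms m) : (termsOp L).IsHermitian := by
  induction L with
  | nil => rw [termsOp_nil]; exact Matrix.isHermitian_zero
  | cons x L ih =>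
    rw [termsOp_cons]
    refine Matrix.IsHermitian.add ?_ ih
    rw [Matrix.IsHermitian, Matrix.conjTranspose_smul, majoranaString_conjTranspose]
    simp

lemma norm_coeff_adOp_majoranaString {X : Str m} (hX : Even X.card) (a : ℝ) (B : Obs m)
    (Z : Str m) : ‖coeff (adOp ((a : ℂ) • majoranaString X) B) Z‖
      = if Odd (X ∩ Z).card then 2 * |a| * ‖coeff B (X ∆ Z)‖ else 0 := by
  have h1 : coeff (adOp ((a : ℂ) • majoranaString X) B) Z = Complex.I * a *
      (ntr ((majoranaString Z * majoranaString X) * B)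
        - ntr ((majoranaString X * majoranaString Z) * B)) := by
    rw [adOp, coeff_smul, coeff_sub, coeff_eq, coeff_eq, smul_mul_assoc, mul_smul_comm,
      mul_smul_comm, mul_smul_comm, ntr_smul, ntr_smul, ← mul_assoc _ B, ntr_mul_comm _
      (majoranaString X), mul_assoc, mul_assoc, mul_assoc]
    ring
  rw [h1]
  split_ifs with h
  · have h2 := majoranaString_anticomm_of_odd hX h
    rw [← neg_eq_iff_eq_neg] at h2
    rw [← h2, neg_mul, ntr_neg, majoranaString_mul, smul_mul_assoc, ntr_smul, ← coeff_eq,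
      show -(mulPhase X Z * coeff B (X ∆ Z)) - mulPhase X Z * coeff B (X ∆ Z)
        = -2 * mulPhase X Z * coeff B (X ∆ Z) by ring]
    simp only [norm_mul, norm_mulPhase, Complex.norm_I, Complex.norm_real, norm_neg,
      Complex.norm_ofNat, Real.norm_eq_abs]
    ring
  · rw [majoranaString_comm_of_even hX (Nat.not_odd_iff_even.1 h), sub_self, mul_zero, norm_zero]

lemma sum_getElem_ite (L : Terms m) (p : Str m × ℝ → Prop) [DecidablePred p] :
    ∑ k : Fin L.length, (if p L[k] then (1 : ℝ) else 0) = L.countP (fun x => decide (p x)) := by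
  induction L with
  | nil => simp
  | cons x L ih =>
    rw [List.countP_cons]
    push_cast
    rw [← ih]
    have := Fin.sum_univ_succ (n := L.length)
      (f := fun k : Fin (L.length + 1) => if p (x :: L)[k] then (1 : ℝ) else 0)
    simp only [List.length_cons] at this ⊢
    rw [this, add_comm]
    simp only [decide_eq_true_eq]
    rfl

lemma norm_coeff_adOp_le {Δ : ℕ} {L : Terms m} (h : SparseTerms Δ L) (B : Obs m) (Z : Str m) :
    ‖coeff (adOp (termsOp L) B) Z‖
      ≤ ∑ k : Fin L.length, if Odd (L[k].1 ∩ Z).card then 2 * ‖coeff B (L[k].1 ∆ Z)‖ else 0 := by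
  induction L with
  | nil => simp [termsOp_nil, adOp_zero_left, coeff_zero]
  | cons x L ih =>
    have h1 := ih (h.sublist (List.sublist_cons_self x L))
    rw [termsOp_cons, adOp_add_left, coeff_add]
    refine (norm_add_le _ _).trans ?_
    have := Fin.sum_univ_succ (n := L.length)
      (f := fun k : Fin (L.length + 1) => if Odd ((x :: L)[k].1 ∩ Z).card then
        2 * ‖coeff B ((x :: L)[k].1 ∆ Z)‖ else 0)
    simp only [List.length_cons] at this ⊢
    rw [this]
    refine add_le_add ?_ h1
    have hx := h.1 x List.mem_cons_self
    rw [norm_coeff_adOp_majoranaString hx.1]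
    by_cases ho : Odd (x.1 ∩ Z).card
    · have := mul_le_mul_of_nonneg_right hx.2.2 (norm_nonneg (coeff B (x.1 ∆ Z)))
      rw [if_pos ho, if_pos (by exact ho)]
      simp only [Fin.getElem_fin, Fin.val_zero, List.getElem_cons_zero]
      linarith
    · rw [if_neg ho, if_neg (by exact ho)]

lemma DegLE.adOp {Δ k : ℕ} {L : Terms m} (h : SparseTerms Δ L) {B : Obs m} (hB : DegLE k B) :
    DegLE (k + 2) (adOp (termsOp L) B) := by
  intro Z hZ
  by_contra hcon
  apply hZ
  have h1 := norm_coeff_adOp_le h B Z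
  rw [Finset.sum_eq_zero] at h1
  · exact norm_le_zero_iff.1 h1
  · intro j _
    split_ifs with ho
    · have hj := h.1 L[j] (List.getElem_mem j.2)
      have h2 : coeff B (L[j].1 ∆ Z) = 0 := by
        by_contra hne
        have h3 := hB _ hne
        have h4 := card_symmDiff_le_add_two hj.2.1 ((odd_card_inter_symmDiff hj.1 Z).2 ho)
        rw [symmDiff_symmDiff_cancel_left] at h4
        omega
      rw [h2]; simp
    · rfl

/-- Schur's test for the matrix that connects every string `Z` with the strings `X j ∆ Z` for which
`X j` overlaps `Z` oddly: if each string has at most `D` neighbours, the matrix has norm at most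
`D`. -/
lemma sum_sq_le_of_le_sum_symmDiff {J : Type*} [Fintype J] (X : J → Str m)
    (hX : ∀ j, Even (X j).card) {b c : Str m → ℝ} {D : ℝ} (hD : 0 ≤ D) (hc0 : ∀ Z, 0 ≤ c Z)
    (hc : ∀ Z, c Z ≤ ∑ j, if Odd (X j ∩ Z).card then 2 * b (X j ∆ Z) else 0)
    (hDb : ∀ S, b S ≠ 0 → ∑ j, (if Odd (X j ∩ S).card then (1 : ℝ) else 0) ≤ D)
    (hDc : ∀ Z, c Z ≠ 0 → ∑ j, (if Odd (X j ∩ Z).card then (1 : ℝ) else 0) ≤ D) :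
    ∑ Z, c Z ^ 2 ≤ (2 * D) ^ 2 * ∑ S, b S ^ 2 := by
  have hZ : ∀ Z : Str m, c Z ^ 2
      ≤ 4 * D * ∑ j, if Odd (X j ∩ Z).card then b (X j ∆ Z) ^ 2 else 0 := by
    intro Z
    have hnn : 0 ≤ ∑ j, if Odd (X j ∩ Z).card then b (X j ∆ Z) ^ 2 else 0 :=
      Finset.sum_nonneg fun j _ => by split_ifs <;> positivity
    by_cases hcZ : c Z = 0
    · rw [hcZ, zero_pow two_ne_zero]; positivity
    · have h2 := Finset.sum_mul_sq_le_sq_mul_sq Finset.univ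
        (fun j => if Odd (X j ∩ Z).card then (1 : ℝ) else 0)
        (fun j => if Odd (X j ∩ Z).card then 2 * b (X j ∆ Z) else 0)
      have h3 : ∀ j, (if Odd (X j ∩ Z).card then (1 : ℝ) else 0) *
          (if Odd (X j ∩ Z).card then 2 * b (X j ∆ Z) else 0) =
          if Odd (X j ∩ Z).card then 2 * b (X j ∆ Z) else 0 := by
        intro j; split_ifs <;> simp
      have h4 : ∀ j, (if Odd (X j ∩ Z).card then (1 : ℝ) else 0) ^ 2 =
          if Odd (X j ∩ Z).card then (1 : ℝ) else 0 := by
        intro j; split_ifs <;> simp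
      have h5 : ∀ j, (if Odd (X j ∩ Z).card then 2 * b (X j ∆ Z) else 0) ^ 2 =
          4 * if Odd (X j ∩ Z).card then b (X j ∆ Z) ^ 2 else 0 := by
        intro j; split_ifs
        · ring
        · simp
      simp only [h3, h4, h5] at h2
      rw [← Finset.mul_sum] at h2
      calc _ ≤ _ := pow_le_pow_left₀ (hc0 Z) (hc Z) 2
        _ ≤ _ := h2
        _ ≤ D * (4 * _) := mul_le_mul_of_nonneg_right (hDc Z hcZ) (by positivity)
        _ = _ := by ring
  calc ∑ Z, c Z ^ 2
      ≤ ∑ Z, 4 * D * ∑ j, (if Odd (X j ∩ Z).card then b (X j ∆ Z) ^ 2 else 0) :=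
        Finset.sum_le_sum fun Z _ => hZ Z
    _ = 4 * D * ∑ j, ∑ Z, (if Odd (X j ∩ Z).card then b (X j ∆ Z) ^ 2 else 0) := by
        rw [← Finset.mul_sum, Finset.sum_comm]
    _ = 4 * D * ∑ j, ∑ S, (if Odd (X j ∩ S).card then b S ^ 2 else 0) := by
        congr 1
        refine Finset.sum_congr rfl fun j _ => ?_
        refine Finset.sum_nbij' (fun Z => X j ∆ Z) (fun Z => X j ∆ Z) (by simp) (by simp)
          (by simp) (by simp) fun Z _ => ?_
        simp only [odd_card_inter_symmDiff (hX j) Z]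
    _ = 4 * D * ∑ S, b S ^ 2 * ∑ j, (if Odd (X j ∩ S).card then (1 : ℝ) else 0) := by
        rw [Finset.sum_comm]
        congr 1
        refine Finset.sum_congr rfl fun S _ => ?_
        rw [Finset.mul_sum]
        refine Finset.sum_congr rfl fun j _ => ?_
        split_ifs <;> simp
    _ ≤ 4 * D * ∑ S, b S ^ 2 * D := by
        refine mul_le_mul_of_nonneg_left (Finset.sum_le_sum fun S _ => ?_) (by positivity)
        by_cases hS : b S = 0
        · simp [hS]
        · exact mul_le_mul_of_nonneg_left (hDb S hS) (by positivity)
    _ = _ := by rw [← Finset.sum_mul]; ring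

/-- The commutator with a sparse Hamiltonian is bounded on observables of bounded degree, uniformly
in the number of modes. -/
lemma frobNorm_adOp_le {Δ k : ℕ} {L : Terms m} (h : SparseTerms Δ L) {B : Obs m}
    (hB : DegLE k B) : frobNorm (adOp (termsOp L) B) ≤ 2 * Δ * (k + 2) * frobNorm B := by
  have hcount : ∀ S : Str m, S.card ≤ k + 2 →
      ∑ j : Fin L.length, (if Odd (L[j].1 ∩ S).card then (1 : ℝ) else 0) ≤ Δ * (k + 2) := by
    intro S hS
    rw [sum_getElem_ite L (fun x => Odd (x.1 ∩ S).card)]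
    exact_mod_cast (countP_odd_le h S).trans (Nat.mul_le_mul_left _ hS)
  have hsq := sum_sq_le_of_le_sum_symmDiff (fun j : Fin L.length => L[j].1)
    (fun j => (h.1 L[j] (List.getElem_mem j.2)).1) (b := fun S => ‖coeff B S‖)
    (c := fun Z => ‖coeff (adOp (termsOp L) B) Z‖) (D := Δ * (k + 2)) (by positivity)
    (fun Z => norm_nonneg _) (norm_coeff_adOp_le h B)
    (fun S hS => hcount S ((hB S (norm_ne_zero_iff.1 hS)).trans (Nat.le_add_right k 2)))
    (fun Z hZ => hcount Z (hB.adOp h Z (norm_ne_zero_iff.1 hZ)))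
  rw [← frobNorm_sq, ← frobNorm_sq, ← mul_pow, ← mul_assoc] at hsq
  exact le_of_sq_le_sq hsq (by have := frobNorm_nonneg B; positivity)

/-! ### The Trotter error -/

lemma trotterOp_append (gs : List (Terms m)) (g : Terms m) (s : ℝ) (B : Obs m) :
    trotterOp (gs ++ [g]) s B = heisenberg (termsOp g) s (trotterOp gs s B) := by
  simp [trotterOp]

lemma frobNorm_adOp_adOp_le {Δ k : ℕ} {L L' : Terms m} (h : SparseTerms Δ L)
    (h' : SparseTerms Δ L') {B : Obs m} (hB : DegLE k B) :
    frobNorm (adOp (termsOp L') (adOp (termsOp L) B)) ≤ (2 * Δ * (k + 4)) ^ 2 * frobNorm B := by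
  have h1 := frobNorm_adOp_le h hB
  have h2 := frobNorm_adOp_le h' (hB.adOp h)
  have h0 := frobNorm_nonneg B
  push_cast at h2
  calc _ ≤ _ := h2
    _ ≤ 2 * Δ * (k + 2 + 2) * (2 * Δ * (k + 4) * frobNorm B) := by
      refine mul_le_mul_of_nonneg_left (h1.trans ?_) (by positivity)
      gcongr; norm_num
    _ = _ := by ring

lemma frobNorm_trotterOp_sub_le {Δ k : ℕ} (gs : List (Terms m)) (h : SparseTerms Δ gs.flatten)
    {B : Obs m} (hB : DegLE k B) {s : ℝ} (hs : 0 ≤ s) :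
    frobNorm (trotterOp gs s B - B) ≤ gs.length * (s * (2 * Δ * (k + 2) * frobNorm B)) := by
  induction gs using List.reverseRecOn with
  | nil => simp [trotterOp, frobNorm_zero]
  | append_singleton gs g ih =>
    rw [List.flatten_append] at h
    have hg : SparseTerms Δ g := h.sublist (by simp)
    have hgs := ih (h.sublist (List.sublist_append_left _ _))
    have hH := termsOp_isHermitian g
    have h1 : trotterOp (gs ++ [g]) s B - B
        = heisenberg (termsOp g) s (trotterOp gs s B - B) + (heisenberg (termsOp g) s B - B) := by
      rw [trotterOp_append, heisenberg_sub]; abel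
    rw [h1]
    refine (frobNorm_add_le _ _).trans ?_
    rw [frobNorm_heisenberg hH, List.length_append, List.length_singleton]
    push_cast
    rw [add_mul, one_mul]
    refine add_le_add hgs ((frobNorm_heisenberg_sub_le hH hs B).trans ?_)
    exact mul_le_mul_of_nonneg_left (frobNorm_adOp_le hg hB) hs

lemma frobNorm_trotterOp_sub_sub_le {Δ k : ℕ} (gs : List (Terms m))
    (h : SparseTerms Δ gs.flatten) {B : Obs m} (hB : DegLE k B) {s : ℝ} (hs : 0 ≤ s) :
    frobNorm (trotterOp gs s B - B - (s : ℂ) • adOp (termsOp gs.flatten) B)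
      ≤ gs.length * (2 * (s ^ 2 * ((2 * Δ * (k + 4)) ^ 2 * frobNorm B))) := by
  induction gs using List.reverseRecOn with
  | nil => simp [trotterOp, frobNorm_zero, termsOp_nil, adOp_zero_left]
  | append_singleton gs g ih =>
    rw [List.flatten_append] at h ⊢
    have hg : SparseTerms Δ g := h.sublist (by simp)
    have hgs := h.sublist (List.sublist_append_left gs.flatten [g].flatten)
    have hH := termsOp_isHermitian g
    have h1 : trotterOp (gs ++ [g]) s B - B - (s : ℂ) • adOp (termsOp (gs.flatten ++ [g].flatten)) B
        = heisenberg (termsOp g) s (trotterOp gs s B - B - (s : ℂ) • adOp (termsOp gs.flatten) B)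
          + ((heisenberg (termsOp g) s B - B - (s : ℂ) • adOp (termsOp g) B)
          + (s : ℂ) • (heisenberg (termsOp g) s (adOp (termsOp gs.flatten) B)
            - adOp (termsOp gs.flatten) B)) := by
      rw [trotterOp_append, heisenberg_sub, heisenberg_sub, heisenberg_smul, termsOp_append,
        adOp_add_left]
      simp only [List.flatten_cons, List.flatten_nil, List.append_nil, smul_add, smul_sub]
      abel
    rw [h1]
    refine (frobNorm_add_le _ _).trans ?_
    rw [frobNorm_heisenberg hH, List.length_append, List.length_singleton]
    push_cast
    rw [add_mul, one_mul, two_mul (s ^ 2 * _)]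
    refine add_le_add ((ih hgs).trans_eq (by ring)) ((frobNorm_add_le _ _).trans (add_le_add ?_ ?_))
    · refine (frobNorm_heisenberg_sub_sub_le hH hs B).trans ?_
      exact mul_le_mul_of_nonneg_left (frobNorm_adOp_adOp_le hg hg hB) (by positivity)
    · rw [frobNorm_smul, Complex.norm_real, Real.norm_of_nonneg hs, pow_two, mul_assoc]
      refine mul_le_mul_of_nonneg_left ((frobNorm_heisenberg_sub_le hH hs _).trans ?_) hs
      exact mul_le_mul_of_nonneg_left (frobNorm_adOp_adOp_le hgs hg hB) hs

/-- The error of one Trotter step on an observable of bounded degree. -/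
lemma frobNorm_heisenberg_sub_trotterOp_le {Δ k : ℕ} (gs : List (Terms m))
    (h : SparseTerms Δ gs.flatten) {B : Obs m} (hB : DegLE k B) {s : ℝ} (hs : 0 ≤ s) :
    frobNorm (heisenberg (termsOp gs.flatten) s B - trotterOp gs s B)
      ≤ (2 * gs.length + 1) * (s ^ 2 * ((2 * Δ * (k + 4)) ^ 2 * frobNorm B)) := by
  have h1 := frobNorm_trotterOp_sub_sub_le gs h hB hs
  have h2 := (frobNorm_heisenberg_sub_sub_le (termsOp_isHermitian gs.flatten) hs B).trans
    (mul_le_mul_of_nonneg_left (frobNorm_adOp_adOp_le h h hB) (by positivity))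
  rw [show heisenberg (termsOp gs.flatten) s B - trotterOp gs s B
    = (heisenberg (termsOp gs.flatten) s B - B - (s : ℂ) • adOp (termsOp gs.flatten) B)
      - (trotterOp gs s B - B - (s : ℂ) • adOp (termsOp gs.flatten) B) by abel]
  refine (frobNorm_sub_le _ _).trans ((add_le_add h2 h1).trans_eq ?_)
  ring

lemma frobNorm_trotterOp (gs : List (Terms m)) (s : ℝ) (B : Obs m) :
    frobNorm (trotterOp gs s B) = frobNorm B := by
  induction gs using List.reverseRecOn with
  | nil => simp [trotterOp]
  | append_singleton gs g ih =>
    rw [trotterOp_append, frobNorm_heisenberg (termsOp_isHermitian g), ih]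

/-! ### Exponentially weighted norms -/

/-- The squared norm of the coefficients of `B`, where the coefficient of `γ_S` has the weight
`exp (∑ i ∈ S, μ i)`. -/
noncomputable def weightSq (μ : Fin (2 * m) → ℝ) (B : Obs m) : ℝ :=
  ∑ S : Str m, (Real.exp (∑ i ∈ S, μ i) * ‖coeff B S‖) ^ 2

lemma weightSq_mono {μ ν : Fin (2 * m) → ℝ} (h : ∀ i, μ i ≤ ν i) (B : Obs m) :
    weightSq μ B ≤ weightSq ν B := by
  refine Finset.sum_le_sum fun S _ => pow_le_pow_left₀ (by positivity) ?_ 2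
  refine mul_le_mul_of_nonneg_right (Real.exp_le_exp.2 ?_) (norm_nonneg _)
  exact Finset.sum_le_sum fun i _ => h i

lemma sum_symmDiff_add (X S : Str m) (μ : Fin (2 * m) → ℝ) {c : ℝ} (hc : ∀ i ∈ X, μ i = c) :
    ∑ i ∈ X ∆ S, μ i + 2 * (c * (X ∩ S).card) = c * X.card + ∑ i ∈ S, μ i := by
  have h1 : ∑ i ∈ X ∆ S, μ i = ∑ i ∈ X \ S, μ i + ∑ i ∈ S \ X, μ i := by
    rw [symmDiff_def, Finset.sup_eq_union, Finset.sum_union disjoint_sdiff_sdiff]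
  have h2 := Finset.sum_inter_add_sum_sdiff X S μ
  have h3 := Finset.sum_inter_add_sum_sdiff S X μ
  rw [Finset.inter_comm S X] at h3
  have h4 : ∑ i ∈ X ∩ S, μ i = c * (X ∩ S).card := by
    rw [Finset.sum_congr rfl (fun i hi => hc i (Finset.mem_inter.1 hi).1), Finset.sum_const,
      nsmul_eq_mul, mul_comm]
  have h5 : ∑ i ∈ X, μ i = c * X.card := by
    rw [Finset.sum_congr rfl hc, Finset.sum_const, nsmul_eq_mul, mul_comm]
  linarith

/-- A quadratic rotation preserves the weighted norm, as it only mixes strings of equal weight. -/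
lemma weightSq_heisenberg_quadratic {X : Str m} (hX : X.card = 2) {μ : Fin (2 * m) → ℝ} {c : ℝ}
    (hc : ∀ i ∈ X, μ i = c) (a s : ℝ) (B : Obs m) :
    weightSq μ (heisenberg ((a : ℂ) • majoranaString X) s B) = weightSq μ B := by
  have hX2 : Even X.card := by rw [hX]; decide
  -- the observable with the weighted coefficients, whose evolution preserves its Frobenius norm
  let Bw : Obs m := ∑ S : Str m, ((Real.exp (∑ i ∈ S, μ i) : ℝ) * coeff B S : ℂ) • majoranaString S
  have hBw : ∀ S, coeff Bw S = (Real.exp (∑ i ∈ S, μ i) : ℝ) * coeff B S := fun S =>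
    coeff_sum_smul _ S
  have hτ : ∀ S, coeff (heisenberg ((a : ℂ) • majoranaString X) s Bw) S
      = (Real.exp (∑ i ∈ S, μ i) : ℝ) * coeff (heisenberg ((a : ℂ) • majoranaString X) s B) S := by
    intro S
    rw [coeff_heisenberg hX2, coeff_heisenberg hX2, hBw, hBw]
    split_ifs with ho
    · have h1 : (X ∩ S).card = 1 := by
        have := Finset.card_le_card (Finset.inter_subset_left (s₁ := X) (s₂ := S))
        rw [hX] at this
        obtain ⟨r, hr⟩ := ho
        omega
      have h2 := sum_symmDiff_add X S μ hc
      rw [h1, hX] at h2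
      have h3 : ∑ i ∈ X ∆ S, μ i = ∑ i ∈ S, μ i := by push_cast at h2; linarith
      rw [h3]; ring
    · rfl
  have h := congrArg (fun x => x ^ 2) (frobNorm_heisenberg (H := (a : ℂ) • majoranaString X)
    (by rw [Matrix.IsHermitian, Matrix.conjTranspose_smul, majoranaString_conjTranspose]; simp)
    s Bw)
  simp only [frobNorm_sq, hτ, hBw, norm_mul, Complex.norm_real, Real.norm_eq_abs,
    Real.abs_exp] at h
  exact h

/-- A quartic rotation by a small angle does not increase the weighted norm, if the weights on the
support of the string are lowered by an amount proportional to the angle. -/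
lemma weightSq_heisenberg_quartic {X : Str m} (hX : X.card = 4) {μ : Fin (2 * m) → ℝ} {c η : ℝ}
    (hc0 : 0 ≤ c) (hc1 : c ≤ 1) (hc : ∀ i ∈ X, μ i = c) {a s : ℝ}
    (hη : 2 * Real.exp 1 ^ 2 * |s * a| ≤ η) (B : Obs m) :
    weightSq (fun i => if i ∈ X then μ i - η else μ i)
      (heisenberg ((a : ℂ) • majoranaString X) s B) ≤ weightSq μ B := by
  have hX2 : Even X.card := by rw [hX]; decide
  have hη0 : 0 ≤ η := le_trans (by positivity) hη
  let x : Str m → ℝ := fun S => Real.exp (∑ i ∈ S, μ i) * ‖coeff B S‖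
  have hsum : ∀ S : Str m, ∑ i ∈ S, (if i ∈ X then μ i - η else μ i)
      = ∑ i ∈ S, μ i - η * (X ∩ S).card := by
    intro S
    have h1 : ∀ i ∈ S, (if i ∈ X then μ i - η else μ i) = μ i - if i ∈ X then η else 0 := by
      intro i _; split_ifs <;> simp
    rw [Finset.sum_congr rfl h1, Finset.sum_sub_distrib, ← Finset.sum_filter, Finset.sum_const,
      nsmul_eq_mul, Finset.filter_mem_eq_inter, Finset.inter_comm, mul_comm η]
  have hkey : ∀ S : Str m, (Real.exp (∑ i ∈ S, (if i ∈ X then μ i - η else μ i)) *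
      ‖coeff (heisenberg ((a : ℂ) • majoranaString X) s B) S‖) ^ 2
      ≤ if Odd (X ∩ S).card then
          Real.exp (-η) ^ 2 * (1 + η) * (x S ^ 2 + η * x (X ∆ S) ^ 2) else x S ^ 2 := by
    intro S
    rw [hsum, coeff_heisenberg hX2]
    split_ifs with ho
    · have ho4 : (X ∩ S).card ≤ 4 := hX ▸ Finset.card_le_card Finset.inter_subset_left
      have ho1 : (1 : ℝ) ≤ (X ∩ S).card := by exact_mod_cast ho.pos
      have ho3 : ((X ∩ S).card : ℝ) ≤ 3 := by
        obtain ⟨r, hr⟩ := ho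
        have : (X ∩ S).card ≤ 3 := by omega
        exact_mod_cast this
      -- the exponents differ by `c (2 |X ∩ S| - 4)`, at most `2`
      have hw : Real.exp (∑ i ∈ S, μ i) ≤ Real.exp 1 ^ 2 * Real.exp (∑ i ∈ X ∆ S, μ i) := by
        rw [← Real.exp_nat_mul, ← Real.exp_add]
        apply Real.exp_le_exp.2
        have h2 := sum_symmDiff_add X S μ hc
        rw [hX] at h2
        push_cast at h2 ⊢
        nlinarith
      have hx0 : ∀ S, 0 ≤ x S := fun S => by positivity
      have hb : Real.exp (∑ i ∈ S, μ i) * ‖(Real.cos (2 * (s * a)) : ℂ) * coeff B S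
          - Complex.I * (Real.sin (2 * (s * a)) : ℂ) * mulPhase X S * coeff B (X ∆ S)‖
          ≤ x S + η * x (X ∆ S) := by
        have h3 : ‖(Real.cos (2 * (s * a)) : ℂ) * coeff B S
            - Complex.I * (Real.sin (2 * (s * a)) : ℂ) * mulPhase X S * coeff B (X ∆ S)‖
            ≤ ‖coeff B S‖ + 2 * |s * a| * ‖coeff B (X ∆ S)‖ := by
          refine (norm_sub_le _ _).trans ?_
          simp only [norm_mul, norm_mulPhase, Complex.norm_I, Complex.norm_real,
            Real.norm_eq_abs, one_mul, mul_one]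
          refine add_le_add (mul_le_of_le_one_left (norm_nonneg _) (Real.abs_cos_le_one _)) ?_
          refine mul_le_mul_of_nonneg_right ?_ (norm_nonneg _)
          have := Real.abs_sin_le_abs (x := 2 * (s * a))
          rwa [abs_mul, abs_two] at this
        calc _ ≤ Real.exp (∑ i ∈ S, μ i) * (‖coeff B S‖ + 2 * |s * a| * ‖coeff B (X ∆ S)‖) :=
              mul_le_mul_of_nonneg_left h3 (Real.exp_nonneg _)
          _ = x S + 2 * |s * a| * ‖coeff B (X ∆ S)‖ * Real.exp (∑ i ∈ S, μ i) := by
              simp only [x]; ring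
          _ ≤ x S + 2 * |s * a| * ‖coeff B (X ∆ S)‖ *
              (Real.exp 1 ^ 2 * Real.exp (∑ i ∈ X ∆ S, μ i)) := by
              gcongr
          _ = x S + (2 * Real.exp 1 ^ 2 * |s * a|) * x (X ∆ S) := by simp only [x]; ring
          _ ≤ _ := by gcongr
      calc _ ≤ (Real.exp (-η) * (x S + η * x (X ∆ S))) ^ 2 := by
            refine pow_le_pow_left₀ (by positivity) ?_ 2
            rw [sub_eq_add_neg, add_comm, Real.exp_add, mul_assoc]
            refine mul_le_mul (Real.exp_le_exp.2 ?_) hb (by positivity) (Real.exp_nonneg _)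
            nlinarith
        _ = Real.exp (-η) ^ 2 * (x S + η * x (X ∆ S)) ^ 2 := by ring
        _ ≤ Real.exp (-η) ^ 2 * ((1 + η) * (x S ^ 2 + η * x (X ∆ S) ^ 2)) := by
            refine mul_le_mul_of_nonneg_left ?_ (by positivity)
            nlinarith [mul_nonneg hη0 (sq_nonneg (x S - x (X ∆ S)))]
        _ = _ := by ring
    · refine pow_le_pow_left₀ (by positivity) ?_ 2
      refine mul_le_mul_of_nonneg_right (Real.exp_le_exp.2 ?_) (norm_nonneg _)
      have : 0 ≤ η * (X ∩ S).card := by positivity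
      linarith
  have hswap : ∑ S : Str m, (if Odd (X ∩ S).card then x (X ∆ S) ^ 2 else 0)
      = ∑ S : Str m, (if Odd (X ∩ S).card then x S ^ 2 else 0) := by
    refine Finset.sum_nbij' (fun Z => X ∆ Z) (fun Z => X ∆ Z) (by simp) (by simp)
      (by simp) (by simp) fun Z _ => ?_
    simp only [odd_card_inter_symmDiff hX2 Z]
  have hexp : Real.exp (-η) ^ 2 * (1 + η) * (1 + η) ≤ 1 := by
    have h1 : 1 + η ≤ Real.exp η := by linarith [Real.add_one_le_exp η]
    have h2 : Real.exp (-η) * (1 + η) ≤ 1 := by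
      calc _ ≤ Real.exp (-η) * Real.exp η := by gcongr
        _ = 1 := by rw [← Real.exp_add]; simp
    have h3 : 0 ≤ Real.exp (-η) * (1 + η) := by positivity
    nlinarith
  calc _ ≤ ∑ S : Str m, (if Odd (X ∩ S).card then
          Real.exp (-η) ^ 2 * (1 + η) * (x S ^ 2 + η * x (X ∆ S) ^ 2) else x S ^ 2) :=
        Finset.sum_le_sum fun S _ => hkey S
    _ = ∑ S : Str m, (Real.exp (-η) ^ 2 * (1 + η) * (if Odd (X ∩ S).card then x S ^ 2 else 0)
          + Real.exp (-η) ^ 2 * (1 + η) * η * (if Odd (X ∩ S).card then x (X ∆ S) ^ 2 else 0)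
          + if Odd (X ∩ S).card then 0 else x S ^ 2) := by
        refine Finset.sum_congr rfl fun S _ => ?_
        split_ifs <;> ring
    _ = Real.exp (-η) ^ 2 * (1 + η) * (1 + η) *
          ∑ S : Str m, (if Odd (X ∩ S).card then x S ^ 2 else 0)
          + ∑ S : Str m, (if Odd (X ∩ S).card then 0 else x S ^ 2) := by
        rw [Finset.sum_add_distrib, Finset.sum_add_distrib, ← Finset.mul_sum, ← Finset.mul_sum,
          hswap]
        ring
    _ ≤ ∑ S : Str m, (if Odd (X ∩ S).card then x S ^ 2 else 0)
          + ∑ S : Str m, (if Odd (X ∩ S).card then 0 else x S ^ 2) := by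
        gcongr
        refine mul_le_of_le_one_left (Finset.sum_nonneg fun S _ => ?_) hexp
        split_ifs <;> positivity
    _ = _ := by
        rw [← Finset.sum_add_distrib]
        refine Finset.sum_congr rfl fun S _ => ?_
        split_ifs <;> simp [x]

/-- All terms are quadratic, or quartic with a coefficient of modulus at most `u`. -/
def QuadraticOrWeakQuartic (u : ℝ) (L : Terms m) : Prop :=
  ∀ p ∈ L, p.1.card = 2 ∨ p.1.card = 4 ∧ |p.2| ≤ u

lemma commute_termsOp {X : Str m} (hX : Even X.card) (a : ℂ) {g : Terms m}
    (h : ∀ p ∈ g, Disjoint X p.1) : Commute (a • majoranaString X) (termsOp g) := by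
  induction g with
  | nil => rw [termsOp_nil]; exact Commute.zero_right _
  | cons y g ih =>
    rw [termsOp_cons]
    refine Commute.add_right ?_ (ih fun p hp => h p (List.mem_cons_of_mem _ hp))
    have hd := Finset.disjoint_iff_inter_eq_empty.1 (h y List.mem_cons_self)
    have : Commute (majoranaString X) (majoranaString y.1) :=
      majoranaString_comm_of_even hX (by rw [hd]; simp)
    exact (this.smul_left a).smul_right _

/-- The evolution under a group of disjoint terms is the composition of their rotations. -/
lemma heisenberg_termsOp_cons {x : Str m × ℝ} {g : Terms m} (hx : Even x.1.card)
    (h : ∀ p ∈ g, Disjoint x.1 p.1) (s : ℝ) (B : Obs m) :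
    heisenberg (termsOp (x :: g)) s B
      = heisenberg (termsOp g) s (heisenberg ((x.2 : ℂ) • majoranaString x.1) s B) := by
  rw [termsOp_cons, heisenberg_add_of_commute (commute_termsOp hx _ h)]

/-- As the terms of a group are disjoint, each weight has to be lowered only once. -/
lemma weightSq_heisenberg_group {u s c : ℝ} (hs : 0 ≤ s) (hc0 : 0 ≤ c) (hc1 : c ≤ 1)
    {g : Terms m} (hg : QuadraticOrWeakQuartic u g)
    (hd : g.Pairwise (fun p q => Disjoint p.1 q.1)) {μ : Fin (2 * m) → ℝ}
    (hμ : ∀ p ∈ g, ∀ i ∈ p.1, μ i = c) (hμ' : ∀ i, c - 2 * Real.exp 1 ^ 2 * (s * u) ≤ μ i)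
    (B : Obs m) :
    weightSq (fun _ => c - 2 * Real.exp 1 ^ 2 * (s * u)) (heisenberg (termsOp g) s B)
      ≤ weightSq μ B := by
  induction g generalizing μ B with
  | nil =>
    rw [termsOp_nil, heisenberg_hamiltonian_zero]
    exact weightSq_mono hμ' B
  | cons x g ih =>
    rw [List.pairwise_cons] at hd
    have hg' : QuadraticOrWeakQuartic u g := fun p hp => hg p (List.mem_cons_of_mem _ hp)
    rcases hg x List.mem_cons_self with h2 | ⟨h4, hu⟩
    · rw [heisenberg_termsOp_cons (by rw [h2]; decide) hd.1,
        ← weightSq_heisenberg_quadratic h2 (hμ x List.mem_cons_self) x.2 s B]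
      exact ih hg' hd.2 (fun p hp => hμ p (List.mem_cons_of_mem _ hp)) hμ' _
    · rw [heisenberg_termsOp_cons (by rw [h4]; decide) hd.1]
      have hη : 2 * Real.exp 1 ^ 2 * |s * x.2| ≤ 2 * Real.exp 1 ^ 2 * (s * u) := by
        rw [abs_mul, abs_of_nonneg hs]
        gcongr
      refine (ih hg' hd.2 ?_ ?_ _).trans
        (weightSq_heisenberg_quartic h4 hc0 hc1 (hμ x List.mem_cons_self) hη B)
      · intro p hp i hi
        have hix : i ∉ x.1 := fun hix => Finset.disjoint_left.1 (hd.1 p hp) hix hi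
        rw [if_neg hix]
        exact hμ p (List.mem_cons_of_mem _ hp) i hi
      · intro i
        split_ifs with hi
        · rw [hμ x List.mem_cons_self i hi]
        · exact hμ' i

lemma weightSq_trotterOp {u s c : ℝ} (hs : 0 ≤ s) (hu : 0 ≤ u) (hc1 : c ≤ 1)
    {gs : List (Terms m)} (hg : ∀ g ∈ gs, QuadraticOrWeakQuartic u g)
    (hd : ∀ g ∈ gs, g.Pairwise (fun p q => Disjoint p.1 q.1))
    (hc : 0 ≤ c - gs.length * (2 * Real.exp 1 ^ 2 * (s * u))) (B : Obs m) :
    weightSq (fun _ => c - gs.length * (2 * Real.exp 1 ^ 2 * (s * u))) (trotterOp gs s B)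
      ≤ weightSq (fun _ => c) B := by
  induction gs generalizing c B with
  | nil => simp [trotterOp]
  | cons g gs ih =>
    have hη : 0 ≤ 2 * Real.exp 1 ^ 2 * (s * u) := by positivity
    have hl : 0 ≤ gs.length * (2 * Real.exp 1 ^ 2 * (s * u)) := by positivity
    rw [List.length_cons] at hc ⊢
    push_cast at hc ⊢
    have h1 : c - (gs.length + 1) * (2 * Real.exp 1 ^ 2 * (s * u))
      = c - 2 * Real.exp 1 ^ 2 * (s * u) - gs.length * (2 * Real.exp 1 ^ 2 * (s * u)) := by ring
    rw [h1] at hc ⊢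
    refine (ih (by linarith) (fun g hg' => hg g (List.mem_cons_of_mem _ hg'))
      (fun g hg' => hd g (List.mem_cons_of_mem _ hg')) hc (heisenberg (termsOp g) s B)).trans ?_
    exact weightSq_heisenberg_group hs (by linarith) hc1 (hg g List.mem_cons_self)
      (hd g List.mem_cons_self) (fun _ _ _ _ => rfl) (fun _ => by linarith) B

/-! ### Truncation -/

lemma coeff_truncOp (ℓ : ℕ) (A : Obs m) (X : Str m) :
    coeff (truncOp ℓ A) X = if X.card ≤ ℓ then coeff A X else 0 := by
  rw [truncOp, Finset.sum_filter]
  have h : ∀ S : Str m, (if S.card ≤ ℓ then coeff A S • majoranaString S else 0)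
      = (if S.card ≤ ℓ then coeff A S else 0) • majoranaString S := by
    intro S; split_ifs <;> simp
  simp only [h]
  exact coeff_sum_smul _ X

lemma degLE_truncOp (ℓ : ℕ) (A : Obs m) : DegLE ℓ (truncOp ℓ A) := by
  intro X hX
  by_contra h
  rw [coeff_truncOp, if_neg h] at hX
  exact hX rfl

lemma truncOp_eq_self {ℓ : ℕ} {A : Obs m} (h : DegLE ℓ A) : truncOp ℓ A = A := by
  refine coeff_ext fun X => ?_
  rw [coeff_truncOp]
  split_ifs with hX
  · rfl
  · by_contra hne; exact hX (h X (Ne.symm hne))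

lemma truncOp_sub (ℓ : ℕ) (A B : Obs m) : truncOp ℓ (A - B) = truncOp ℓ A - truncOp ℓ B := by
  refine coeff_ext fun X => ?_
  simp only [coeff_sub, coeff_truncOp]
  split_ifs <;> simp

lemma weightSq_truncOp_le (ℓ : ℕ) (μ : Fin (2 * m) → ℝ) (A : Obs m) :
    weightSq μ (truncOp ℓ A) ≤ weightSq μ A := by
  refine Finset.sum_le_sum fun S _ => pow_le_pow_left₀ (by positivity) ?_ 2
  refine mul_le_mul_of_nonneg_left ?_ (Real.exp_nonneg _)
  rw [coeff_truncOp]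
  split_ifs <;> simp

lemma frobNorm_truncOp_le (ℓ : ℕ) (A : Obs m) : frobNorm (truncOp ℓ A) ≤ frobNorm A := by
  refine le_of_sq_le_sq ?_ (frobNorm_nonneg A)
  rw [frobNorm_sq, frobNorm_sq]
  refine Finset.sum_le_sum fun S _ => pow_le_pow_left₀ (by positivity) ?_ 2
  rw [coeff_truncOp]
  split_ifs <;> simp

lemma weightSq_le_of_degLE {d : ℕ} {A : Obs m} (h : DegLE d A) :
    weightSq (fun _ => 1) A ≤ (Real.exp d * frobNorm A) ^ 2 := by
  rw [mul_pow, frobNorm_sq, Finset.mul_sum]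
  refine Finset.sum_le_sum fun S _ => ?_
  rw [← mul_pow]
  refine pow_le_pow_left₀ (by positivity) ?_ 2
  by_cases hS : coeff A S = 0
  · simp [hS]
  · refine mul_le_mul_of_nonneg_right (Real.exp_le_exp.2 ?_) (norm_nonneg _)
    simpa using h S hS

/-- Truncation of an observable with small weighted norm changes it by an amount that is
exponentially small in the truncation degree. -/
lemma frobNorm_sub_truncOp_le (ℓ : ℕ) {c M : ℝ} (hc : 3 / 4 ≤ c) (hM : 0 ≤ M) {B : Obs m}
    (hB : weightSq (fun _ => c) B ≤ M ^ 2) :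
    frobNorm (B - truncOp ℓ B) ≤ Real.exp (-(3 / 4 * (ℓ + 1))) * M := by
  refine le_of_sq_le_sq ?_ (by positivity)
  rw [frobNorm_sq, mul_pow]
  refine le_trans ?_ (mul_le_mul_of_nonneg_left hB (by positivity))
  rw [weightSq, Finset.mul_sum]
  refine Finset.sum_le_sum fun S _ => ?_
  rw [← mul_pow]
  refine pow_le_pow_left₀ (by positivity) ?_ 2
  rw [coeff_sub, coeff_truncOp]
  split_ifs with hS
  · simp only [sub_self, norm_zero]; positivity
  · rw [sub_zero, ← mul_assoc, ← Real.exp_add]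
    refine le_mul_of_one_le_left (norm_nonneg _) (Real.one_le_exp ?_)
    have h1 : (ℓ : ℝ) + 1 ≤ S.card := by exact_mod_cast not_le.1 hS
    simp only [Finset.sum_const, nsmul_eq_mul]
    nlinarith

/-! ### The error of Majorana Propagation -/

/-- One truncated Trotter step: the invariants of the propagation and its error. -/
lemma truncated_trotter_step {Δ d ℓ : ℕ} {u c s t : ℝ} (hs : 0 ≤ s) (hu : 0 ≤ u) (hc1 : c ≤ 1)
    {gs : List (Terms m)} (hΔ : SparseTerms Δ gs.flatten)
    (hg : ∀ g ∈ gs, QuadraticOrWeakQuartic u g)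
    (hd : ∀ g ∈ gs, g.Pairwise (fun p q => Disjoint p.1 q.1))
    (hc : 3 / 4 ≤ c - gs.length * (2 * Real.exp 1 ^ 2 * (s * u))) {A B : Obs m}
    (hBℓ : DegLE ℓ B) (hBA : frobNorm B ≤ frobNorm A)
    (hBw : weightSq (fun _ => c) B ≤ (Real.exp d * frobNorm A) ^ 2) :
    DegLE ℓ (truncOp ℓ (trotterOp gs s B)) ∧
    frobNorm (truncOp ℓ (trotterOp gs s B)) ≤ frobNorm A ∧
    weightSq (fun _ => c - gs.length * (2 * Real.exp 1 ^ 2 * (s * u)))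
      (truncOp ℓ (trotterOp gs s B)) ≤ (Real.exp d * frobNorm A) ^ 2 ∧
    frobNorm (heisenberg (termsOp gs.flatten) (s + t) A - truncOp ℓ (trotterOp gs s B))
      ≤ frobNorm (heisenberg (termsOp gs.flatten) t A - B)
        + ((2 * gs.length + 1) * (2 * Δ * (ℓ + 4)) ^ 2 * s ^ 2
          + Real.exp (d - 3 / 4 * (ℓ + 1))) * frobNorm A := by
  have hA := frobNorm_nonneg A
  have hw := (weightSq_trotterOp hs hu hc1 hg hd (by linarith) B).trans hBw
  refine ⟨degLE_truncOp _ _, ?_, (weightSq_truncOp_le _ _ _).trans hw, ?_⟩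
  · exact (frobNorm_truncOp_le _ _).trans ((frobNorm_trotterOp gs s B).le.trans hBA)
  · have h1 : heisenberg (termsOp gs.flatten) (s + t) A - truncOp ℓ (trotterOp gs s B)
        = heisenberg (termsOp gs.flatten) s (heisenberg (termsOp gs.flatten) t A - B)
          + ((heisenberg (termsOp gs.flatten) s B - trotterOp gs s B)
          + (trotterOp gs s B - truncOp ℓ (trotterOp gs s B))) := by
      rw [heisenberg_add_time, heisenberg_sub]; abel
    have h2 := frobNorm_heisenberg_sub_trotterOp_le gs hΔ hBℓ hs
    have h3 := frobNorm_sub_truncOp_le ℓ hc (by positivity) hw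
    rw [h1]
    refine (frobNorm_add_le _ _).trans ?_
    rw [frobNorm_heisenberg (termsOp_isHermitian _), add_mul]
    gcongr
    refine (frobNorm_add_le _ _).trans (add_le_add (h2.trans ?_) (h3.trans_eq ?_))
    · calc _ ≤ (2 * gs.length + 1) * (s ^ 2 * ((2 * Δ * (ℓ + 4)) ^ 2 * frobNorm A)) := by gcongr
        _ = _ := by ring
    · rw [← mul_assoc, ← Real.exp_add]; congr 2; ring

/-- The error of Majorana Propagation: each of the `⌊t/δt⌋ + 1` steps contributes a Trotter error
and a truncation error. -/
lemma frobNorm_heisenberg_sub_mpOp_le {Δ d ℓ : ℕ} {u t δt : ℝ} (hδ : 0 < δt) (ht : 0 ≤ t)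
    (hu : 0 ≤ u) (hdℓ : d ≤ ℓ) {gs : List (Terms m)} (hΔ : SparseTerms Δ gs.flatten)
    (hg : ∀ g ∈ gs, QuadraticOrWeakQuartic u g)
    (hd : ∀ g ∈ gs, g.Pairwise (fun p q => Disjoint p.1 q.1))
    (hut : gs.length * (2 * Real.exp 1 ^ 2 * (t * u)) ≤ 1 / 4) {A : Obs m} (hA : DegLE d A) :
    frobNorm (heisenberg (termsOp gs.flatten) t A - mpOp gs δt ℓ t A)
      ≤ (⌊t / δt⌋₊ + 1) * (((2 * gs.length + 1) * (2 * Δ * (ℓ + 4)) ^ 2 * δt ^ 2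
          + Real.exp (d - 3 / 4 * (ℓ + 1))) * frobNorm A) := by
  set K := ⌊t / δt⌋₊ with hK
  set f : Obs m → Obs m := fun B => truncOp ℓ (trotterOp gs δt B) with hf
  set E := ((2 * gs.length + 1) * (2 * Δ * (ℓ + 4)) ^ 2 * δt ^ 2
          + Real.exp (d - 3 / 4 * (ℓ + 1))) * frobNorm A with hE
  have hKt : K * δt ≤ t := by
    have := Nat.floor_le (a := t / δt) (by positivity)
    rwa [le_div_iff₀ hδ] at this
  have hKt' : t - K * δt ≤ δt := by
    have := Nat.lt_floor_add_one (t / δt)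
    rw [div_lt_iff₀ hδ] at this
    linarith
  have hind : ∀ j : ℕ, j ≤ K → DegLE ℓ (f^[j] A) ∧ frobNorm (f^[j] A) ≤ frobNorm A ∧
      weightSq (fun _ => 1 - gs.length * (2 * Real.exp 1 ^ 2 * ((j * δt) * u))) (f^[j] A)
        ≤ (Real.exp d * frobNorm A) ^ 2 ∧
      frobNorm (heisenberg (termsOp gs.flatten) (j * δt) A - f^[j] A) ≤ j * E := by
    intro j
    induction j with
    | zero =>
      intro _
      refine ⟨hA.mono hdℓ, le_rfl, ?_, ?_⟩
      · simpa using weightSq_le_of_degLE hA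
      · simp [heisenberg_zero_time, frobNorm_zero]
    | succ j ih =>
      intro hj
      obtain ⟨h1, h2, h3, h4⟩ := ih (by omega)
      have h5 : 1 - gs.length * (2 * Real.exp 1 ^ 2 * (((j + 1 : ℕ) * δt) * u))
          = 1 - gs.length * (2 * Real.exp 1 ^ 2 * ((j * δt) * u))
            - gs.length * (2 * Real.exp 1 ^ 2 * (δt * u)) := by push_cast; ring
      have h6 : gs.length * (2 * Real.exp 1 ^ 2 * (((j + 1 : ℕ) * δt) * u)) ≤ 1 / 4 := by
        refine le_trans ?_ hut
        have : ((j + 1 : ℕ) : ℝ) * δt ≤ t := le_trans (by gcongr) hKt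
        gcongr
      have h7 : 0 ≤ gs.length * (2 * Real.exp 1 ^ 2 * ((j * δt) * u)) := by positivity
      rw [Function.iterate_succ_apply', h5]
      obtain ⟨k1, k2, k3, k4⟩ := truncated_trotter_step (t := j * δt) hδ.le hu (by linarith)
        hΔ hg hd (by rw [← h5]; linarith) h1 h2 h3
      refine ⟨k1, k2, k3, ?_⟩
      have h8 : ((j + 1 : ℕ) : ℝ) * δt = δt + j * δt := by push_cast; ring
      rw [h8]
      refine k4.trans ((add_le_add h4 le_rfl).trans_eq ?_)
      rw [hE]; push_cast; ring
  obtain ⟨h1, h2, h3, h4⟩ := hind K le_rfl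
  have h5 : 1 - gs.length * (2 * Real.exp 1 ^ 2 * (t * u))
      = 1 - gs.length * (2 * Real.exp 1 ^ 2 * ((K * δt) * u))
        - gs.length * (2 * Real.exp 1 ^ 2 * ((t - K * δt) * u)) := by ring
  have h7 : 0 ≤ gs.length * (2 * Real.exp 1 ^ 2 * ((K * δt) * u)) := by positivity
  obtain ⟨-, -, -, k4⟩ := truncated_trotter_step (t := K * δt) (sub_nonneg.2 hKt) hu
    (by linarith) hΔ hg hd (by rw [← h5]; linarith) h1 h2 h3
  rw [sub_add_cancel] at k4
  refine k4.trans ((add_le_add h4 (b := _) (d := E) ?_).trans_eq (by ring))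
  have h8 := frobNorm_nonneg A
  rw [hE]
  have h9 : 0 ≤ t - K * δt := sub_nonneg.2 hKt
  gcongr

/-- Over a short time both the exact and the approximate evolution hardly change the observable. -/
lemma frobNorm_heisenberg_sub_truncOp_trotterOp_le {Δ d : ℕ} {t : ℝ} (ht : 0 ≤ t)
    {gs : List (Terms m)} (hΔ : SparseTerms Δ gs.flatten) {A : Obs m} (hA : DegLE d A) :
    frobNorm (heisenberg (termsOp gs.flatten) t A - truncOp d (trotterOp gs t A))
      ≤ (gs.length + 1) * (2 * Δ * (d + 2)) * t * frobNorm A := by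
  have h1 : heisenberg (termsOp gs.flatten) t A - truncOp d (trotterOp gs t A)
      = (heisenberg (termsOp gs.flatten) t A - A) - truncOp d (trotterOp gs t A - A) := by
    rw [truncOp_sub, truncOp_eq_self hA]; abel
  have h2 := (frobNorm_heisenberg_sub_le (termsOp_isHermitian gs.flatten) ht A).trans
    (mul_le_mul_of_nonneg_left (frobNorm_adOp_le hΔ hA) ht)
  have h3 := (frobNorm_truncOp_le d _).trans (frobNorm_trotterOp_sub_le gs hΔ hA ht)
  rw [h1]
  refine (frobNorm_sub_le _ _).trans ((add_le_add h2 h3).trans_eq (by ring))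

/-! ### Values and costs of counted computations -/

section Counted

variable {α β : Type}

@[simp] lemma Counted.bind_val (x : Counted α) (f : α → Counted β) :
    (x >>= f).val = (f x.val).val := rfl

@[simp] lemma Counted.bind_cost (x : Counted α) (f : α → Counted β) :
    (x >>= f).cost = x.cost + (f x.val).cost := rfl

@[simp] lemma Counted.pure_val (a : α) : (pure a : Counted α).val = a := rfl

@[simp] lemma Counted.pure_cost (a : α) : (pure a : Counted α).cost = 0 := rfl

@[simp] lemma tick_cost : tick.cost = 1 := rfl

end Counted

/-! ### The greedy decomposition -/

lemma disjointFromAll_val (X : Str m) (g : Terms m) :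
    (disjointFromAll X g).val = true ↔ ∀ p ∈ g, Disjoint X p.1 := by
  induction g with
  | nil => simp [disjointFromAll]
  | cons y g ih =>
    by_cases h : Disjoint X y.1 <;> simp [disjointFromAll, strDisjoint, h, ih]

lemma disjointFromAll_cost (X : Str m) (g : Terms m) :
    (disjointFromAll X g).cost ≤ g.length * (2 * m + 1) + 1 := by
  induction g with
  | nil => simp [disjointFromAll]
  | cons y g ih =>
    rw [List.length_cons, add_mul]
    by_cases h : Disjoint X y.1 <;> simp [disjointFromAll, strDisjoint, h] <;> omega

lemma placeTerm_cons (x : Str m × ℝ) (g : Terms m) (gs : List (Terms m)) :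
    (placeTerm x (g :: gs)).val = if ∀ p ∈ g, Disjoint x.1 p.1 then (x :: g) :: gs
      else g :: (placeTerm x gs).val := by
  rw [placeTerm]
  simp only [Counted.bind_val]
  by_cases h : (disjointFromAll x.1 g).val = true
  · rw [if_pos h, if_pos ((disjointFromAll_val _ _).1 h)]; rfl
  · rw [if_neg h, if_neg (fun h' => h ((disjointFromAll_val _ _).2 h'))]; rfl

lemma placeTerm_perm (x : Str m × ℝ) (gs : List (Terms m)) :
    (placeTerm x gs).val.flatten.Perm (x :: gs.flatten) := by
  induction gs with
  | nil => simp [placeTerm]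
  | cons g gs ih =>
    rw [placeTerm_cons]
    split_ifs
    · simp
    · rw [List.flatten_cons, List.flatten_cons]
      exact (ih.append_left g).trans List.perm_middle

lemma placeTerm_pairwise {x : Str m × ℝ} {gs : List (Terms m)}
    (h : ∀ g ∈ gs, g.Pairwise (fun p q => Disjoint p.1 q.1)) :
    ∀ g ∈ (placeTerm x gs).val, g.Pairwise (fun p q => Disjoint p.1 q.1) := by
  induction gs with
  | nil => simp [placeTerm]
  | cons g gs ih =>
    rw [placeTerm_cons]
    have hg := h g List.mem_cons_self
    have hgs := fun g' hg' => h g' (List.mem_cons_of_mem _ hg')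
    split_ifs with hd
    · intro g' hg'
      rcases List.mem_cons.1 hg' with rfl | hg'
      · exact List.pairwise_cons.2 ⟨hd, hg⟩
      · exact hgs g' hg'
    · intro g' hg'
      rcases List.mem_cons.1 hg' with rfl | hg'
      · exact hg
      · exact ih hgs g' hg'

/-- A new group is opened only if the term meets every group. -/
lemma placeTerm_length (x : Str m × ℝ) (gs : List (Terms m)) :
    (placeTerm x gs).val.length = gs.length ∨
      (placeTerm x gs).val.length = gs.length + 1 ∧
        gs.length ≤ gs.flatten.countP (fun p => decide (¬Disjoint x.1 p.1)) := by
  induction gs with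
  | nil => simp [placeTerm]
  | cons g gs ih =>
    rw [placeTerm_cons]
    split_ifs with hd
    · simp
    · simp only [List.length_cons, List.flatten_cons, List.countP_append]
      rcases ih with h | ⟨h, h'⟩
      · left; omega
      · right
        push Not at hd
        obtain ⟨p, hp, hpd⟩ := hd
        have : 0 < g.countP (fun p => decide (¬Disjoint x.1 p.1)) :=
          List.countP_pos_iff.2 ⟨p, hp, by simpa using hpd⟩
        omega

lemma greedyGroups_cons (x : Str m × ℝ) (L : Terms m) :
    (greedyGroups (x :: L)).val = (placeTerm x (greedyGroups L).val).val := rfl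

lemma isDecomposition_greedyGroups (L : Terms m) : IsDecomposition (greedyGroups L).val L := by
  induction L with
  | nil => exact ⟨by simp [greedyGroups], by simp [greedyGroups]⟩
  | cons x L ih =>
    rw [greedyGroups_cons]
    exact ⟨(placeTerm_perm x _).trans (ih.1.cons x), placeTerm_pairwise ih.2⟩

lemma greedyGroups_length_le {Δ : ℕ} {L : Terms m} (h : SparseTerms Δ L)
    (h0 : ∀ p ∈ L, 0 < p.1.card) : (greedyGroups L).val.length ≤ 4 * Δ := by
  induction L with
  | nil => simp [greedyGroups]
  | cons x L ih =>
    have hL := ih (h.sublist (List.sublist_cons_self x L))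
      (fun p hp => h0 p (List.mem_cons_of_mem _ hp))
    rw [greedyGroups_cons]
    rcases placeTerm_length x (greedyGroups L).val with h1 | ⟨h1, h2⟩
    · omega
    · -- the term meets every group, and at most `Δ - 1` others at each of its at most `4` modes
      rw [(isDecomposition_greedyGroups L).1.countP_eq] at h2
      have h3 := countP_le_sum L (S := x.1) (q := fun p => ¬Disjoint x.1 p.1) fun p hp => hp
      have h4 : ∑ i ∈ x.1, (L.countP (fun p => decide (i ∈ p.1)) + 1) ≤ ∑ i ∈ x.1, Δ := by
        refine Finset.sum_le_sum fun i hi => ?_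
        have := h.2 i
        rwa [List.countP_cons, if_pos (by simpa using hi)] at this
      rw [Finset.sum_add_distrib, Finset.sum_const, Finset.sum_const, smul_eq_mul, smul_eq_mul,
        mul_one] at h4
      have h5 := h0 x List.mem_cons_self
      have h6 := Nat.mul_le_mul_right Δ (h.1 x List.mem_cons_self).2.1
      omega

lemma placeTerm_cost (x : Str m × ℝ) (gs : List (Terms m)) :
    (placeTerm x gs).cost ≤ 2 * gs.length + gs.flatten.length * (2 * m + 1) + 1 := by
  induction gs with
  | nil => simp [placeTerm]
  | cons g gs ih =>
    have h1 := disjointFromAll_cost x.1 g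
    rw [placeTerm]
    simp only [Counted.bind_cost, tick_cost, List.flatten_cons, List.length_append,
      List.length_cons, add_mul]
    split_ifs
    · simp only [Counted.pure_cost]; omega
    · simp only [Counted.bind_cost, Counted.pure_cost]; omega

lemma greedyGroups_length_le_length (L : Terms m) :
    (greedyGroups L).val.length ≤ L.length := by
  induction L with
  | nil => simp [greedyGroups]
  | cons x L ih =>
    rw [greedyGroups_cons, List.length_cons]
    rcases placeTerm_length x (greedyGroups L).val with h1 | ⟨h1, -⟩ <;> omega

lemma greedyGroups_cost (L : Terms m) :
    (greedyGroups L).cost ≤ L.length * (2 + L.length * (2 * m + 3)) + 1 := by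
  induction L with
  | nil => simp [greedyGroups]
  | cons x L ih =>
    have h1 := placeTerm_cost x (greedyGroups L).val
    rw [(isDecomposition_greedyGroups L).1.length_eq] at h1
    have h2 := greedyGroups_length_le_length L
    rw [greedyGroups]
    simp only [Counted.bind_cost, tick_cost, List.length_cons]
    have h3 : L.length * (2 + L.length * (2 * m + 3)) + (2 + L.length * (2 * m + 3))
        ≤ (L.length + 1) * (2 + (L.length + 1) * (2 * m + 3)) := by nlinarith
    nlinarith

/-! ### Correctness of the algorithm -/

lemma polyOp_nil : polyOp ([] : Poly m) = 0 := by simp [polyOp]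

lemma polyOp_cons (q : Str m × ℂ) (P : Poly m) :
    polyOp (q :: P) = q.2 • majoranaString q.1 + polyOp P := by simp [polyOp]

lemma polyOp_append (P Q : Poly m) : polyOp (P ++ Q) = polyOp P + polyOp Q := by simp [polyOp]

lemma strMul_val (X S : Str m) : (strMul X S).val = (X ∆ S, mulPhase X S) := rfl

lemma rotateMono_val (s : ℝ) (x : Str m × ℝ) (q : Str m × ℂ) :
    (rotateMono s x q).val = if Odd (x.1 ∩ q.1).card then
      [(q.1, (Real.cos (2 * (s * x.2)) : ℂ) * q.2),
        (x.1 ∆ q.1, Complex.I * ((Real.sin (2 * (s * x.2)) : ℂ) * q.2) * mulPhase x.1 q.1)]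
      else [q] := by
  rw [rotateMono]
  simp only [Counted.bind_val, strOddOverlap, Nat.odd_iff]
  by_cases h : (x.1 ∩ q.1).card % 2 = 1
  · simp [h, rmul, rcos, rsin, cmul, strMul_val]
  · simp [h]

lemma polyOp_rotateMono (s : ℝ) {x : Str m × ℝ} (hx : Even x.1.card) (q : Str m × ℂ) :
    polyOp (rotateMono s x q).val
      = heisenberg ((x.2 : ℂ) • majoranaString x.1) s (q.2 • majoranaString q.1) := by
  rw [rotateMono_val, heisenberg_smul]
  split_ifs with h
  · rw [heisenberg_majoranaString_of_odd hx h, majoranaString_mul, polyOp_cons, polyOp_cons,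
      polyOp_nil]
    module
  · rw [heisenberg_majoranaString_of_even hx (Nat.not_odd_iff_even.1 h), polyOp_cons, polyOp_nil,
      add_zero]

lemma rotateList_cons_val (s : ℝ) (x : Str m × ℝ) (q : Str m × ℂ) (P : Poly m) :
    (rotateList s x (q :: P)).val = (rotateMono s x q).val ++ (rotateList s x P).val := rfl

lemma polyOp_rotateList (s : ℝ) {x : Str m × ℝ} (hx : Even x.1.card) (P : Poly m) :
    polyOp (rotateList s x P).val
      = heisenberg ((x.2 : ℂ) • majoranaString x.1) s (polyOp P) := by
  induction P with
  | nil => simp [rotateList, polyOp_nil, heisenberg_zero]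
  | cons q P ih =>
    rw [rotateList_cons_val, polyOp_append, polyOp_rotateMono s hx, ih, polyOp_cons,
      heisenberg_add]

lemma rotateGroup_cons_val (s : ℝ) (x : Str m × ℝ) (g : Terms m) (P : Poly m) :
    (rotateGroup s (x :: g) P).val = (rotateGroup s g (rotateList s x P).val).val := rfl

lemma polyOp_rotateGroup (s : ℝ) {g : Terms m} (hg : ∀ p ∈ g, Even p.1.card)
    (hd : g.Pairwise (fun p q => Disjoint p.1 q.1)) (P : Poly m) :
    polyOp (rotateGroup s g P).val = heisenberg (termsOp g) s (polyOp P) := by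
  induction g generalizing P with
  | nil => simp [rotateGroup, termsOp_nil, heisenberg_hamiltonian_zero]
  | cons x g ih =>
    rw [List.pairwise_cons] at hd
    have hx := hg x List.mem_cons_self
    rw [rotateGroup_cons_val, ih (fun p hp => hg p (List.mem_cons_of_mem _ hp)) hd.2,
      heisenberg_termsOp_cons hx hd.1, polyOp_rotateList s hx]

lemma addMono_cons_val (q p : Str m × ℂ) (P : Poly m) :
    (addMono q (p :: P)).val = if q.1 = p.1 then (p.1, q.2 + p.2) :: P
      else p :: (addMono q P).val := by
  rw [addMono]
  simp only [Counted.bind_val, strEq]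
  by_cases h : q.1 = p.1 <;> simp [h, cadd]

lemma polyOp_addMono (q : Str m × ℂ) (P : Poly m) :
    polyOp (addMono q P).val = q.2 • majoranaString q.1 + polyOp P := by
  induction P with
  | nil => simp [addMono, polyOp_cons]
  | cons p P ih =>
    rw [addMono_cons_val]
    split_ifs with h
    · rw [polyOp_cons, polyOp_cons, h]; module
    · rw [polyOp_cons, ih, polyOp_cons]; abel

lemma addMono_keys (q : Str m × ℂ) (P : Poly m) :
    (addMono q P).val.map Prod.fst
      = if q.1 ∈ P.map Prod.fst then P.map Prod.fst else P.map Prod.fst ++ [q.1] := by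
  induction P with
  | nil => simp [addMono]
  | cons p P ih =>
    rw [addMono_cons_val]
    by_cases h : q.1 = p.1
    · simp [h]
    · rw [if_neg h, List.map_cons, ih, List.map_cons]
      by_cases h2 : q.1 ∈ P.map Prod.fst
      · rw [if_pos h2, if_pos (List.mem_cons_of_mem _ h2)]
      · rw [if_neg h2, if_neg (by simpa [h] using h2), List.cons_append]

lemma addMono_nodup {q : Str m × ℂ} {P : Poly m} (h : (P.map Prod.fst).Nodup) :
    ((addMono q P).val.map Prod.fst).Nodup := by
  rw [addMono_keys]
  split_ifs with hq
  · exact h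
  · rw [List.nodup_append]
    refine ⟨h, List.nodup_singleton _, ?_⟩
    rintro a ha b hb rfl
    rw [List.mem_singleton] at hb
    exact hq (hb ▸ ha)

lemma addPoly_cons_val (q : Str m × ℂ) (P R : Poly m) :
    (addPoly (q :: P) R).val = (addPoly P (addMono q R).val).val := rfl

lemma polyOp_addPoly (P R : Poly m) : polyOp (addPoly P R).val = polyOp P + polyOp R := by
  induction P generalizing R with
  | nil => simp [addPoly, polyOp_nil]
  | cons q P ih => rw [addPoly_cons_val, ih, polyOp_addMono, polyOp_cons]; abel

lemma addPoly_nodup {P R : Poly m} (h : (R.map Prod.fst).Nodup) :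
    ((addPoly P R).val.map Prod.fst).Nodup := by
  induction P generalizing R with
  | nil => exact h
  | cons q P ih => exact ih (addMono_nodup h)

/-- All strings of a polynomial have length at most `D`. -/
def KeysLE (D : ℕ) (P : Poly m) : Prop := ∀ X ∈ P.map Prod.fst, X.card ≤ D

lemma KeysLE.tail {D : ℕ} {q : Str m × ℂ} {P : Poly m} (h : KeysLE D (q :: P)) : KeysLE D P :=
  fun X hX => h X (by rw [List.map_cons]; exact List.mem_cons_of_mem _ hX)

lemma KeysLE.head {D : ℕ} {q : Str m × ℂ} {P : Poly m} (h : KeysLE D (q :: P)) : q.1.card ≤ D :=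
  h q.1 (by simp)

lemma addMono_keysLE {D : ℕ} {q : Str m × ℂ} {P : Poly m} (hq : q.1.card ≤ D) (h : KeysLE D P) :
    KeysLE D (addMono q P).val := by
  intro X hX
  rw [addMono_keys] at hX
  split_ifs at hX
  · exact h X hX
  · rcases List.mem_append.1 hX with hX | hX
    · exact h X hX
    · rw [List.mem_singleton.1 hX]; exact hq

lemma addPoly_keysLE {D : ℕ} {P R : Poly m} (hP : KeysLE D P) (h : KeysLE D R) :
    KeysLE D (addPoly P R).val := by
  induction P generalizing R with
  | nil => exact h
  | cons q P ih => exact ih hP.tail (addMono_keysLE hP.head h)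

lemma evolveGroup_cons_val (s : ℝ) (g : Terms m) (q : Str m × ℂ) (P : Poly m) :
    (evolveGroup s g (q :: P)).val
      = (addPoly (rotateGroup s g [q]).val (evolveGroup s g P).val).val := rfl

lemma polyOp_evolveGroup (s : ℝ) {g : Terms m} (hg : ∀ p ∈ g, Even p.1.card)
    (hd : g.Pairwise (fun p q => Disjoint p.1 q.1)) (P : Poly m) :
    polyOp (evolveGroup s g P).val = heisenberg (termsOp g) s (polyOp P) := by
  induction P with
  | nil => simp [evolveGroup, polyOp_nil, heisenberg_zero]
  | cons q P ih =>
    rw [evolveGroup_cons_val, polyOp_addPoly, ih, polyOp_rotateGroup s hg hd, ← heisenberg_add,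
      polyOp_cons q P, polyOp_cons, polyOp_nil, add_zero]

lemma evolveGroup_nodup (s : ℝ) (g : Terms m) (P : Poly m) :
    ((evolveGroup s g P).val.map Prod.fst).Nodup := by
  induction P with
  | nil => simp [evolveGroup]
  | cons q P ih => exact addPoly_nodup ih

lemma trotterStep_cons_val (s : ℝ) (g : Terms m) (gs : List (Terms m)) (P : Poly m) :
    (trotterStep s (g :: gs) P).val = (trotterStep s gs (evolveGroup s g P).val).val := rfl

lemma polyOp_trotterStep (s : ℝ) {gs : List (Terms m)} (hg : ∀ g ∈ gs, ∀ p ∈ g, Even p.1.card)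
    (hd : ∀ g ∈ gs, g.Pairwise (fun p q => Disjoint p.1 q.1)) (P : Poly m) :
    polyOp (trotterStep s gs P).val = trotterOp gs s (polyOp P) := by
  induction gs generalizing P with
  | nil => rfl
  | cons g gs ih =>
    rw [trotterStep_cons_val, ih (fun g h => hg g (List.mem_cons_of_mem _ h))
      (fun g h => hd g (List.mem_cons_of_mem _ h)), polyOp_evolveGroup s
      (hg g List.mem_cons_self) (hd g List.mem_cons_self)]
    rfl

lemma trotterStep_nodup (s : ℝ) {gs : List (Terms m)} {P : Poly m} (h : (P.map Prod.fst).Nodup) :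
    ((trotterStep s gs P).val.map Prod.fst).Nodup := by
  induction gs generalizing P with
  | nil => exact h
  | cons g gs ih => exact ih (evolveGroup_nodup s g P)

lemma truncPoly_val (ℓ : ℕ) (P : Poly m) :
    (truncPoly ℓ P).val = P.filter (fun q => decide (q.1.card ≤ ℓ)) := by
  induction P with
  | nil => rfl
  | cons q P ih =>
    rw [truncPoly]
    simp only [Counted.bind_val, leNat, strCard, ih]
    by_cases h : q.1.card ≤ ℓ <;> simp [h]

lemma truncOp_add (ℓ : ℕ) (A B : Obs m) : truncOp ℓ (A + B) = truncOp ℓ A + truncOp ℓ B := by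
  refine coeff_ext fun X => ?_
  simp only [coeff_add, coeff_truncOp]
  split_ifs <;> simp

lemma truncOp_smul_majoranaString (ℓ : ℕ) (c : ℂ) (S : Str m) :
    truncOp ℓ (c • majoranaString S) = if S.card ≤ ℓ then c • majoranaString S else 0 := by
  refine coeff_ext fun X => ?_
  rw [coeff_truncOp]
  by_cases hXS : X = S
  · subst hXS; split_ifs <;> simp [coeff_zero]
  · split_ifs <;> simp [coeff_smul, coeff_majoranaString, hXS, coeff_zero]

lemma polyOp_truncPoly (ℓ : ℕ) (P : Poly m) :
    polyOp (truncPoly ℓ P).val = truncOp ℓ (polyOp P) := by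
  rw [truncPoly_val]
  induction P with
  | nil => simp [polyOp_nil, truncOp, coeff_zero]
  | cons q P ih =>
    rw [polyOp_cons, truncOp_add, truncOp_smul_majoranaString, List.filter_cons, ← ih]
    by_cases h : q.1.card ≤ ℓ <;> simp [h, polyOp_cons]

lemma truncPoly_nodup (ℓ : ℕ) {P : Poly m} (h : (P.map Prod.fst).Nodup) :
    ((truncPoly ℓ P).val.map Prod.fst).Nodup := by
  rw [truncPoly_val]
  exact h.sublist (List.filter_sublist.map _)

lemma truncPoly_card_le (ℓ : ℕ) (P : Poly m) : ∀ p ∈ (truncPoly ℓ P).val, p.1.card ≤ ℓ := by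
  rw [truncPoly_val]
  intro p hp
  simpa using (List.mem_filter.1 hp).2

lemma truncPoly_keysLE (ℓ : ℕ) (P : Poly m) : KeysLE ℓ (truncPoly ℓ P).val := by
  intro X hX
  obtain ⟨p, hp, rfl⟩ := List.mem_map.1 hX
  exact truncPoly_card_le ℓ P p hp

lemma propagate_succ_val (gs : List (Terms m)) (s : ℝ) (ℓ K : ℕ) (P : Poly m) :
    (propagate gs s ℓ (K + 1) P).val
      = (propagate gs s ℓ K (truncPoly ℓ (trotterStep s gs P).val).val).val := rfl

lemma polyOp_propagate (s : ℝ) (ℓ K : ℕ) {gs : List (Terms m)}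
    (hg : ∀ g ∈ gs, ∀ p ∈ g, Even p.1.card)
    (hd : ∀ g ∈ gs, g.Pairwise (fun p q => Disjoint p.1 q.1)) (P : Poly m) :
    polyOp (propagate gs s ℓ K P).val
      = (fun B => truncOp ℓ (trotterOp gs s B))^[K] (polyOp P) := by
  induction K generalizing P with
  | zero => rfl
  | succ K ih =>
    rw [propagate_succ_val, ih, polyOp_truncPoly, polyOp_trotterStep s hg hd,
      Function.iterate_succ_apply]

lemma propagate_nodup (gs : List (Terms m)) (s : ℝ) (ℓ K : ℕ) {P : Poly m}
    (h : (P.map Prod.fst).Nodup) : ((propagate gs s ℓ K P).val.map Prod.fst).Nodup := by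
  induction K generalizing P with
  | zero => exact h
  | succ K ih => exact ih (truncPoly_nodup ℓ (trotterStep_nodup s h))

lemma propagate_keysLE (gs : List (Terms m)) (s : ℝ) (ℓ K : ℕ) {P : Poly m}
    (h : KeysLE ℓ P) : KeysLE ℓ (propagate gs s ℓ K P).val := by
  induction K generalizing P with
  | zero => exact h
  | succ K ih => exact ih (truncPoly_keysLE ℓ _)

lemma majoranaPropagation_val (L : Terms m) (P : Poly m) (δt : ℝ) (ℓ : ℕ) (t : ℝ) :
    (majoranaPropagation L P δt ℓ t).val
      = (truncPoly ℓ (trotterStep (t - (⌊t / δt⌋₊ : ℝ) * δt) (greedyGroups L).val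
          (propagate (greedyGroups L).val δt ℓ ⌊t / δt⌋₊ P).val).val).val := rfl

lemma polyOp_majoranaPropagation {L : Terms m} (hL : ∀ p ∈ L, Even p.1.card) (P : Poly m)
    (δt : ℝ) (ℓ : ℕ) (t : ℝ) :
    polyOp (majoranaPropagation L P δt ℓ t).val
      = mpOp (greedyGroups L).val δt ℓ t (polyOp P) := by
  obtain ⟨h1, hd⟩ := isDecomposition_greedyGroups L
  have hg : ∀ g ∈ (greedyGroups L).val, ∀ p ∈ g, Even p.1.card := fun g hg p hp =>
    hL p (h1.subset (List.mem_flatten.2 ⟨g, hg, hp⟩))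
  rw [majoranaPropagation_val, polyOp_truncPoly, polyOp_trotterStep _ hg hd,
    polyOp_propagate _ _ _ hg hd, mpOp]

/-! ### Growth of the lists of monomials -/

/-- The number of terms of a group that rotate the string `S`. -/
def oddCount (g : Terms m) (S : Str m) : ℕ := g.countP (fun p => decide (Odd (p.1 ∩ S).card))

/-- An upper bound for the number of monomials after the rotations by a group: each term that
rotates a string doubles the number of monomials. -/
def growth (g : Terms m) (P : Poly m) : ℕ := (P.map (fun q => 2 ^ oddCount g q.1)).sum

lemma oddCount_cons (x : Str m × ℝ) (g : Terms m) (S : Str m) :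
    oddCount (x :: g) S = oddCount g S + if Odd (x.1 ∩ S).card then 1 else 0 := by
  simp [oddCount, List.countP_cons]

lemma oddCount_symmDiff {X : Str m} {g : Terms m} (h : ∀ p ∈ g, Disjoint X p.1) (S : Str m) :
    oddCount g (X ∆ S) = oddCount g S := by
  refine List.countP_congr fun p hp => ?_
  have h1 : p.1 ∩ (X ∆ S) = p.1 ∩ S := by
    have := Finset.disjoint_left.1 (h p hp)
    ext i; simp only [Finset.mem_inter, Finset.mem_symmDiff]; grind
  rw [h1]

lemma countP_mem_le_one {g : Terms m} (hd : g.Pairwise (fun p q => Disjoint p.1 q.1))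
    (i : Fin (2 * m)) : g.countP (fun p => decide (i ∈ p.1)) ≤ 1 := by
  induction g with
  | nil => simp
  | cons x g ih =>
    rw [List.pairwise_cons] at hd
    rw [List.countP_cons]
    split_ifs with hi
    · have : g.countP (fun p => decide (i ∈ p.1)) = 0 := by
        refine List.countP_eq_zero.2 fun p hp hip => ?_
        exact Finset.disjoint_left.1 (hd.1 p hp) (by simpa using hi) (by simpa using hip)
      omega
    · exact ih hd.2

lemma oddCount_le_card {g : Terms m} (hd : g.Pairwise (fun p q => Disjoint p.1 q.1))
    (S : Str m) : oddCount g S ≤ S.card := by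
  calc _ ≤ _ := countP_le_sum g (S := S) fun p hp => not_disjoint_of_odd hp
    _ ≤ ∑ i ∈ S, 1 := Finset.sum_le_sum fun i _ => countP_mem_le_one hd i
    _ = S.card := by simp

lemma growth_append (g : Terms m) (P Q : Poly m) :
    growth g (P ++ Q) = growth g P + growth g Q := by simp [growth]

lemma growth_cons (g : Terms m) (q : Str m × ℂ) (P : Poly m) :
    growth g (q :: P) = 2 ^ oddCount g q.1 + growth g P := by simp [growth]

lemma length_le_growth (g : Terms m) (P : Poly m) : P.length ≤ growth g P := by
  induction P with
  | nil => simp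
  | cons q P ih =>
    rw [growth_cons, List.length_cons]
    have : 1 ≤ 2 ^ oddCount g q.1 := Nat.one_le_two_pow
    omega

lemma growth_rotateMono (s : ℝ) {x : Str m × ℝ} {g : Terms m} (hd : ∀ p ∈ g, Disjoint x.1 p.1)
    (q : Str m × ℂ) : growth g (rotateMono s x q).val = 2 ^ oddCount (x :: g) q.1 := by
  rw [rotateMono_val, oddCount_cons]
  split_ifs with h
  · simp only [growth, List.map_cons, List.map_nil, List.sum_cons, List.sum_nil,
      oddCount_symmDiff hd, pow_succ]
    ring
  · simp [growth]

lemma growth_rotateList (s : ℝ) {x : Str m × ℝ} {g : Terms m} (hd : ∀ p ∈ g, Disjoint x.1 p.1)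
    (P : Poly m) : growth g (rotateList s x P).val = growth (x :: g) P := by
  induction P with
  | nil => rfl
  | cons q P ih =>
    rw [rotateList_cons_val, growth_append, growth_rotateMono s hd, ih, growth_cons]

lemma rotateGroup_length_le (s : ℝ) {g : Terms m}
    (hd : g.Pairwise (fun p q => Disjoint p.1 q.1)) (P : Poly m) :
    (rotateGroup s g P).val.length ≤ growth g P := by
  induction g generalizing P with
  | nil => exact length_le_growth _ _
  | cons x g ih =>
    rw [List.pairwise_cons] at hd
    rw [rotateGroup_cons_val, ← growth_rotateList s hd.1]
    exact ih hd.2 _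

/-- Each term that rotates a string adds at most two to its length. -/
lemma mem_rotateGroup (s : ℝ) {g : Terms m} (hg : ∀ p ∈ g, p.1.card ≤ 4)
    (hd : g.Pairwise (fun p q => Disjoint p.1 q.1)) {E : ℕ} {P : Poly m}
    (hP : ∀ q ∈ P, q.1.card + 2 * oddCount g q.1 ≤ E) :
    ∀ q ∈ (rotateGroup s g P).val, q.1.card ≤ E := by
  induction g generalizing P with
  | nil => exact fun q hq => (Nat.le_add_right _ _).trans (hP q hq)
  | cons x g ih =>
    rw [List.pairwise_cons] at hd
    refine ih (fun p hp => hg p (List.mem_cons_of_mem _ hp)) hd.2 ?_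
    clear ih
    induction P with
    | nil => intro q hq; simp [rotateList] at hq
    | cons p P ih =>
      intro q hq
      rw [rotateList_cons_val, List.mem_append] at hq
      rcases hq with hq | hq
      · have hp := hP p List.mem_cons_self
        rw [rotateMono_val] at hq
        rw [oddCount_cons] at hp
        split_ifs at hq hp with ho
        · have := card_symmDiff_le_add_two (hg x List.mem_cons_self) ho
          simp only [List.mem_cons, List.not_mem_nil, or_false] at hq
          rcases hq with rfl | rfl
          · simp only; omega
          · simp only [oddCount_symmDiff hd.1]; omega
        · rw [List.mem_singleton.1 hq]; omega
      · exact ih (fun r hr => hP r (List.mem_cons_of_mem _ hr)) q hq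

lemma evolveGroup_keysLE (s : ℝ) {g : Terms m} (hg : ∀ p ∈ g, p.1.card ≤ 4)
    (hd : g.Pairwise (fun p q => Disjoint p.1 q.1)) {D : ℕ} {P : Poly m} (hP : KeysLE D P) :
    KeysLE (3 * D) (evolveGroup s g P).val := by
  induction P with
  | nil => intro X hX; simp [evolveGroup] at hX
  | cons q P ih =>
    rw [evolveGroup_cons_val]
    refine addPoly_keysLE ?_ (ih hP.tail)
    intro X hX
    obtain ⟨p, hp, rfl⟩ := List.mem_map.1 hX
    refine mem_rotateGroup s hg hd (P := [q]) ?_ p hp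
    intro r hr
    rw [List.mem_singleton.1 hr]
    have h1 := oddCount_le_card hd q.1
    have h2 := hP.head
    omega

/-! ### The running time -/

lemma rotateMono_cost (s : ℝ) (x : Str m × ℝ) (q : Str m × ℂ) :
    (rotateMono s x q).cost ≤ (2 * m) ^ 2 + 5 * (2 * m) + 9 := by
  rw [rotateMono]
  simp only [Counted.bind_cost, strOddOverlap]
  by_cases h : (x.1 ∩ q.1).card % 2 = 1
  · simp only [h, decide_true, if_true, Counted.bind_cost, rmul, rcos, rsin, cmul, strMul,
      Counted.pure_cost, strSymmDiff, strInversions, strCard, ipow]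
    omega
  · simp only [h, decide_false, Bool.false_eq_true, if_false, Counted.pure_cost]
    omega

lemma rotateList_cost (s : ℝ) (x : Str m × ℝ) (P : Poly m) :
    (rotateList s x P).cost ≤ P.length * ((2 * m) ^ 2 + 5 * (2 * m) + 10) + 1 := by
  induction P with
  | nil => simp [rotateList]
  | cons q P ih =>
    have h := rotateMono_cost s x q
    rw [rotateList]
    simp only [Counted.bind_cost, tick_cost, Counted.pure_cost, List.length_cons, add_mul]
    omega

lemma rotateGroup_cost (s : ℝ) {g : Terms m}
    (hd : g.Pairwise (fun p q => Disjoint p.1 q.1)) (P : Poly m) :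
    (rotateGroup s g P).cost
      ≤ g.length * (growth g P * ((2 * m) ^ 2 + 5 * (2 * m) + 10) + 2) + 1 := by
  induction g generalizing P with
  | nil => simp [rotateGroup]
  | cons x g ih =>
    rw [List.pairwise_cons] at hd
    have h1 := rotateList_cost s x P
    have h2 := ih hd.2 (rotateList s x P).val
    rw [growth_rotateList s hd.1] at h2
    have h3 := Nat.mul_le_mul_right ((2 * m) ^ 2 + 5 * (2 * m) + 10) (length_le_growth (x :: g) P)
    rw [rotateGroup]
    simp only [Counted.bind_cost, tick_cost, List.length_cons]
    rw [add_mul g.length]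
    omega

lemma addMono_cost (q : Str m × ℂ) (P : Poly m) :
    (addMono q P).cost ≤ P.length * (2 * m + 2) + 1 := by
  induction P with
  | nil => simp [addMono]
  | cons p P ih =>
    rw [addMono]
    simp only [Counted.bind_cost, strEq, tick_cost, List.length_cons, add_mul]
    by_cases h : q.1 = p.1
    · simp only [h, decide_true, if_true, Counted.bind_cost, cadd, Counted.pure_cost]
      omega
    · simp only [h, decide_false, Bool.false_eq_true, if_false, Counted.bind_cost,
        Counted.pure_cost]
      omega

lemma addMono_length (q : Str m × ℂ) (P : Poly m) : (addMono q P).val.length ≤ P.length + 1 := by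
  induction P with
  | nil => simp [addMono]
  | cons p P ih =>
    rw [addMono_cons_val]
    split_ifs
    · simp
    · simpa using ih

lemma addPoly_cost (P R : Poly m) :
    (addPoly P R).cost ≤ P.length * ((P.length + R.length) * (2 * m + 2) + 2) + 1 := by
  induction P generalizing R with
  | nil => simp [addPoly]
  | cons q P ih =>
    have h1 := addMono_cost q R
    have h2 := ih (addMono q R).val
    have h3 := addMono_length q R
    rw [addPoly]
    simp only [Counted.bind_cost, tick_cost, List.length_cons]
    have h4 : (P.length + (addMono q R).val.length) * (2 * m + 2)
        ≤ (P.length + 1 + R.length) * (2 * m + 2) := Nat.mul_le_mul_right _ (by omega)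
    have h5 : R.length * (2 * m + 2) ≤ (P.length + 1 + R.length) * (2 * m + 2) :=
      Nat.mul_le_mul_right _ (by omega)
    have h6 := Nat.mul_le_mul_left P.length (Nat.add_le_add_right h4 2)
    rw [add_mul P.length 1]
    omega

lemma truncPoly_cost (ℓ : ℕ) (P : Poly m) :
    (truncPoly ℓ P).cost ≤ P.length * (2 * m + 2) + 1 := by
  induction P with
  | nil => simp [truncPoly]
  | cons q P ih =>
    rw [truncPoly]
    simp only [Counted.bind_cost, tick_cost, strCard, leNat, List.length_cons, add_mul]
    by_cases h : q.1.card ≤ ℓ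
    · simp only [h, decide_true, if_true, Counted.pure_cost]; omega
    · simp only [h, decide_false, Bool.false_eq_true, if_false, Counted.pure_cost]; omega

/-- `M` bounds all sizes that occur in a computation with polynomials of degree at most `D`. -/
structure SizeBound (m D M : ℕ) : Prop where
  modes : (2 * m) ^ 2 + 5 * (2 * m) + 10 ≤ M
  two_pow : 2 ^ D ≤ M
  length : ∀ l : List (Str m), l.Nodup → (∀ X ∈ l, X.card ≤ D) → l.length ≤ M

lemma SizeBound.poly {D M : ℕ} (hM : SizeBound m D M) {P : Poly m} (h : (P.map Prod.fst).Nodup)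
    {k : ℕ} (hk : KeysLE k P) (hkD : k ≤ D) : P.length ≤ M := by
  simpa using hM.length _ h fun X hX => (hk X hX).trans hkD

lemma evolveGroup_cost (s : ℝ) {g : Terms m} (hg : ∀ p ∈ g, p.1.card ≤ 4)
    (hd : g.Pairwise (fun p q => Disjoint p.1 q.1)) {D E M : ℕ} (hM : SizeBound m E M)
    (hDE : 3 * D ≤ E) (hgM : g.length ≤ M) {P : Poly m} (hP : KeysLE D P) :
    (evolveGroup s g P).cost ≤ P.length * (9 * M ^ 3) + 1 := by
  have hM10 : 10 ≤ M := (Nat.le_add_left _ _).trans hM.modes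
  induction P with
  | nil => simp [evolveGroup]
  | cons q P ih =>
    have hgr : growth g [q] ≤ M := by
      have h1 : oddCount g q.1 ≤ E := by
        have := oddCount_le_card hd q.1
        have := hP.head
        omega
      calc growth g [q] = 2 ^ oddCount g q.1 := by simp [growth]
        _ ≤ 2 ^ E := Nat.pow_le_pow_right (by norm_num) h1
        _ ≤ M := hM.two_pow
    have h1 := ih hP.tail
    have h2 := rotateGroup_cost s hd [q]
    have h3 := addPoly_cost (rotateGroup s g [q]).val (evolveGroup s g P).val
    have h4 : (rotateGroup s g [q]).val.length ≤ M := (rotateGroup_length_le s hd [q]).trans hgr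
    have h5 : (evolveGroup s g P).val.length ≤ M :=
      hM.poly (evolveGroup_nodup s g P) (evolveGroup_keysLE s hg hd hP.tail) hDE
    have h6 : 2 * m + 2 ≤ M := by have := hM.modes; omega
    have h7 : (rotateGroup s g [q]).cost ≤ M * (M * M + 2) + 1 :=
      h2.trans (by gcongr; exact hM.modes)
    have h8 : (addPoly (rotateGroup s g [q]).val (evolveGroup s g P).val).cost
        ≤ M * ((M + M) * M + 2) + 1 := h3.trans (by gcongr)
    rw [evolveGroup]
    simp only [Counted.bind_cost, tick_cost, List.length_cons, add_mul]
    have h9 : M * (M * M + 2) + 1 + (M * ((M + M) * M + 2) + 1) + 1 ≤ 9 * M ^ 3 := by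
      nlinarith [Nat.mul_le_mul hM10 hM10, Nat.mul_le_mul (Nat.mul_le_mul hM10 hM10) hM10,
        Nat.mul_le_mul (Nat.mul_le_mul hM10 hM10) (le_refl M)]
    omega

lemma trotterStep_keysLE (s : ℝ) {gs : List (Terms m)} (hg : ∀ g ∈ gs, ∀ p ∈ g, p.1.card ≤ 4)
    (hd : ∀ g ∈ gs, g.Pairwise (fun p q => Disjoint p.1 q.1)) {D : ℕ} {P : Poly m}
    (hP : KeysLE D P) : KeysLE (3 ^ gs.length * D) (trotterStep s gs P).val := by
  induction gs generalizing P D with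
  | nil => simpa [trotterStep] using hP
  | cons g gs ih =>
    rw [trotterStep_cons_val, List.length_cons, pow_succ, mul_assoc]
    exact ih (fun g h => hg g (List.mem_cons_of_mem _ h))
      (fun g h => hd g (List.mem_cons_of_mem _ h))
      (evolveGroup_keysLE s (hg g List.mem_cons_self) (hd g List.mem_cons_self) hP)

lemma trotterStep_cost (s : ℝ) {gs : List (Terms m)} (hg : ∀ g ∈ gs, ∀ p ∈ g, p.1.card ≤ 4)
    (hd : ∀ g ∈ gs, g.Pairwise (fun p q => Disjoint p.1 q.1)) {D E M : ℕ}
    (hM : SizeBound m E M) (hDE : 3 ^ gs.length * D ≤ E) (hgM : ∀ g ∈ gs, g.length ≤ M)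
    {P : Poly m} (hPn : (P.map Prod.fst).Nodup) (hP : KeysLE D P) :
    (trotterStep s gs P).cost ≤ gs.length * (10 * M ^ 4) + 1 := by
  have hM10 : 10 ≤ M := (Nat.le_add_left _ _).trans hM.modes
  induction gs generalizing P D with
  | nil => simp [trotterStep]
  | cons g gs ih =>
    rw [List.length_cons, pow_succ, mul_assoc] at hDE
    have h3 : 1 ≤ 3 ^ gs.length := Nat.one_le_pow _ _ (by norm_num)
    have hDE3 : 3 * D ≤ E := (Nat.le_mul_of_pos_left _ h3).trans hDE
    have h1 := evolveGroup_cost s (hg g List.mem_cons_self) (hd g List.mem_cons_self) hM hDE3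
      (hgM g List.mem_cons_self) hP
    have h2 := ih (fun g h => hg g (List.mem_cons_of_mem _ h))
      (fun g h => hd g (List.mem_cons_of_mem _ h)) hDE
      (fun g h => hgM g (List.mem_cons_of_mem _ h)) (evolveGroup_nodup s g P)
      (evolveGroup_keysLE s (hg g List.mem_cons_self) (hd g List.mem_cons_self) hP)
    have h4 : P.length ≤ M := hM.poly hPn hP (by omega)
    have h5 : P.length * (9 * M ^ 3) ≤ M * (9 * M ^ 3) := Nat.mul_le_mul_right _ h4
    have h6 : M * (9 * M ^ 3) + 2 ≤ 10 * M ^ 4 := by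
      have : 10 ^ 4 ≤ M ^ 4 := Nat.pow_le_pow_left hM10 4
      have h7 : M * (9 * M ^ 3) = 9 * M ^ 4 := by ring
      omega
    rw [trotterStep]
    simp only [Counted.bind_cost, tick_cost, List.length_cons, add_mul]
    omega

lemma propagate_cost (s : ℝ) {gs : List (Terms m)} (hg : ∀ g ∈ gs, ∀ p ∈ g, p.1.card ≤ 4)
    (hd : ∀ g ∈ gs, g.Pairwise (fun p q => Disjoint p.1 q.1)) {ℓ E M : ℕ}
    (hM : SizeBound m E M) (hE : 3 ^ gs.length * ℓ ≤ E) (hgM : ∀ g ∈ gs, g.length ≤ M)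
    (hgsM : gs.length ≤ M) (K : ℕ)
    {P : Poly m} (hPn : (P.map Prod.fst).Nodup) (hP : KeysLE ℓ P) :
    (propagate gs s ℓ K P).cost ≤ K * (12 * M ^ 5) + 1 := by
  have hM10 : 10 ≤ M := (Nat.le_add_left _ _).trans hM.modes
  induction K generalizing P with
  | zero => simp [propagate]
  | succ K ih =>
    have h1 := trotterStep_cost s hg hd hM hE hgM hPn hP
    have h2 := truncPoly_cost ℓ (trotterStep s gs P).val
    have h3 : (trotterStep s gs P).val.length ≤ M :=
      hM.poly (trotterStep_nodup s hPn) (trotterStep_keysLE s hg hd hP) hE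
    have h4 := ih (truncPoly_nodup ℓ (trotterStep_nodup (gs := gs) s hPn))
      (truncPoly_keysLE ℓ (trotterStep s gs P).val)
    have h5 : gs.length * (10 * M ^ 4) ≤ M * (10 * M ^ 4) := Nat.mul_le_mul_right _ hgsM
    have h6 : 2 * m + 2 ≤ M := by have := hM.modes; omega
    have h7 : (trotterStep s gs P).val.length * (2 * m + 2) ≤ M * M := Nat.mul_le_mul h3 h6
    have h8 : M * (10 * M ^ 4) + M * M + 3 ≤ 12 * M ^ 5 := by
      have h9 : M * (10 * M ^ 4) = 10 * M ^ 5 := by ring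
      have h10 : M ^ 2 ≤ M ^ 5 := Nat.pow_le_pow_right (by omega) (by norm_num)
      have h11 : 10 ^ 5 ≤ M ^ 5 := Nat.pow_le_pow_left hM10 5
      have h12 : M * M = M ^ 2 := by ring
      omega
    rw [propagate]
    simp only [Counted.bind_cost, tick_cost, add_mul]
    omega

lemma majoranaPropagation_cost {L : Terms m} (hL : ∀ p ∈ L, p.1.card ≤ 4) {ℓ E M : ℕ}
    (hM : SizeBound m E M) (hE : 3 ^ (greedyGroups L).val.length * ℓ ≤ E) (hLM : L.length ≤ M)
    {P : Poly m} (hPn : (P.map Prod.fst).Nodup) (hP : KeysLE ℓ P) (δt t : ℝ) :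
    (majoranaPropagation L P δt ℓ t).cost ≤ (⌊t / δt⌋₊ + 1) * (20 * M ^ 5) := by
  have hM10 : 10 ≤ M := (Nat.le_add_left _ _).trans hM.modes
  obtain ⟨hperm, hd⟩ := isDecomposition_greedyGroups L
  have hg : ∀ g ∈ (greedyGroups L).val, ∀ p ∈ g, p.1.card ≤ 4 := fun g hg p hp =>
    hL p (hperm.subset (List.mem_flatten.2 ⟨g, hg, hp⟩))
  have hgM : ∀ g ∈ (greedyGroups L).val, g.length ≤ M := fun g hg =>
    ((List.sublist_flatten_of_mem hg).length_le.trans hperm.length_eq.le).trans hLM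
  have hgsM := (greedyGroups_length_le_length L).trans hLM
  set gs := (greedyGroups L).val with hgs
  set K := ⌊t / δt⌋₊ with hK
  set Q := (propagate gs δt ℓ K P).val with hQ
  have hQn : (Q.map Prod.fst).Nodup := propagate_nodup gs δt ℓ K hPn
  have hQk : KeysLE ℓ Q := propagate_keysLE gs δt ℓ K hP
  have h0 := greedyGroups_cost L
  have h1 := propagate_cost δt hg hd hM hE hgM hgsM K hPn hP
  have h2 := trotterStep_cost (t - (K : ℝ) * δt) hg hd hM hE hgM hQn hQk
  have h3 := truncPoly_cost ℓ (trotterStep (t - (K : ℝ) * δt) gs Q).val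
  have h4 : (trotterStep (t - (K : ℝ) * δt) gs Q).val.length ≤ M :=
    hM.poly (trotterStep_nodup _ hQn) (trotterStep_keysLE _ hg hd hQk) hE
  have h5 : gs.length * (10 * M ^ 4) ≤ M * (10 * M ^ 4) := Nat.mul_le_mul_right _ hgsM
  have h6 : 2 * m + 3 ≤ M := by have := hM.modes; omega
  have h7 : (trotterStep (t - (K : ℝ) * δt) gs Q).val.length * (2 * m + 2) ≤ M * M :=
    Nat.mul_le_mul h4 (by omega)
  have h8 : L.length * (2 + L.length * (2 * m + 3)) ≤ M * (2 + M * M) := by gcongr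
  have hcost : (majoranaPropagation L P δt ℓ t).cost = (greedyGroups L).cost + (2 * K + 2
      + ((propagate gs δt ℓ K P).cost + (1 + (1 + ((trotterStep (t - (K : ℝ) * δt) gs Q).cost
      + (truncPoly ℓ (trotterStep (t - (K : ℝ) * δt) gs Q).val).cost))))) := rfl
  rw [hcost, add_mul, one_mul]
  have h9 : M * (10 * M ^ 4) = 10 * M ^ 5 := by ring
  have h10 : M ^ 2 ≤ M ^ 5 := Nat.pow_le_pow_right (by omega) (by norm_num)
  have h11 : 10 ^ 5 ≤ M ^ 5 := Nat.pow_le_pow_left hM10 5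
  have h12 : M * M = M ^ 2 := by ring
  have h13 : M * (2 + M * M) = 2 * M + M ^ 3 := by ring
  have h14 : M ^ 3 ≤ M ^ 5 := Nat.pow_le_pow_right (by omega) (by norm_num)
  have h15 : M ≤ M ^ 5 := Nat.le_self_pow (by norm_num) M
  have h16 : K * (12 * M ^ 5) + K * 2 ≤ K * (20 * M ^ 5) := by
    rw [← mul_add]; exact Nat.mul_le_mul_left _ (by omega)
  omega

/-! ### Sizes as powers of the number of modes -/

lemma card_strings_le (D : ℕ) :
    ((Finset.univ : Finset (Str m)).filter (fun X => X.card ≤ D)).card ≤ (2 * m + 1) ^ D := by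
  -- every string of length at most `D` is the set of values of a map from `Fin D` to the modes
  -- and a blank symbol
  let f : (Fin D → Option (Fin (2 * m))) → Str m :=
    fun a => Finset.univ.filter (fun i => ∃ k, a k = some i)
  have h1 : (Finset.univ : Finset (Str m)).filter (fun X => X.card ≤ D)
      ⊆ Finset.univ.image f := by
    intro X hX
    have hX' : X.card ≤ D := (Finset.mem_filter.1 hX).2
    refine Finset.mem_image.2 ⟨fun k => if h : k.val < X.card then
      some (X.equivFin.symm ⟨k.val, h⟩) else none, Finset.mem_univ _, ?_⟩
    ext i
    simp only [f, Finset.mem_filter, Finset.mem_univ, true_and]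
    constructor
    · rintro ⟨k, hk⟩
      split_ifs at hk with h
      rw [← Option.some.inj hk]
      exact Subtype.coe_prop _
    · intro hi
      refine ⟨⟨(X.equivFin ⟨i, hi⟩).val, (X.equivFin ⟨i, hi⟩).2.trans_le hX'⟩, ?_⟩
      simp
  calc _ ≤ _ := Finset.card_le_card h1
    _ ≤ _ := Finset.card_image_le
    _ = _ := by simp

lemma sizeBound_pow (hm : 1 ≤ m) (D a : ℕ) : SizeBound m D ((2 * m) ^ (2 * D + a + 5)) := by
  have h2 : 2 ≤ 2 * m := by omega
  have hpow : ∀ {i j : ℕ}, i ≤ j → (2 * m) ^ i ≤ (2 * m) ^ j := fun h =>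
    Nat.pow_le_pow_right (by omega) h
  refine ⟨?_, ?_, ?_⟩
  · refine le_trans ?_ (hpow (show 5 ≤ 2 * D + a + 5 by omega))
    generalize 2 * m = N at h2
    have h3 : 8 ≤ N ^ 3 := by simpa using Nat.pow_le_pow_left h2 3
    have h4 : 8 * N ^ 2 ≤ N ^ 5 := by
      calc 8 * N ^ 2 ≤ N ^ 3 * N ^ 2 := Nat.mul_le_mul_right _ h3
        _ = N ^ 5 := by ring
    nlinarith
  · exact (Nat.pow_le_pow_left h2 D).trans (hpow (by omega))
  · intro l hl hD
    have h1 : l.length = l.toFinset.card := (List.toFinset_card_of_nodup hl).symm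
    have h3 : l.toFinset ⊆ (Finset.univ : Finset (Str m)).filter (fun X => X.card ≤ D) := by
      intro X hX
      simpa using hD X (List.mem_toFinset.1 hX)
    have h4 : 2 * m + 1 ≤ (2 * m) ^ 2 := by nlinarith
    calc l.length ≤ (2 * m + 1) ^ D := h1 ▸ (Finset.card_le_card h3).trans (card_strings_le D)
      _ ≤ ((2 * m) ^ 2) ^ D := Nat.pow_le_pow_left h4 D
      _ = (2 * m) ^ (2 * D) := by rw [← pow_mul]
      _ ≤ _ := hpow (by omega)

lemma terms_length_le {Δ : ℕ} {L : Terms m} (h : SparseTerms Δ L) (h0 : ∀ p ∈ L, 0 < p.1.card) :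
    L.length ≤ 2 * m * Δ := by
  have h1 : L.countP (fun p => decide (0 < p.1.card)) = L.length :=
    List.countP_eq_length.2 fun p hp => by simpa using h0 p hp
  have h2 := countP_le_sum L (S := Finset.univ) (q := fun p => 0 < p.1.card) fun p hp => by
    obtain ⟨i, hi⟩ := Finset.card_pos.1 hp
    exact Finset.not_disjoint_iff.2 ⟨i, Finset.mem_univ i, hi⟩
  rw [h1] at h2
  refine h2.trans ((Finset.sum_le_sum fun i _ => h.2 i).trans_eq ?_)
  simp

/-- The running time as a power of the number `2 * m` of modes. -/
lemma majoranaPropagation_cost_le_pow {Δ : ℕ} (hm : 1 ≤ m) {L : Terms m} (h : SparseTerms Δ L)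
    (h0 : ∀ p ∈ L, 0 < p.1.card) {ℓ : ℕ} {P : Poly m} (hPn : (P.map Prod.fst).Nodup)
    (hP : KeysLE ℓ P) (δt t : ℝ) :
    (majoranaPropagation L P δt ℓ t).cost
      ≤ (⌊t / δt⌋₊ + 1) * (2 * m) ^ (10 * (3 ^ (4 * Δ) * ℓ) + 5 * Δ + 30) := by
  have h2 : 2 ≤ 2 * m := by omega
  have hM := sizeBound_pow hm (3 ^ (4 * Δ) * ℓ) Δ
  have hE : 3 ^ (greedyGroups L).val.length * ℓ ≤ 3 ^ (4 * Δ) * ℓ :=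
    Nat.mul_le_mul_right _ (Nat.pow_le_pow_right (by norm_num) (greedyGroups_length_le h h0))
  have hLM : L.length ≤ (2 * m) ^ (2 * (3 ^ (4 * Δ) * ℓ) + Δ + 5) := by
    calc L.length ≤ 2 * m * Δ := terms_length_le h h0
      _ ≤ 2 * m * (2 * m) ^ Δ :=
        Nat.mul_le_mul_left _ (Nat.lt_two_pow_self.le.trans (Nat.pow_le_pow_left h2 Δ))
      _ = (2 * m) ^ (Δ + 1) := by ring
      _ ≤ _ := Nat.pow_le_pow_right (by omega) (by omega)
  refine (majoranaPropagation_cost (fun p hp => (h.1 p hp).2.1) hM hE hLM hPn hP δt t).trans ?_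
  refine Nat.mul_le_mul_left _ ?_
  have h5 : 20 ≤ (2 * m) ^ 5 := by
    have := Nat.pow_le_pow_left h2 5
    omega
  calc _ ≤ (2 * m) ^ 5 * ((2 * m) ^ (2 * (3 ^ (4 * Δ) * ℓ) + Δ + 5)) ^ 5 :=
        Nat.mul_le_mul_right _ h5
    _ = _ := by rw [← pow_mul, ← pow_add]; congr 1; ring

/-! ### Lists of terms and expansions -/

lemma termsOp_perm {L L' : Terms m} (h : L.Perm L') : termsOp L = termsOp L' :=
  (h.map _).sum_eq

lemma termsOp_eq_polyOp (L : Terms m) :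
    termsOp L = polyOp (L.map (fun p => (p.1, (p.2 : ℂ)))) := by
  simp [termsOp, polyOp, Function.comp_def]

lemma coeff_polyOp_of_notMem {P : Poly m} {X : Str m} (h : X ∉ P.map Prod.fst) :
    coeff (polyOp P) X = 0 := by
  induction P with
  | nil => rw [polyOp_nil, coeff_zero]
  | cons q P ih =>
    rw [List.map_cons, List.mem_cons, not_or] at h
    rw [polyOp_cons, coeff_add, coeff_smul, coeff_majoranaString, if_neg h.1, ih h.2]
    simp

lemma coeff_polyOp_of_mem {P : Poly m} (h : (P.map Prod.fst).Nodup) {p : Str m × ℂ}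
    (hp : p ∈ P) : coeff (polyOp P) p.1 = p.2 := by
  induction P with
  | nil => simp at hp
  | cons q P ih =>
    rw [List.map_cons, List.nodup_cons] at h
    rw [polyOp_cons, coeff_add, coeff_smul, coeff_majoranaString]
    rcases List.mem_cons.1 hp with rfl | hp
    · rw [if_pos rfl, coeff_polyOp_of_notMem h.1]; simp
    · have hne : p.1 ≠ q.1 := fun heq => h.1 (heq ▸ List.mem_map_of_mem hp)
      rw [if_neg hne, ih h.2 hp]; simp

lemma IsTermList.coeff_eq {L : Terms m} {H : Obs m} (h : IsTermList L H) {p : Str m × ℝ}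
    (hp : p ∈ L) : coeff H p.1 = p.2 := by
  rw [← h.2.2, termsOp_eq_polyOp]
  have hn : ((L.map (fun p => (p.1, (p.2 : ℂ)))).map Prod.fst).Nodup := by
    rw [List.map_map]; exact h.1
  exact coeff_polyOp_of_mem hn (p := (p.1, (p.2 : ℂ))) (List.mem_map_of_mem hp)

lemma IsTermList.coeff_ne_zero {L : Terms m} {H : Obs m} (h : IsTermList L H) {p : Str m × ℝ}
    (hp : p ∈ L) : coeff H p.1 ≠ 0 := by
  rw [h.coeff_eq hp]
  exact_mod_cast h.2.1 p hp

lemma IsTermList.countP_le {Δ : ℕ} {L : Terms m} {H : Obs m} (h : IsTermList L H)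
    (hs : IsSparse Δ H) (i : Fin (2 * m)) : L.countP (fun p => decide (i ∈ p.1)) ≤ Δ := by
  have hn : ((L.filter (fun p => decide (i ∈ p.1))).map Prod.fst).Nodup :=
    h.1.sublist (List.filter_sublist.map _)
  rw [List.countP_eq_length_filter, ← List.length_map (f := Prod.fst),
    ← List.toFinset_card_of_nodup hn]
  refine (Finset.card_le_card fun X hX => ?_).trans (hs i)
  obtain ⟨p, hp, rfl⟩ := List.mem_map.1 (List.mem_toFinset.1 hX)
  obtain ⟨hpL, hpi⟩ := List.mem_filter.1 hp
  exact Finset.mem_filter.2 ⟨Finset.mem_univ _, by simpa using hpi, h.coeff_ne_zero hpL⟩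

lemma IsTermList.quadraticOrWeakQuartic {u : ℝ} (hu : 0 ≤ u) {L : Terms m} {H₀ V H : Obs m}
    (h : IsTermList L H) (hH : H = H₀ + (u : ℂ) • V) (hH₀ : IsInteraction 2 H₀)
    (hV : IsInteraction 4 V) : QuadraticOrWeakQuartic u L := by
  intro p hp
  have h1 := h.coeff_eq hp
  have h2 := h.coeff_ne_zero hp
  rw [hH, coeff_add, coeff_smul] at h1 h2
  by_cases h0 : coeff H₀ p.1 = 0
  · right
    rw [h0, zero_add] at h1 h2
    refine ⟨(hV p.1).1 (right_ne_zero_of_mul h2), ?_⟩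
    have h3 := congrArg norm h1
    rw [norm_mul, Complex.norm_real, Complex.norm_real, Real.norm_of_nonneg hu,
      Real.norm_eq_abs] at h3
    rw [← h3]
    exact mul_le_of_le_one_right hu (hV p.1).2
  · exact Or.inl ((hH₀ p.1).1 h0)

lemma IsTermList.sparseTerms {Δ : ℕ} {u : ℝ} (hu : 0 ≤ u) (hu1 : u ≤ 1) {L : Terms m}
    {H₀ V H : Obs m} (h : IsTermList L H) (hH : H = H₀ + (u : ℂ) • V)
    (hH₀ : IsInteraction 2 H₀) (hV : IsInteraction 4 V) (hs : IsSparse Δ H) :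
    SparseTerms Δ L := by
  refine ⟨fun p hp => ?_, h.countP_le hs⟩
  rcases h.quadraticOrWeakQuartic hu hH hH₀ hV p hp with h2 | ⟨h4, hpu⟩
  · refine ⟨by rw [h2]; decide, by omega, ?_⟩
    have hv : coeff V p.1 = 0 := by
      by_contra hne
      have := (hV p.1).1 hne
      omega
    have h1 := h.coeff_eq hp
    rw [hH, coeff_add, coeff_smul, hv, mul_zero, add_zero] at h1
    have h3 := (hH₀ p.1).2
    rwa [h1, Complex.norm_real, Real.norm_eq_abs] at h3
  · exact ⟨by rw [h4]; decide, by omega, hpu.trans hu1⟩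

lemma IsExpansion.keysLE {P : Poly m} {A : Obs m} (h : IsExpansion P A) : KeysLE (deg A) P := by
  intro X hX
  obtain ⟨p, hp, rfl⟩ := List.mem_map.1 hX
  refine degLE_deg A p.1 ?_
  rw [← h.2.2, coeff_polyOp_of_mem h.1 hp]
  exact h.2.1 p hp

/-! ### The choice of the parameters -/

/-- The parameters for small `log ((1 + t) / ε)`: the time is short and the accuracy is low, so a
single step without increase of the degree is enough. -/
lemma parameters_small {c t ε : ℝ} (hc : 0 ≤ c) (ht : 0 ≤ t) (hε : 0 < ε) (hε1 : ε < 1)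
    (h : Real.log ((1 + t) / ε) < 1 / (4 * (c + 1))) : c * t ≤ ε := by
  set y := ε / (1 + t) with hy
  have ht1 : 0 < 1 + t := by linarith
  have hy0 : 0 < y := by positivity
  have hlog : Real.log ((1 + t) / ε) = -Real.log y := by
    rw [← Real.log_inv, hy, inv_div]
  have h1 : 1 - y ≤ 1 / (4 * (c + 1)) := by
    have := Real.one_sub_inv_le_log_of_pos (inv_pos.2 hy0)
    rw [inv_inv, Real.log_inv] at this
    linarith
  have h2 : (1 - y) * (4 * (c + 1)) ≤ 1 := by rwa [le_div_iff₀ (by positivity)] at h1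
  have hyε : y * (1 + t) = ε := div_mul_cancel₀ _ ht1.ne'
  have hyle : y ≤ ε := div_le_self hε.le (by linarith)
  have h3 : 0 < 1 - y := by linarith
  have h2' : 4 * (c * (1 - y)) + 4 * (1 - y) ≤ 1 := by linarith
  have hcy : 0 ≤ c * (1 - y) := by positivity
  have h5 : 3 / 4 ≤ y := by linarith
  have h6 : t * y ≤ 1 - y := by linarith
  have h7 : c * t * y ≤ ε * y := by
    calc c * t * y = c * (t * y) := by ring
      _ ≤ c * (1 - y) := by gcongr
      _ ≤ 3 / 4 * (3 / 4) := by linarith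
      _ ≤ ε * y := by gcongr; linarith
  exact le_of_mul_le_mul_right h7 hy0

/-- The parameters in the general case, with `x = ℓ + 1`: the time step makes the sum of the Trotter
errors at most `ε / 2`, and the lower bound for `x` makes that of the truncation errors at most
`ε / 2`. The bound for the number of steps controls the running time. -/
lemma parameters_large {κ d x t ε δ : ℝ} (hκ : 1 ≤ κ) (hx : 1 ≤ x)
    (ht : 0 ≤ t) (hε : 0 < ε) (hε1 : ε < 1)
    (hδ : δ = ε / (1 + t) / (2 * κ * x ^ 2))
    (hxl : 4 * Real.log ((1 + t) / ε) + 2 * d + 2 * Real.log (128 * κ) ≤ x) :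
    (⌊t / δ⌋₊ + 1) * (κ * x ^ 2 * δ ^ 2 + Real.exp (d - 3 / 4 * x)) ≤ ε ∧
      ((⌊t / δ⌋₊ : ℝ) + 1) ≤ Real.exp (2 * Real.log ((1 + t) / ε)) * (2 * κ * x ^ 2) := by
  have ht1 : 0 < 1 + t := by linarith
  have hδ0 : 0 < δ := by rw [hδ]; positivity
  set lam := Real.log ((1 + t) / ε) with hlam
  have hexp : Real.exp lam = (1 + t) / ε := Real.exp_log (by positivity)
  have hκx : 1 ≤ κ * x ^ 2 := one_le_mul_of_one_le_of_one_le hκ (one_le_pow₀ hx)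
  have hδ1 : δ ≤ 1 := by
    rw [hδ, div_div, div_le_one (by positivity), mul_assoc 2]
    calc ε ≤ 1 * (2 * 1) := by linarith
      _ ≤ (1 + t) * (2 * (κ * x ^ 2)) := by gcongr; linarith
  have hK : (⌊t / δ⌋₊ : ℝ) * δ ≤ t := by
    have := Nat.floor_le (a := t / δ) (by positivity)
    rwa [le_div_iff₀ hδ0] at this
  have hK1 : ((⌊t / δ⌋₊ : ℝ) + 1) * δ ≤ 1 + t := by linarith
  have hK2 : ((⌊t / δ⌋₊ : ℝ) + 1) ≤ (1 + t) * (Real.exp lam * (2 * κ * x ^ 2)) := by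
    rw [← le_div_iff₀ hδ0] at hK1
    refine hK1.trans_eq ?_
    rw [hδ, hexp]; field_simp
  have htexp : 1 + t ≤ Real.exp lam := by
    rw [hexp, le_div_iff₀ hε]; nlinarith
  refine ⟨?_, ?_⟩
  · have h1 : ((⌊t / δ⌋₊ : ℝ) + 1) * (κ * x ^ 2 * δ ^ 2) ≤ ε / 2 := by
      calc ((⌊t / δ⌋₊ : ℝ) + 1) * (κ * x ^ 2 * δ ^ 2)
          = (((⌊t / δ⌋₊ : ℝ) + 1) * δ) * (κ * x ^ 2 * δ) := by ring
        _ ≤ (1 + t) * (κ * x ^ 2 * δ) := by gcongr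
        _ = ε / 2 := by rw [hδ]; field_simp
    have hx2 : x ^ 2 ≤ 32 * Real.exp (x / 4) := by
      have := Real.quadratic_le_exp_of_nonneg (x := x / 4) (by positivity)
      have h3 : (x / 4) ^ 2 / 2 = x ^ 2 / 32 := by ring
      linarith
    have hsmall : 128 * κ * Real.exp (2 * lam + d - x / 2) ≤ 1 := by
      have h128 : Real.exp (Real.log (128 * κ)) = 128 * κ := Real.exp_log (by positivity)
      rw [← h128, ← Real.exp_add, Real.exp_le_one_iff]
      linarith
    have h2 : ((⌊t / δ⌋₊ : ℝ) + 1) * Real.exp (d - 3 / 4 * x) ≤ ε / 2 := by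
      calc ((⌊t / δ⌋₊ : ℝ) + 1) * Real.exp (d - 3 / 4 * x)
          ≤ (1 + t) * (Real.exp lam * (2 * κ * (32 * Real.exp (x / 4)))) *
            Real.exp (d - 3 / 4 * x) := by
            refine mul_le_mul_of_nonneg_right (hK2.trans ?_) (Real.exp_nonneg _)
            gcongr
        _ = ε / 2 * (128 * κ * Real.exp (2 * lam + d - x / 2)) := by
            have h3 : 2 * lam + d - x / 2 = lam + lam + x / 4 + (d - 3 / 4 * x) := by ring
            rw [h3, Real.exp_add, Real.exp_add, Real.exp_add]
            have h4 : 1 + t = ε * Real.exp lam := by rw [hexp]; field_simp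
            rw [h4]; ring
        _ ≤ ε / 2 := mul_le_of_le_one_right (by positivity) hsmall
    rw [mul_add]; linarith
  · refine hK2.trans ?_
    rw [two_mul lam, Real.exp_add, mul_assoc (Real.exp lam)]
    exact mul_le_mul_of_nonneg_right htexp (by positivity)

/-- The time step and the truncation degree. The last alternative distinguishes short times with
low accuracy from the general case. -/
lemma exists_parameters (Δ d : ℕ) :
    ∃ C : ℝ, 0 < C ∧ ∀ t ε : ℝ, 0 ≤ t → 0 < ε → ε < 1 → ∃ (δt : ℝ) (ℓ : ℕ),
      0 < δt ∧ d ≤ ℓ ∧ (ℓ : ℝ) ≤ d + C * Real.log ((1 + t) / ε) ∧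
      ((⌊t / δt⌋₊ : ℝ) + 1) ≤ Real.exp (C * Real.log ((1 + t) / ε)) ∧
      ((ℓ = d ∧ ⌊t / δt⌋₊ = 0 ∧ (4 * Δ + 1) * (2 * Δ * (d + 2)) * t ≤ ε) ∨
        (⌊t / δt⌋₊ + 1) * ((2 * (4 * Δ) + 1) * (2 * Δ * (ℓ + 4)) ^ 2 * δt ^ 2
          + Real.exp (d - 3 / 4 * (ℓ + 1))) ≤ ε) := by
  set c : ℝ := (4 * Δ + 1) * (2 * Δ * (d + 2)) with hc
  have hc0 : 0 ≤ c := by positivity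
  set κ : ℝ := (2 * (4 * Δ) + 1) * (2 * Δ) ^ 2 * 16 + 1 with hκ
  have hκ1 : 1 ≤ κ := by
    have : (0 : ℝ) ≤ (2 * (4 * Δ) + 1) * (2 * Δ) ^ 2 * 16 := by positivity
    linarith
  set r : ℝ := 4 * (c + 1) with hr
  have hr0 : 0 < r := by positivity
  have hlog128 : 0 ≤ Real.log (128 * κ) := Real.log_nonneg (by linarith)
  have hlog2 : 0 ≤ Real.log (2 * κ) := Real.log_nonneg (by linarith)
  -- for `r * lam ≥ 1`, the constants in the exponents are absorbed in multiples of `lam`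
  set C₁ : ℝ := 4 + (2 * d + 2 * Real.log (128 * κ)) * r with hC₁
  have hC₁0 : 0 ≤ C₁ := by positivity
  set C : ℝ := 2 + 2 * (C₁ + r) + (Real.log (2 * κ) + 2 * d) * r with hC
  have hC0 : 0 < C := by positivity
  have hCC : C₁ + r ≤ C := by
    have : 0 ≤ (Real.log (2 * κ) + 2 * d) * r := by positivity
    linarith
  refine ⟨C, hC0, fun t ε ht hε hε1 => ?_⟩
  set lam := Real.log ((1 + t) / ε) with hlam
  have hlam0 : 0 ≤ lam := Real.log_nonneg (by rw [le_div_iff₀ hε]; linarith)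
  by_cases hsmall : lam < 1 / r
  · have hfl : ⌊t / (t + 1)⌋₊ = 0 := by
      rw [Nat.floor_eq_zero, div_lt_one (by linarith)]; linarith
    refine ⟨t + 1, d, by linarith, le_rfl, ?_, ?_, Or.inl ⟨rfl, hfl, ?_⟩⟩
    · have : 0 ≤ C * lam := by positivity
      linarith
    · rw [hfl]
      simpa using Real.one_le_exp (by positivity : 0 ≤ C * lam)
    · exact parameters_small hc0 ht hε hε1 hsmall
  · have hlr : 1 ≤ r * lam := by
      rw [not_lt, div_le_iff₀ hr0] at hsmall; linarith
    set ℓ : ℕ := d + ⌈C₁ * lam⌉₊ with hℓ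
    have hℓ1 : d + C₁ * lam ≤ ℓ := by
      rw [hℓ]; push_cast; linarith [Nat.le_ceil (C₁ * lam)]
    have hℓ2 : (ℓ : ℝ) ≤ d + (C₁ + r) * lam := by
      rw [hℓ]; push_cast
      have := (Nat.ceil_lt_add_one (a := C₁ * lam) (by positivity)).le
      linarith
    have hx1 : (1 : ℝ) ≤ ℓ + 1 := by linarith [(Nat.cast_nonneg ℓ : (0 : ℝ) ≤ ℓ)]
    have hxl : 4 * lam + 2 * d + 2 * Real.log (128 * κ) ≤ ℓ + 1 := by
      have h1 : (2 * d + 2 * Real.log (128 * κ)) * 1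
          ≤ (2 * d + 2 * Real.log (128 * κ)) * (r * lam) := by gcongr
      have h2 : C₁ * lam = 4 * lam + (2 * d + 2 * Real.log (128 * κ)) * (r * lam) := by
        rw [hC₁]; ring
      have h3 : (0 : ℝ) ≤ d := Nat.cast_nonneg d
      linarith
    obtain ⟨h1, h2⟩ := parameters_large hκ1 hx1 ht hε hε1 rfl hxl
    refine ⟨ε / (1 + t) / (2 * κ * ((ℓ : ℝ) + 1) ^ 2), ℓ, by positivity, Nat.le_add_right _ _,
      hℓ2.trans (by gcongr), h2.trans ?_, Or.inr (le_trans ?_ h1)⟩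
    · have hx : (ℓ : ℝ) + 1 ≤ Real.exp (d + (C₁ + r) * lam) :=
        (Real.add_one_le_exp _).trans (Real.exp_le_exp.2 hℓ2)
      calc Real.exp (2 * lam) * (2 * κ * ((ℓ : ℝ) + 1) ^ 2)
          ≤ Real.exp (2 * lam) * (Real.exp (Real.log (2 * κ)) *
            Real.exp (d + (C₁ + r) * lam) ^ 2) := by
            rw [Real.exp_log (by positivity)]; gcongr
        _ = Real.exp (2 * lam + Real.log (2 * κ) + 2 * (d + (C₁ + r) * lam)) := by
            rw [← Real.exp_nat_mul, ← Real.exp_add, ← Real.exp_add]; push_cast; congr 1; ring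
        _ ≤ Real.exp (C * lam) := by
            refine Real.exp_le_exp.2 ?_
            have h3 : (Real.log (2 * κ) + 2 * d) * 1 ≤ (Real.log (2 * κ) + 2 * d) * (r * lam) := by
              gcongr
            have h4 : C * lam = 2 * lam + 2 * ((C₁ + r) * lam)
                + (Real.log (2 * κ) + 2 * d) * (r * lam) := by rw [hC]; ring
            linarith
    · refine mul_le_mul_of_nonneg_left (add_le_add
        (mul_le_mul_of_nonneg_right ?_ (sq_nonneg _)) le_rfl) (by positivity)
      have h3 : ((ℓ : ℝ) + 4) ^ 2 ≤ 16 * ((ℓ : ℝ) + 1) ^ 2 := by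
        rw [show (16 : ℝ) * ((ℓ : ℝ) + 1) ^ 2 = (4 * (ℓ + 1)) ^ 2 by ring]
        exact pow_le_pow_left₀ (by positivity) (by linarith [(Nat.cast_nonneg ℓ : (0 : ℝ) ≤ ℓ)]) 2
      calc (2 * (4 * (Δ : ℝ)) + 1) * (2 * Δ * ((ℓ : ℝ) + 4)) ^ 2
          = (2 * (4 * (Δ : ℝ)) + 1) * (2 * Δ) ^ 2 * ((ℓ : ℝ) + 4) ^ 2 := by ring
        _ ≤ (2 * (4 * (Δ : ℝ)) + 1) * (2 * Δ) ^ 2 * (16 * ((ℓ : ℝ) + 1) ^ 2) := by gcongr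
        _ ≤ κ * ((ℓ : ℝ) + 1) ^ 2 := by
            rw [hκ]; linarith [sq_nonneg ((ℓ : ℝ) + 1)]

/-- Within the time horizon the exponents of the weights decrease by at most `1 / 4` in total, since
`u * log (e / u) ≤ 1`. -/
lemma weight_loss_le {Δ d : ℕ} {u t : ℝ} (hu : 0 ≤ u) (ht : 0 ≤ t)
    (h : 0 < u → 16 * Real.exp 1 ^ 2 * (Δ : ℝ) * ((d : ℝ) + 2) * t ≤ Real.log (Real.exp 1 / u)) :
    4 * Δ * (2 * Real.exp 1 ^ 2 * (t * u)) ≤ 1 / 4 := by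
  rcases hu.eq_or_lt with rfl | hu
  · simp
  · have h1 := h hu
    rw [Real.log_div (Real.exp_pos 1).ne' hu.ne', Real.log_exp] at h1
    have h2 := Real.one_sub_inv_le_log_of_pos hu
    have h3 : u * (1 - Real.log u) ≤ 1 := by
      calc u * (1 - Real.log u) ≤ u * u⁻¹ := by gcongr; linarith
        _ = 1 := mul_inv_cancel₀ hu.ne'
    have h4 := mul_le_mul_of_nonneg_left h1 hu.le
    have h5 : 0 ≤ Real.exp 1 ^ 2 * Δ * t * u * d := by positivity
    have h6 : u * (16 * Real.exp 1 ^ 2 * Δ * (d + 2) * t)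
        = 16 * (Real.exp 1 ^ 2 * Δ * t * u * d) + 32 * (Real.exp 1 ^ 2 * Δ * t * u) := by ring
    have h7 : 4 * Δ * (2 * Real.exp 1 ^ 2 * (t * u)) = 8 * (Real.exp 1 ^ 2 * Δ * t * u) := by ring
    linarith

end MajoranaPropagation

theorem corollary1p3 (Δ d : ℕ) :
    -- the constant in the `O(·)` depends on the sparsity `Δ` and on `d = deg A` only
    ∃ C : ℝ, 0 < C ∧
      ∀ t ε : ℝ, 0 ≤ t → 0 < ε → ε < 1 →
        -- the parameters of the algorithm depend on `Δ`, `deg A`, `t` and `ε` only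
        ∃ (δt : ℝ) (ℓ : ℕ), 0 < δt ∧ d ≤ ℓ ∧ (ℓ : ℝ) ≤ d + C * Real.log ((1 + t) / ε) ∧
          ∀ (m : ℕ), 1 ≤ m → ∀ (u : ℝ) (H₀ V H A : Obs m) (L : Terms m) (P : Poly m),
            0 ≤ u → u ≤ 1 →
            H = H₀ + (u : ℂ) • V → IsInteraction 2 H₀ → IsInteraction 4 V → H.IsHermitian →
            IsSparse Δ H → deg A = d →
            -- `t ≤ log (e / u) / (16 e² Δ (deg A + 2))`, which is no condition for `u = 0`
            (0 < u → 16 * Real.exp 1 ^ 2 * (Δ : ℝ) * ((d : ℝ) + 2) * t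
              ≤ Real.log (Real.exp 1 / u)) →
            IsTermList L H → IsExpansion P A →
            -- the terms of `H` are decomposed into at most `4 Δ` groups of disjoint strings
            IsDecomposition (greedyGroups L).val L ∧ (greedyGroups L).val.length ≤ 4 * Δ ∧
            ∃ A' : Obs m,
              -- `A'` is the operator of Majorana Propagation, and it is what the algorithm computes
              A' = mpOp (greedyGroups L).val δt ℓ t A ∧
              polyOp (majoranaPropagation L P δt ℓ t).val = A' ∧
              -- as a Majorana polynomial of degree at most `ℓ`
              ((majoranaPropagation L P δt ℓ t).val.map Prod.fst).Nodup ∧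
              (∀ p ∈ (majoranaPropagation L P δt ℓ t).val, p.1.card ≤ ℓ) ∧
              deg A' ≤ ℓ ∧
              -- the accuracy
              frobNorm (heisenberg H t A - A') ≤ ε * frobNorm A ∧
              -- the running time, with `N = 2 m`
              ((majoranaPropagation L P δt ℓ t).cost : ℝ)
                ≤ ((2 * m : ℕ) : ℝ) ^ (C * (1 + Real.log ((1 + t) / ε))) := by
  obtain ⟨C, hC, hpar⟩ := exists_parameters Δ d
  refine ⟨2 * C + 10 * 3 ^ (4 * Δ) * (d + C) + 5 * Δ + 30, by positivity,
    fun t ε ht hε hε1 => ?_⟩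
  obtain ⟨δt, ℓ, hδ, hdℓ, hℓ, hK, herr⟩ := hpar t ε ht hε hε1
  have hlam : 0 ≤ Real.log ((1 + t) / ε) :=
    Real.log_nonneg (by rw [le_div_iff₀ hε]; linarith)
  set lam := Real.log ((1 + t) / ε) with hlamdef
  have hp3 : (0 : ℝ) ≤ 10 * 3 ^ (4 * Δ) * (d + C) := by positivity
  refine ⟨δt, ℓ, hδ, hdℓ, hℓ.trans ?_, ?_⟩
  · have : C * lam ≤ (2 * C + 10 * 3 ^ (4 * Δ) * (d + C) + 5 * Δ + 30) * lam := by
      refine mul_le_mul_of_nonneg_right ?_ hlam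
      linarith [(Nat.cast_nonneg Δ : (0 : ℝ) ≤ Δ)]
    linarith
  intro m hm u H₀ V H A L P hu hu1 hH hH₀ hV _ hs hdeg htu hL hP
  have hsparse : SparseTerms Δ L := hL.sparseTerms hu hu1 hH hH₀ hV hs
  have hqq := hL.quadraticOrWeakQuartic hu hH hH₀ hV
  have hpos : ∀ p ∈ L, 0 < p.1.card := fun p hp => by
    rcases hqq p hp with h | ⟨h, -⟩ <;> omega
  have hdec := isDecomposition_greedyGroups L
  have hG := greedyGroups_length_le hsparse hpos
  have hkeys : KeysLE ℓ P := fun X hX => (hP.keysLE X hX).trans (hdeg ▸ hdℓ)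
  have hAd : DegLE d A := hdeg ▸ degLE_deg A
  have hop := polyOp_majoranaPropagation (fun p hp => (hsparse.1 p hp).1) P δt ℓ t
  rw [hP.2.2] at hop
  refine ⟨hdec, hG, _, rfl, hop, ?_, ?_, ?_, ?_, ?_⟩
  · rw [majoranaPropagation_val]
    exact truncPoly_nodup ℓ (trotterStep_nodup _ (propagate_nodup _ _ _ _ hP.1))
  · rw [majoranaPropagation_val]
    exact truncPoly_card_le ℓ _
  · exact (degLE_truncOp ℓ _).deg_le
  · have hA := frobNorm_nonneg A
    have hflat : SparseTerms Δ (greedyGroups L).val.flatten := hsparse.perm hdec.1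
    have hHf : H = termsOp (greedyGroups L).val.flatten := by
      rw [termsOp_perm hdec.1, hL.2.2]
    have hGr : ((greedyGroups L).val.length : ℝ) ≤ 4 * Δ := by exact_mod_cast hG
    rw [hHf]
    rcases herr with ⟨rfl, hK0, hct⟩ | herr
    · rw [mpOp, hK0]
      simp only [Function.iterate_zero, id_eq, Nat.cast_zero, zero_mul, sub_zero]
      refine (frobNorm_heisenberg_sub_truncOp_trotterOp_le ht hflat hAd).trans ?_
      refine mul_le_mul_of_nonneg_right (le_trans ?_ hct) hA
      gcongr
    · have hut : (greedyGroups L).val.length * (2 * Real.exp 1 ^ 2 * (t * u)) ≤ 1 / 4 :=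
        le_trans (by gcongr) (weight_loss_le hu ht htu)
      refine (frobNorm_heisenberg_sub_mpOp_le hδ ht hu hdℓ hflat
        (fun g hg p hp => hqq p (hdec.1.subset (List.mem_flatten.2 ⟨g, hg, hp⟩)))
        hdec.2 hut hAd).trans ?_
      rw [← mul_assoc]
      refine mul_le_mul_of_nonneg_right (le_trans ?_ herr) hA
      gcongr
  · have hcost := majoranaPropagation_cost_le_pow hm hsparse hpos hP.1 hkeys δt t
    have hN : (2 : ℝ) ≤ ((2 * m : ℕ) : ℝ) := by exact_mod_cast (by omega : 2 ≤ 2 * m)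
    have hcost' : ((majoranaPropagation L P δt ℓ t).cost : ℝ) ≤ ((⌊t / δt⌋₊ : ℝ) + 1) *
        ((2 * m : ℕ) : ℝ) ^ (10 * (3 ^ (4 * Δ) * ℓ) + 5 * Δ + 30) := by exact_mod_cast hcost
    refine hcost'.trans ?_
    generalize ((2 * m : ℕ) : ℝ) = N at hN
    have hN0 : 0 < N := by linarith
    -- `N ≥ 2`, so the number of steps is a power of `N` as well
    have hexp : Real.exp (C * lam) ≤ N ^ (2 * (C * lam)) := by
      rw [Real.rpow_def_of_pos hN0]
      refine Real.exp_le_exp.2 ?_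
      have h1 : 1 / 2 ≤ Real.log N := by
        have := Real.log_le_log (by norm_num) hN
        linarith [Real.log_two_gt_d9]
      have h2 : 0 ≤ C * lam := by positivity
      nlinarith
    calc _ ≤ N ^ (2 * (C * lam)) * N ^ (((10 * (3 ^ (4 * Δ) * ℓ) + 5 * Δ + 30 : ℕ)) : ℝ) := by
          rw [Real.rpow_natCast]
          gcongr
          exact hK.trans hexp
      _ = N ^ (2 * (C * lam) + ((10 * (3 ^ (4 * Δ) * ℓ) + 5 * Δ + 30 : ℕ) : ℝ)) := by
          rw [Real.rpow_add hN0]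
      _ ≤ _ := by
          refine Real.rpow_le_rpow_of_exponent_le (by linarith) ?_
          push_cast
          have h1 : (10 : ℝ) * (3 ^ (4 * Δ) * ℓ) ≤ 10 * 3 ^ (4 * Δ) * (d + C * lam) := by
            rw [← mul_assoc]; gcongr
          have h2 : (0 : ℝ) ≤ (10 * 3 ^ (4 * Δ) * d + 5 * Δ + 30) * lam := by positivity
          have h3 : (0 : ℝ) ≤ 2 * C + 10 * 3 ^ (4 * Δ) * C := by positivity
          nlinarith
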